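/- **Notation.** A simplicial set $X_\bullet$ is *2-Segal* if for every $n\ge 2$ and every triangulation $T$ of the convex polygon with vertices $0,\dots,n$ the natural map from $X_n$ to the iterated fibre product over $X_1$ of copies of $X_2$, one copy for each triangle of $T$ and glued along the common sides of triangles, is a bijection. In particular $\psi\mapsto(d_3\psi,d_1\psi)$ and $\psi\mapsto(d_2\psi,d_0\psi)$ are bijections $X_3\cong X_2\times_{d_1,X_1,d_2}X_2$ and $X_3\cong X_2\times_{d_1,X_1,d_0}X_2$. $\mathrm{Span}$ is the symmetric monoidal bicategory of sets, spans of sets (composed by fibre product) and maps of spans, with the Cartesian product of sets as monoidal product and with braiding $\rho_{X,Y}\colon X\times Y\to Y\times X$, the flip. A *pseudomonoid* in $\mathrm{Span}$ is an object $X$ with morphisms $\eta\colon\{\bullet\}\to X$ and $\mu\colon X\times X\to X$ and invertible 2-morphisms $a\colon\mu\circ(\mu\times 1)\Rightarrow\mu\circ(1\times\mu)$, $\ell\colon\mu\circ(\eta\times1)\Rightarrow 1$, $r\colon\mu\circ(1\times\eta)\Rightarrow 1$ (up to the coherence isomorphisms of the monoidal product) that satisfy the triangle and pentagon equations. A 2-Segal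 set $X_\bullet$ determines the pseudomonoid with object $X_1$, unit $\{\bullet\}\leftarrow X_0\xrightarrow{s_0}X_1$, multiplication $X_1\times X_1\xleftarrow{(d_2,d_0)}X_2\xrightarrow{d_1}X_1$, associator the composite of the inverse of the first and of the second bijection above, i.e. $(d_3\psi,d_1\psi)\mapsto(d_2\psi,d_0\psi)$ for $\psi\in X_3$, and the unitors that identify the fibre products with $X_1$, with inverses given by $s_0\colon X_1\to X_2$ (left) and $s_1\colon X_1\to X_2$ (right). A *commutative structure* on a pseudomonoid is an invertible 2-morphism $\gamma\colon\mu\Rightarrow\mu\circ\rho$ that satisfies the symmetry equation (the composite $\mu\Rightarrow\mu\rho\Rightarrow\mu\rho\rho\cong\mu$ is the identity) and the hexagon equation (the two composite 2-morphisms from $\mu\circ(\mu\times1)$ to $\mu\circ(1\times\mu)$ precomposed with the cyclic permutation that carries the first factor past the other two, namely $a$, then $\gamma$, then $a$; and $\gamma\times1$, then $a$, then $1\times\gamma$, agree). Two commutative structures on the same pseudomonoid are *equivalent* if the identity morphism of the pseudomonoid, with identity 2-morphisms, is compatible with them. $\Phi_*$ is the category of the finite pointed sets $\langle n\rangle=\{*,1,\dots,n\}$,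 $n\ge0$, and pointed maps. The functor $\mathrm{Cut}\colon\Delta^{\mathrm{op}}\to\Phi_*$ sends $[n]$ to $\langle n\rangle$ and a monotone map $f\colon[n]\to[m]$ to the map $\langle m\rangle\to\langle n\rangle$ that sends $i\in\{1,\dots,m\}$ to $*$ if $f(0)\ge i$ or $f(n)<i$, and to $\min\{k: f(k)\ge i\}$ otherwise. A *$\Gamma$-structure* on $X_\bullet$ is a functor $F\colon\Phi_*\to\mathrm{Set}$ with $F\circ\mathrm{Cut}=X_\bullet$. **Theorem.** Let $X_\bullet$ be a 2-Segal set. Then there is a one-to-one correspondence between $\Gamma$-structures on $X_\bullet$ and equivalence classes of commutative structures on the corresponding pseudomonoid in $\mathrm{Span}$. It takes a $\Gamma$-structure $F$ to the class of a commutative structure $\gamma$ whose underlying map $X_2\to X_2$ is $F(\tau)$, where $\tau\colon\langle2\rangle\to\langle2\rangle$ is the transposition of $1$ and $2$ and $\mu\circ\rho$ is identified with the span $X_1\times X_1\xleftarrow{(d_0,d_2)}X_2\xrightarrow{d_1}X_1$. -/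

import Mathlib

open CategoryTheory Bicategory Opposite Simplicial

universe u

/-- A set, regarded as an object of the bicategory of spans of sets. -/
structure SpanSet : Type (u + 1) where
  carrier : Type u

/-- A span of sets `X ← apex → Y`. -/
structure SetSpan (X Y : SpanSet.{u}) : Type (u + 1) where
  apex : Type u
  left : apex → X.carrier
  right : apex → Y.carrier

namespace SetSpan

/-- A map of spans: a map of apexes which commutes with both legs. -/
@[ext]
structure Hom {X Y : SpanSet.{u}} (f g : SetSpan X Y) : Type u where
  map : f.apex → g.apex
  left_map : ∀ p, g.left (map p) = f.left p
  right_map : ∀ p, g.right (map p) = f.right p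

instance (X Y : SpanSet.{u}) : Category (SetSpan X Y) where
  Hom f g := Hom f g
  id f := ⟨fun p => p, fun _ => rfl, fun _ => rfl⟩
  comp φ ψ := ⟨fun p => ψ.map (φ.map p),
    fun p => (ψ.left_map _).trans (φ.left_map p), fun p => (ψ.right_map _).trans (φ.right_map p)⟩

section

variable {W X Y Z : SpanSet.{u}}

/-- The underlying map of apexes of a 2-morphism. -/
def app {f g : SetSpan X Y} (φ : f ⟶ g) : f.apex → g.apex := Hom.map φ

theorem left_app {f g : SetSpan X Y} (φ : f ⟶ g) (p : f.apex) : g.left (app φ p) = f.left p :=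
  Hom.left_map φ p

theorem right_app {f g : SetSpan X Y} (φ : f ⟶ g) (p : f.apex) : g.right (app φ p) = f.right p :=
  Hom.right_map φ p

theorem hom_ext {f g : SetSpan X Y} {φ ψ : f ⟶ g} (h : ∀ p, app φ p = app ψ p) : φ = ψ :=
  Hom.ext (funext h)

/-- Constructor for 2-morphisms. -/
def homMk {f g : SetSpan X Y} (m : f.apex → g.apex)
    (hl : ∀ p, g.left (m p) = f.left p) (hr : ∀ p, g.right (m p) = f.right p) : f ⟶ g :=
  (⟨m, hl, hr⟩ : Hom f g)

/-- A bijection of apexes which commutes with both legs is an invertible 2-morphism. -/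
def isoOfEquiv {f g : SetSpan X Y} (e : f.apex ≃ g.apex)
    (hl : ∀ p, g.left (e p) = f.left p) (hr : ∀ p, g.right (e p) = f.right p) : f ≅ g where
  hom := homMk e hl hr
  inv := homMk e.symm (fun p => by rw [← hl, e.apply_symm_apply])
    (fun p => by rw [← hr, e.apply_symm_apply])
  hom_inv_id := hom_ext e.symm_apply_apply
  inv_hom_id := hom_ext e.apply_symm_apply

/-- The composite (in diagrammatic order), by fibre product over the middle set. -/
def comp (f : SetSpan X Y) (g : SetSpan Y Z) : SetSpan X Z where
  apex := {p : f.apex × g.apex // f.right p.1 = g.left p.2}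
  left p := f.left p.1.1
  right p := g.right p.1.2

/-- The span `X ← X → Y` whose legs are the identity and a given function. -/
def ofFun (f : X.carrier → Y.carrier) : SetSpan X Y where
  apex := X.carrier
  left x := x
  right := f

/-- Left whiskering. -/
def whiskL (f : SetSpan X Y) {g h : SetSpan Y Z} (φ : g ⟶ h) : f.comp g ⟶ f.comp h :=
  homMk (fun p => ⟨(p.1.1, app φ p.1.2), p.2.trans (left_app φ _).symm⟩)
    (fun _ => rfl) (fun _ => right_app φ _)

/-- Right whiskering. -/
def whiskR {f g : SetSpan X Y} (φ : f ⟶ g) (h : SetSpan Y Z) : f.comp h ⟶ g.comp h :=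
  homMk (fun p => ⟨(app φ p.1.1, p.1.2), (right_app φ _).trans p.2⟩)
    (fun _ => left_app φ _) (fun _ => rfl)

/-- Rebracketing of triple composites. -/
def assoc (f : SetSpan W X) (g : SetSpan X Y) (h : SetSpan Y Z) :
    (f.comp g).comp h ≅ f.comp (g.comp h) :=
  isoOfEquiv
    { toFun := fun p => ⟨(p.1.1.1.1, ⟨(p.1.1.1.2, p.1.2), p.2⟩), p.1.1.2⟩
      invFun := fun p => ⟨(⟨(p.1.1, p.1.2.1.1), p.2⟩, p.1.2.1.2), p.1.2.2⟩
      left_inv := fun _ => rfl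
      right_inv := fun _ => rfl } (fun _ => rfl) (fun _ => rfl)

/-- The canonical identification `X ×_X A = A`. -/
def lUnitor (f : SetSpan X Y) : (ofFun fun x => x : SetSpan X X).comp f ≅ f :=
  isoOfEquiv
    { toFun := fun p => p.1.2
      invFun := fun a => ⟨(f.left a, a), rfl⟩
      left_inv := fun p => Subtype.ext (Prod.ext p.2.symm rfl)
      right_inv := fun _ => rfl } (fun p => p.2.symm) (fun _ => rfl)

/-- The canonical identification `A ×_Y Y = A`. -/
def rUnitor (f : SetSpan X Y) : f.comp (ofFun fun y => y : SetSpan Y Y) ≅ f :=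
  isoOfEquiv
    { toFun := fun p => p.1.1
      invFun := fun a => ⟨(a, f.right a), rfl⟩
      left_inv := fun p => Subtype.ext (Prod.ext rfl p.2)
      right_inv := fun _ => rfl } (fun _ => rfl) (fun p => p.2)

end

end SetSpan

open SetSpan

/-- The bicategory of spans of sets. -/
instance : Bicategory.{u, u + 1} SpanSet.{u} where
  Hom X Y := SetSpan X Y
  id X := ofFun fun x => x
  comp f g := SetSpan.comp f g
  whiskerLeft f _ _ φ := whiskL f φ
  whiskerRight φ h := whiskR φ h
  associator f g h := assoc f g h
  leftUnitor f := lUnitor f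
  rightUnitor f := rUnitor f
  whiskerLeft_id _ _ := rfl
  whiskerLeft_comp _ _ _ _ _ _ := rfl
  id_whiskerLeft φ := by
    refine SetSpan.hom_ext fun p => ?_
    rcases p with ⟨⟨x, a⟩, h⟩
    exact Subtype.ext (Prod.ext (Eq.trans h (left_app φ a).symm) rfl)
  comp_whiskerLeft _ _ _ _ _ := rfl
  id_whiskerRight _ _ := rfl
  comp_whiskerRight _ _ _ := rfl
  whiskerRight_id φ := by
    refine SetSpan.hom_ext fun p => ?_
    rcases p with ⟨⟨a, y⟩, h⟩
    exact Subtype.ext (Prod.ext rfl (Eq.trans h.symm (right_app φ a).symm))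
  whiskerRight_comp _ _ _ := rfl
  whisker_assoc _ _ _ _ _ := rfl
  whisker_exchange _ _ := rfl
  pentagon _ _ _ _ := rfl
  triangle _ _ := rfl


namespace SpanSet

/-- The monoidal product of objects: the Cartesian product. -/
def tensor (X Y : SpanSet.{u}) : SpanSet.{u} := ⟨X.carrier × Y.carrier⟩

/-- The monoidal unit: a one-point set. -/
def unit : SpanSet.{u} := ⟨PUnit⟩

infixr:70 " ⊠ " => SpanSet.tensor

/-- The span `X ← X → Y` given by a function, as a 1-morphism of the bicategory. -/
def graph {X Y : SpanSet.{u}} (f : X.carrier → Y.carrier) : X ⟶ Y := ofFun f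

variable {X X' X'' Y Y' Y'' Z Z' : SpanSet.{u}}

/-- The monoidal product of 1-morphisms. -/
def tensor₁ (f : X ⟶ X') (g : Y ⟶ Y') : X ⊠ Y ⟶ X' ⊠ Y' where
  apex := SetSpan.apex f × SetSpan.apex g
  left p := (SetSpan.left f p.1, SetSpan.left g p.2)
  right p := (SetSpan.right f p.1, SetSpan.right g p.2)

infixr:81 " ⊠₁ " => SpanSet.tensor₁

/-- The monoidal product of 2-morphisms. -/
def tensor₂ {f f' : X ⟶ X'} {g g' : Y ⟶ Y'} (φ : f ⟶ f') (ψ : g ⟶ g') : f ⊠₁ g ⟶ f' ⊠₁ g' :=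
  homMk (fun p => (app φ p.1, app ψ p.2))
    (fun p => Prod.ext (left_app φ p.1) (left_app ψ p.2))
    (fun p => Prod.ext (right_app φ p.1) (right_app ψ p.2))

infixr:81 " ⊠₂ " => SpanSet.tensor₂

/-- The tensorator `(A × B) ×_{X' × Y'} (A' × B') = (A ×_{X'} A') × (B ×_{Y'} B')`. -/
def tensorator (f : X ⟶ X') (g : Y ⟶ Y') (f' : X' ⟶ X'') (g' : Y' ⟶ Y'') :
    (f ⊠₁ g) ≫ (f' ⊠₁ g') ≅ (f ≫ f') ⊠₁ (g ≫ g') :=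
  isoOfEquiv
    { toFun := fun p => (⟨(p.1.1.1, p.1.2.1), congrArg Prod.fst p.2⟩,
        ⟨(p.1.1.2, p.1.2.2), congrArg Prod.snd p.2⟩)
      invFun := fun p => ⟨((p.1.1.1, p.2.1.1), (p.1.1.2, p.2.1.2)), Prod.ext p.1.2 p.2.2⟩
      left_inv := fun _ => rfl
      right_inv := fun _ => rfl } (fun _ => rfl) (fun _ => rfl)

/-- The product of two identity spans is the identity span of the product. -/
def tensorId (X Y : SpanSet.{u}) : 𝟙 X ⊠₁ 𝟙 Y ≅ 𝟙 (X ⊠ Y) :=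
  isoOfEquiv (Equiv.refl (X.carrier × Y.carrier)) (fun _ => rfl) (fun _ => rfl)

/-- `(f ≫ g) ⊗ 1 ⇒ (f ⊗ 1) ≫ (g ⊗ 1)`, from the tensorator and a unitor. -/
def splitR (f : X ⟶ X') (g : X' ⟶ X'') (Y : SpanSet.{u}) :
    (f ≫ g) ⊠₁ 𝟙 Y ⟶ (f ⊠₁ 𝟙 Y) ≫ (g ⊠₁ 𝟙 Y) :=
  (𝟙 (f ≫ g) ⊠₂ (λ_ (𝟙 Y)).inv) ≫ (tensorator f (𝟙 Y) g (𝟙 Y)).inv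

/-- `(f ⊗ 1) ≫ (g ⊗ 1) ⇒ (f ≫ g) ⊗ 1`, the inverse of the preceding 2-morphism. -/
def joinR (f : X ⟶ X') (g : X' ⟶ X'') (Y : SpanSet.{u}) :
    (f ⊠₁ 𝟙 Y) ≫ (g ⊠₁ 𝟙 Y) ⟶ (f ≫ g) ⊠₁ 𝟙 Y :=
  (tensorator f (𝟙 Y) g (𝟙 Y)).hom ≫ (𝟙 (f ≫ g) ⊠₂ (λ_ (𝟙 Y)).hom)

/-- `1 ⊗ (f ≫ g) ⇒ (1 ⊗ f) ≫ (1 ⊗ g)`, from the tensorator and a unitor. -/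
def splitL (Y : SpanSet.{u}) (f : X ⟶ X') (g : X' ⟶ X'') :
    𝟙 Y ⊠₁ (f ≫ g) ⟶ (𝟙 Y ⊠₁ f) ≫ (𝟙 Y ⊠₁ g) :=
  ((λ_ (𝟙 Y)).inv ⊠₂ 𝟙 (f ≫ g)) ≫ (tensorator (𝟙 Y) f (𝟙 Y) g).inv

/-- `(1 ⊗ f) ≫ (1 ⊗ g) ⇒ 1 ⊗ (f ≫ g)`, the inverse of the preceding 2-morphism. -/
def joinL (Y : SpanSet.{u}) (f : X ⟶ X') (g : X' ⟶ X'') :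
    (𝟙 Y ⊠₁ f) ≫ (𝟙 Y ⊠₁ g) ⟶ 𝟙 Y ⊠₁ (f ≫ g) :=
  (tensorator (𝟙 Y) f (𝟙 Y) g).hom ≫ ((λ_ (𝟙 Y)).hom ⊠₂ 𝟙 (f ≫ g))

/-- The slide move `c_{f,g}`, from the tensorator and the unitors. -/
def slide (f : X ⟶ X') (g : Y ⟶ Y') :
    (f ⊠₁ 𝟙 Y) ≫ (𝟙 X' ⊠₁ g) ⟶ (𝟙 X ⊠₁ g) ≫ (f ⊠₁ 𝟙 Y') :=
  (tensorator f (𝟙 Y) (𝟙 X') g).hom ≫ ((ρ_ f).hom ⊠₂ (λ_ g).hom) ≫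
    ((λ_ f).inv ⊠₂ (ρ_ g).inv) ≫ (tensorator (𝟙 X) g f (𝟙 Y')).inv

/-- The monoidal associator on objects. -/
def assoc₁ (X Y Z : SpanSet.{u}) : (X ⊠ Y) ⊠ Z ⟶ X ⊠ (Y ⊠ Z) :=
  graph fun p : (X.carrier × Y.carrier) × Z.carrier => (p.1.1, (p.1.2, p.2))

/-- Naturality of the monoidal associator. -/
def assocNat (f : X ⟶ X') (g : Y ⟶ Y') (h : Z ⟶ Z') :
    ((f ⊠₁ g) ⊠₁ h) ≫ assoc₁ X' Y' Z' ≅ assoc₁ X Y Z ≫ (f ⊠₁ (g ⊠₁ h)) :=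
  isoOfEquiv
    { toFun := fun p => ⟨(((left f p.1.1.1.1, left g p.1.1.1.2), left h p.1.1.2),
        (p.1.1.1.1, (p.1.1.1.2, p.1.1.2))), rfl⟩
      invFun := fun p => ⟨(((p.1.2.1, p.1.2.2.1), p.1.2.2.2),
        ((right f p.1.2.1, right g p.1.2.2.1), right h p.1.2.2.2)), rfl⟩
      left_inv := fun p => Subtype.ext (Prod.ext rfl p.2)
      right_inv := fun p => Subtype.ext (Prod.ext
        (congrArg (fun q : X.carrier × Y.carrier × Z.carrier => ((q.1, q.2.1), q.2.2)) p.2.symm)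
        rfl) } (fun _ => rfl)
    (fun p => congrArg
      (fun q : (X'.carrier × Y'.carrier) × Z'.carrier => (q.1.1, (q.1.2, q.2))) p.2)

/-- The pentagonator: two ways to rebracket a fourfold product. -/
def pentagonator (W X Y Z : SpanSet.{u}) :
    (assoc₁ W X Y ⊠₁ 𝟙 Z) ≫ assoc₁ W (X ⊠ Y) Z ≫ (𝟙 W ⊠₁ assoc₁ X Y Z) ≅
      assoc₁ (W ⊠ X) Y Z ≫ assoc₁ W X (Y ⊠ Z) :=
  isoOfEquiv
    { toFun := fun p => ⟨(p.1.1, ((p.1.1.1.1.1, p.1.1.1.1.2), (p.1.1.1.2, p.1.1.2))), rfl⟩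
      invFun := fun p => ⟨(p.1.1, ⟨(((p.1.1.1.1.1, (p.1.1.1.1.2, p.1.1.1.2)), p.1.1.2),
        (p.1.1.1.1.1, ((p.1.1.1.1.2, p.1.1.1.2), p.1.1.2))), rfl⟩), rfl⟩
      left_inv := by
        rintro ⟨⟨a, ⟨⟨b, c⟩, h'⟩⟩, h⟩
        obtain rfl : SetSpan.right (assoc₁ W (X ⊠ Y) Z) b = c := h'
        obtain rfl : SetSpan.right (assoc₁ W X Y ⊠₁ 𝟙 Z) a = b := h
        rfl
      right_inv := fun p => Subtype.ext (Prod.ext rfl p.2) } (fun _ => rfl)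
    (by
      rintro ⟨⟨a, ⟨⟨b, c⟩, h'⟩⟩, h⟩
      obtain rfl : SetSpan.right (assoc₁ W (X ⊠ Y) Z) b = c := h'
      obtain rfl : SetSpan.right (assoc₁ W X Y ⊠₁ 𝟙 Z) a = b := h
      rfl)

/-- The monoidal left unitor on objects. -/
def leftUnit (X : SpanSet.{u}) : unit ⊠ X ⟶ X := graph fun p : PUnit × X.carrier => p.2

/-- The monoidal right unitor on objects. -/
def rightUnit (X : SpanSet.{u}) : X ⊠ unit ⟶ X := graph fun p : X.carrier × PUnit => p.1

/-- Compatibility of the monoidal unitors with the monoidal associator. -/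
def triangulator (X Y : SpanSet.{u}) :
    assoc₁ X unit Y ≫ (𝟙 X ⊠₁ leftUnit Y) ≅ rightUnit X ⊠₁ 𝟙 Y :=
  isoOfEquiv
    { toFun := fun p => p.1.1
      invFun := fun p => ⟨(p, (p.1.1, (p.1.2, p.2))), rfl⟩
      left_inv := fun p => Subtype.ext (Prod.ext rfl p.2)
      right_inv := fun _ => rfl } (fun _ => rfl)
    (fun p => congrArg (fun q : X.carrier × PUnit × Y.carrier => (q.1, q.2.2)) p.2)

/-- The braiding on objects. -/
def braid (X Y : SpanSet.{u}) : X ⊠ Y ⟶ Y ⊠ X :=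
  graph fun p : X.carrier × Y.carrier => (p.2, p.1)

/-- Naturality of the braiding. -/
def braidNat (f : X ⟶ X') (g : Y ⟶ Y') :
    (f ⊠₁ g) ≫ braid X' Y' ≅ braid X Y ≫ (g ⊠₁ f) :=
  isoOfEquiv
    { toFun := fun p => ⟨((left f p.1.1.1, left g p.1.1.2), (p.1.1.2, p.1.1.1)), rfl⟩
      invFun := fun p => ⟨((p.1.2.2, p.1.2.1), (right f p.1.2.2, right g p.1.2.1)), rfl⟩
      left_inv := fun p => Subtype.ext (Prod.ext rfl p.2)
      right_inv := fun p => Subtype.ext (Prod.ext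
        (congrArg (fun q : Y.carrier × X.carrier => (q.2, q.1)) p.2.symm) rfl) }
    (fun _ => rfl)
    (fun p => congrArg (fun q : X'.carrier × Y'.carrier => (q.2, q.1)) p.2)

/-- The left hexagonator. -/
def hexagonator (X Y Z : SpanSet.{u}) :
    (braid X Y ⊠₁ 𝟙 Z) ≫ assoc₁ Y X Z ≫ (𝟙 Y ⊠₁ braid X Z) ≅
      assoc₁ X Y Z ≫ braid X (Y ⊠ Z) ≫ assoc₁ Y Z X :=
  isoOfEquiv
    { toFun := fun p => ⟨(p.1.1, ⟨((p.1.1.1.1, (p.1.1.1.2, p.1.1.2)),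
        ((p.1.1.1.2, p.1.1.2), p.1.1.1.1)), rfl⟩), rfl⟩
      invFun := fun p => ⟨(p.1.1, ⟨(((p.1.1.1.2, p.1.1.1.1), p.1.1.2),
        (p.1.1.1.2, (p.1.1.1.1, p.1.1.2))), rfl⟩), rfl⟩
      left_inv := by
        rintro ⟨⟨a, ⟨⟨b, c⟩, h'⟩⟩, h⟩
        obtain rfl : SetSpan.right (assoc₁ Y X Z) b = c := h'
        obtain rfl : SetSpan.right (braid X Y ⊠₁ 𝟙 Z) a = b := h
        rfl
      right_inv := by
        rintro ⟨⟨a, ⟨⟨b, c⟩, h'⟩⟩, h⟩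
        obtain rfl : SetSpan.right (braid X (Y ⊠ Z)) b = c := h'
        obtain rfl : SetSpan.right (assoc₁ X Y Z) a = b := h
        rfl } (fun _ => rfl)
    (by
      rintro ⟨⟨a, ⟨⟨b, c⟩, h'⟩⟩, h⟩
      obtain rfl : SetSpan.right (assoc₁ Y X Z) b = c := h'
      obtain rfl : SetSpan.right (braid X Y ⊠₁ 𝟙 Z) a = b := h
      rfl)

/-- The syllepsis. -/
def syllepsis (X Y : SpanSet.{u}) : braid X Y ≫ braid Y X ≅ 𝟙 (X ⊠ Y) :=
  isoOfEquiv
    { toFun := fun p => p.1.1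
      invFun := fun p => ⟨(p, (p.2, p.1)), rfl⟩
      left_inv := fun p => Subtype.ext (Prod.ext rfl p.2)
      right_inv := fun _ => rfl } (fun _ => rfl)
    (fun p => congrArg (fun q : Y.carrier × X.carrier => (q.2, q.1)) p.2)

end SpanSet

open SpanSet

section Equations

variable {X : SpanSet.{u}} (η : unit ⟶ X) (μ : X ⊠ X ⟶ X)
  (a : (μ ⊠₁ 𝟙 X) ≫ μ ≅ assoc₁ X X X ≫ (𝟙 X ⊠₁ μ) ≫ μ)
  (l : (η ⊠₁ 𝟙 X) ≫ μ ≅ leftUnit X) (r : (𝟙 X ⊠₁ η) ≫ μ ≅ rightUnit X)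
  (γ : μ ≅ braid X X ≫ μ)

/-- The triangle equation. Both sides are 2-morphisms
`((1 ⊗ η) ⊗ 1) ≫ (μ ⊗ 1) ≫ μ ⇒ (r ⊗ 1) ≫ μ`; `⊗≫` is composition of 2-morphisms
with insertion of the associators and unitors of the bicategory. -/
def TriangleEquation : Prop :=
  (((𝟙 X ⊠₁ η) ⊠₁ 𝟙 X) ◁ a.hom) ⊗≫
      ((assocNat (𝟙 X) η (𝟙 X)).hom ▷ ((𝟙 X ⊠₁ μ) ≫ μ)) ⊗≫
      (assoc₁ X unit X ◁ ((joinL X (η ⊠₁ 𝟙 X) μ ≫ (𝟙 (𝟙 X) ⊠₂ l.hom)) ▷ μ)) ⊗≫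
      ((triangulator X X).hom ▷ μ) =
    𝟙 (((𝟙 X ⊠₁ η) ⊠₁ 𝟙 X) ≫ (μ ⊠₁ 𝟙 X) ≫ μ) ⊗≫
      ((joinR (𝟙 X ⊠₁ η) μ X ≫ (r.hom ⊠₂ 𝟙 (𝟙 X))) ▷ μ)

/-- The pentagon equation. Both sides are 2-morphisms
`((μ ⊗ 1) ⊗ 1) ≫ (μ ⊗ 1) ≫ μ ⇒ α ≫ α ≫ (1 ⊗ (1 ⊗ μ)) ≫ (1 ⊗ μ) ≫ μ`. -/
def PentagonEquation : Prop :=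
  𝟙 (((μ ⊠₁ 𝟙 X) ⊠₁ 𝟙 X) ≫ (μ ⊠₁ 𝟙 X) ≫ μ) ⊗≫
      ((joinR (μ ⊠₁ 𝟙 X) μ X ≫ (a.hom ⊠₂ 𝟙 (𝟙 X)) ≫
        splitR (assoc₁ X X X) ((𝟙 X ⊠₁ μ) ≫ μ) X ≫
        ((assoc₁ X X X ⊠₁ 𝟙 X) ◁ splitR (𝟙 X ⊠₁ μ) μ X)) ▷ μ) ⊗≫
      ((assoc₁ X X X ⊠₁ 𝟙 X) ◁ ((𝟙 X ⊠₁ μ) ⊠₁ 𝟙 X) ◁ a.hom) ⊗≫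
      ((assoc₁ X X X ⊠₁ 𝟙 X) ◁
        ((assocNat (𝟙 X) μ (𝟙 X)).hom ▷ ((𝟙 X ⊠₁ μ) ≫ μ))) ⊗≫
      ((assoc₁ X X X ⊠₁ 𝟙 X) ◁ assoc₁ X (X ⊠ X) X ◁
        ((joinL X (μ ⊠₁ 𝟙 X) μ ≫ (𝟙 (𝟙 X) ⊠₂ a.hom) ≫
          splitL X (assoc₁ X X X) ((𝟙 X ⊠₁ μ) ≫ μ) ≫
          ((𝟙 X ⊠₁ assoc₁ X X X) ◁ splitL X (𝟙 X ⊠₁ μ) μ)) ▷ μ)) ⊗≫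
      ((pentagonator X X X X).hom ▷
        ((𝟙 X ⊠₁ (𝟙 X ⊠₁ μ)) ≫ (𝟙 X ⊠₁ μ) ≫ μ)) ⊗≫
      𝟙 (assoc₁ (X ⊠ X) X X ≫ assoc₁ X X (X ⊠ X) ≫
        (𝟙 X ⊠₁ (𝟙 X ⊠₁ μ)) ≫ (𝟙 X ⊠₁ μ) ≫ μ) =
    (((μ ⊠₁ 𝟙 X) ⊠₁ 𝟙 X) ◁ a.hom) ⊗≫
      ((assocNat μ (𝟙 X) (𝟙 X)).hom ▷ ((𝟙 X ⊠₁ μ) ≫ μ)) ⊗≫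
      (assoc₁ (X ⊠ X) X X ◁
        (((𝟙 μ ⊠₂ (tensorId X X).hom) ▷ (𝟙 X ⊠₁ μ) ≫ slide μ μ ≫
          ((tensorId X X).inv ⊠₂ 𝟙 μ) ▷ (μ ⊠₁ 𝟙 X)) ▷ μ)) ⊗≫
      (assoc₁ (X ⊠ X) X X ◁ ((𝟙 X ⊠₁ 𝟙 X) ⊠₁ μ) ◁ a.hom) ⊗≫
      (assoc₁ (X ⊠ X) X X ◁
        ((assocNat (𝟙 X) (𝟙 X) μ).hom ▷ ((𝟙 X ⊠₁ μ) ≫ μ))) ⊗≫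
      𝟙 (assoc₁ (X ⊠ X) X X ≫ assoc₁ X X (X ⊠ X) ≫
        (𝟙 X ⊠₁ (𝟙 X ⊠₁ μ)) ≫ (𝟙 X ⊠₁ μ) ≫ μ)

/-- The symmetry equation. Both sides are 2-morphisms `μ ⇒ ρ ≫ ρ ≫ μ`. -/
def SymmetryEquation : Prop :=
  γ.hom ≫ (braid X X ◁ γ.hom) =
    𝟙 μ ⊗≫ ((syllepsis X X).inv ▷ μ) ⊗≫ 𝟙 (braid X X ≫ braid X X ≫ μ)

/-- The hexagon equation. Both sides are 2-morphisms
`(μ ⊗ 1) ≫ μ ⇒ α ≫ ρ ≫ α ≫ (1 ⊗ μ) ≫ μ`. -/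
def HexagonEquation : Prop :=
  a.hom ⊗≫
      (assoc₁ X X X ◁ (𝟙 X ⊠₁ μ) ◁ γ.hom) ⊗≫
      (assoc₁ X X X ◁ ((braidNat (𝟙 X) μ).hom ▷ μ)) ⊗≫
      (assoc₁ X X X ◁ braid X (X ⊠ X) ◁ a.hom) ⊗≫
      𝟙 (assoc₁ X X X ≫ braid X (X ⊠ X) ≫
        assoc₁ X X X ≫ (𝟙 X ⊠₁ μ) ≫ μ) =
    (((γ.hom ⊠₂ 𝟙 (𝟙 X)) ≫ splitR (braid X X) μ X) ▷ μ) ⊗≫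
      ((braid X X ⊠₁ 𝟙 X) ◁ a.hom) ⊗≫
      ((braid X X ⊠₁ 𝟙 X) ◁ assoc₁ X X X ◁
        (((𝟙 (𝟙 X) ⊠₂ γ.hom) ≫ splitL X (braid X X) μ) ▷ μ)) ⊗≫
      ((hexagonator X X X).hom ▷ ((𝟙 X ⊠₁ μ) ≫ μ)) ⊗≫
      𝟙 (assoc₁ X X X ≫ braid X (X ⊠ X) ≫
        assoc₁ X X X ≫ (𝟙 X ⊠₁ μ) ≫ μ)

end Equations

/-- A pseudomonoid in the monoidal bicategory of spans of sets. -/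
structure SpanPseudomonoid : Type (u + 1) where
  /-- the underlying object -/
  obj : SpanSet.{u}
  /-- the unit morphism -/
  η : unit ⟶ obj
  /-- the multiplication morphism -/
  μ : obj ⊠ obj ⟶ obj
  /-- the associator -/
  a : (μ ⊠₁ 𝟙 obj) ≫ μ ≅ assoc₁ obj obj obj ≫ (𝟙 obj ⊠₁ μ) ≫ μ
  /-- the left unitor -/
  l : (η ⊠₁ 𝟙 obj) ≫ μ ≅ leftUnit obj
  /-- the right unitor -/
  r : (𝟙 obj ⊠₁ η) ≫ μ ≅ rightUnit obj
  triangle : TriangleEquation η μ a l r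
  pentagon : PentagonEquation μ a

/-- A commutative structure on a pseudomonoid in the symmetric monoidal bicategory of spans:
an invertible 2-morphism `γ : μ ⇒ μ ∘ ρ` with the symmetry and hexagon equations. -/
@[ext]
structure CommStructure (M : SpanPseudomonoid.{u}) : Type u where
  γ : M.μ ≅ braid M.obj M.obj ≫ M.μ
  symmetry : SymmetryEquation M.μ γ
  hexagon : HexagonEquation M.μ M.a γ

/-- A side or a diagonal of the polygon with vertices `0, …, n`: a pair of vertices `i < j`. -/
def PolygonChord (n : ℕ) : Type := {c : Fin (n + 1) × Fin (n + 1) // c.1 < c.2}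

namespace PolygonChord

/-- Two chords cross when they meet in the interior of the polygon. -/
def Crosses {n : ℕ} (c d : PolygonChord n) : Prop :=
  (c.1.1 < d.1.1 ∧ d.1.1 < c.1.2 ∧ c.1.2 < d.1.2) ∨
    (d.1.1 < c.1.1 ∧ c.1.1 < d.1.2 ∧ d.1.2 < c.1.2)

end PolygonChord

/-- A triangulation of the polygon with vertices `0, …, n`, given by its chords (the sides of the
polygon included): a maximal set of pairwise noncrossing chords. -/
def IsPolygonTriangulation {n : ℕ} (T : Set (PolygonChord n)) : Prop :=
  Maximal (fun S : Set (PolygonChord n) => ∀ c ∈ S, ∀ d ∈ S, ¬ c.Crosses d) T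

/-- The side of the triangle `t 0 < t 1 < t 2` opposite to its vertex `t a`. -/
def triangleSide {n : ℕ} (t : Fin 3 ↪o Fin (n + 1)) (a : Fin 3) : PolygonChord n :=
  ⟨(t (a.succAbove 0), t (a.succAbove 1)), t.strictMono (a.strictMono_succAbove (by decide))⟩

/-- The triangles of a triangulation: those whose sides all belong to it. -/
def TriangulationTriangle {n : ℕ} (T : Set (PolygonChord n)) : Type :=
  {t : Fin 3 ↪o Fin (n + 1) // ∀ a, triangleSide t a ∈ T}

/-- The map `X_n → X_2` induced by a triangle with vertices among `0, …, n`. -/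
def SSet.triangleFace (X : SSet.{u}) {n : ℕ} (t : Fin 3 ↪o Fin (n + 1)) (ψ : X _⦋n⦌) : X _⦋2⦌ :=
  X.map (SimplexCategory.mkHom t.toOrderHom).op ψ

/-- The iterated fibre product `X_2 ×_{X_1} ⋯ ×_{X_1} X_2` of a triangulation: a 2-simplex for each
of its triangles, such that 2-simplices agree on every side that their triangles share. -/
def SSet.TriangulationProduct (X : SSet.{u}) {n : ℕ} (T : Set (PolygonChord n)) : Type u :=
  {ξ : TriangulationTriangle T → X _⦋2⦌ // ∀ t t' a a',
    triangleSide t.1 a = triangleSide t'.1 a' → X.δ a (ξ t) = X.δ a' (ξ t')}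

theorem SSet.δ_triangleFace (X : SSet.{u}) {n : ℕ} (t t' : Fin 3 ↪o Fin (n + 1)) (a a' : Fin 3)
    (h : triangleSide t a = triangleSide t' a') (ψ : X _⦋n⦌) :
    X.δ a (X.triangleFace t ψ) = X.δ a' (X.triangleFace t' ψ) := by
  have key : SimplexCategory.δ a ≫ SimplexCategory.mkHom t.toOrderHom =
      SimplexCategory.δ a' ≫ SimplexCategory.mkHom t'.toOrderHom := by
    have h' := congrArg Subtype.val h
    have h0 := congrArg Prod.fst h'
    have h1 := congrArg Prod.snd h'
    apply SimplexCategory.Hom.ext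
    apply OrderHom.ext
    funext i
    fin_cases i
    · exact h0
    · exact h1
  unfold SSet.triangleFace SimplicialObject.δ
  rw [← Functor.map_comp_apply, ← Functor.map_comp_apply, ← op_comp, ← op_comp, key]

/-- The map from `X_n` to the iterated fibre product of a triangulation. -/
def SSet.triangulationMap (X : SSet.{u}) {n : ℕ} (T : Set (PolygonChord n)) (ψ : X _⦋n⦌) :
    X.TriangulationProduct T :=
  ⟨fun t => X.triangleFace t.1 ψ, fun t t' a a' h => X.δ_triangleFace t.1 t'.1 a a' h ψ⟩

/-- A simplicial set is 2-Segal if the map `X_n → X_2 ×_{X_1} ⋯ ×_{X_1} X_2` is an isomorphism for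
every triangulation of every polygon with at least three vertices. -/
def SSet.IsTwoSegal (X : SSet.{u}) : Prop :=
  ∀ n : ℕ, 2 ≤ n → ∀ T : Set (PolygonChord n), IsPolygonTriangulation T →
    Function.Bijective (X.triangulationMap T)


section TwoSegal

theorem SSet.δ_δ_apply (X : SSet.{u}) {n : ℕ} {i j : Fin (n + 2)} (h : i ≤ j) (ψ : X _⦋n + 2⦌) :
    X.δ i (X.δ j.succ ψ) = X.δ j (X.δ i.castSucc ψ) :=
  ConcreteCategory.congr_hom (X.δ_comp_δ h) ψ

theorem SSet.triangleFace_eq (X : SSet.{u}) {n : ℕ} (t : Fin 3 ↪o Fin (n + 1))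
    (f : ⦋2⦌ ⟶ ⦋n⦌) (h : ∀ i, t i = f i) (ψ : X _⦋n⦌) : X.triangleFace t ψ = X.map f.op ψ := by
  have : SimplexCategory.mkHom t.toOrderHom = f := by
    apply SimplexCategory.Hom.ext
    apply OrderHom.ext
    funext i
    exact h i
  rw [SSet.triangleFace, this]

theorem SSet.triangleFace_δ (X : SSet.{u}) (t : Fin 3 ↪o Fin 4) (k : Fin 4)
    (h : t 0 = k.succAbove 0 ∧ t 1 = k.succAbove 1 ∧ t 2 = k.succAbove 2) (ψ : X _⦋3⦌) :
    X.triangleFace t ψ = X.δ k ψ :=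
  X.triangleFace_eq t (SimplexCategory.δ k) (fun i => by
    fin_cases i
    · exact h.1
    · exact h.2.1
    · exact h.2.2) ψ

theorem isPolygonTriangulation_of {n : ℕ} (T : Set (PolygonChord n))
    (h₁ : ∀ c ∈ T, ∀ d ∈ T, ¬ c.Crosses d) (h₂ : ∀ c, c ∉ T → ∃ d ∈ T, c.Crosses d) :
    IsPolygonTriangulation T :=
  ⟨h₁, fun _ hS hTS c hc => by_contra fun hcT => by
    obtain ⟨d, hd, hcd⟩ := h₂ c hcT
    exact hS c hc d (hTS hd) hcd⟩

/-- The chords of the square other than the diagonal from `1` to `3`. -/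
def squareA : Set (PolygonChord 3) := {c | c.1 ≠ (1, 3)}

/-- The chords of the square other than the diagonal from `0` to `2`. -/
def squareB : Set (PolygonChord 3) := {c | c.1 ≠ (0, 2)}

/-- The sides of the pentagon and its diagonals at the vertex `0`. -/
def pentagonFan : Set (PolygonChord 4) := {c | c.1 ≠ (1, 3) ∧ c.1 ≠ (1, 4) ∧ c.1 ≠ (2, 4)}

theorem squareA_isTriangulation : IsPolygonTriangulation squareA := by
  apply isPolygonTriangulation_of
  · have : ∀ i j k l : Fin 4, i < j → k < l → (i, j) ≠ (1, 3) → (k, l) ≠ (1, 3) →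
      ¬ ((i < k ∧ k < j ∧ j < l) ∨ (k < i ∧ i < l ∧ l < j)) := by decide
    rintro ⟨⟨i, j⟩, hc⟩ h ⟨⟨k, l⟩, hd⟩ h'
    exact this i j k l hc hd h h'
  · have : ∀ i j : Fin 4, (i, j) = (1, 3) → (i < 0 ∧ 0 < j ∧ j < 2) ∨ (0 < i ∧ i < 2 ∧ 2 < j) := by
      decide
    rintro ⟨⟨i, j⟩, hc⟩ h
    exact ⟨⟨(0, 2), by decide⟩, show ((0 : Fin 4), (2 : Fin 4)) ≠ (1, 3) by decide,
      this i j (not_not.mp h)⟩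

theorem squareB_isTriangulation : IsPolygonTriangulation squareB := by
  apply isPolygonTriangulation_of
  · have : ∀ i j k l : Fin 4, i < j → k < l → (i, j) ≠ (0, 2) → (k, l) ≠ (0, 2) →
      ¬ ((i < k ∧ k < j ∧ j < l) ∨ (k < i ∧ i < l ∧ l < j)) := by decide
    rintro ⟨⟨i, j⟩, hc⟩ h ⟨⟨k, l⟩, hd⟩ h'
    exact this i j k l hc hd h h'
  · have : ∀ i j : Fin 4, (i, j) = (0, 2) → (i < 1 ∧ 1 < j ∧ j < 3) ∨ (1 < i ∧ i < 3 ∧ 3 < j) := by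
      decide
    rintro ⟨⟨i, j⟩, hc⟩ h
    exact ⟨⟨(1, 3), by decide⟩, show ((1 : Fin 4), (3 : Fin 4)) ≠ (0, 2) by decide,
      this i j (not_not.mp h)⟩

theorem pentagonFan_isTriangulation : IsPolygonTriangulation pentagonFan := by
  apply isPolygonTriangulation_of
  · have : ∀ i j k l : Fin 5, i < j → k < l →
      ((i, j) ≠ (1, 3) ∧ (i, j) ≠ (1, 4) ∧ (i, j) ≠ (2, 4)) →
      ((k, l) ≠ (1, 3) ∧ (k, l) ≠ (1, 4) ∧ (k, l) ≠ (2, 4)) →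
      ¬ ((i < k ∧ k < j ∧ j < l) ∨ (k < i ∧ i < l ∧ l < j)) := by decide
    rintro ⟨⟨i, j⟩, hc⟩ h ⟨⟨k, l⟩, hd⟩ h'
    exact this i j k l hc hd h h'
  · have : ∀ i j : Fin 5, i < j → ¬ ((i, j) ≠ (1, 3) ∧ (i, j) ≠ (1, 4) ∧ (i, j) ≠ (2, 4)) →
      ∃ k l : Fin 5, ∃ _ : k < l, ((k, l) ≠ (1, 3) ∧ (k, l) ≠ (1, 4) ∧ (k, l) ≠ (2, 4)) ∧
        ((i < k ∧ k < j ∧ j < l) ∨ (k < i ∧ i < l ∧ l < j)) := by decide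
    rintro ⟨⟨i, j⟩, hc⟩ h
    obtain ⟨k, l, hkl, h₁, h₂⟩ := this i j hc h
    exact ⟨⟨(k, l), hkl⟩, h₁, h₂⟩

theorem squareA_triangle (t : TriangulationTriangle squareA) :
    (t.1 0 = 0 ∧ t.1 1 = 1 ∧ t.1 2 = 2) ∨ (t.1 0 = 0 ∧ t.1 1 = 2 ∧ t.1 2 = 3) := by
  have key : ∀ a b c : Fin 4, a < b → b < c → (b, c) ≠ (1, 3) → (a, c) ≠ (1, 3) →
    (a, b) ≠ (1, 3) → (a = 0 ∧ b = 1 ∧ c = 2) ∨ (a = 0 ∧ b = 2 ∧ c = 3) := by decide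
  exact key _ _ _ (t.1.strictMono (by decide)) (t.1.strictMono (by decide)) (t.2 0) (t.2 1) (t.2 2)

theorem squareB_triangle (t : TriangulationTriangle squareB) :
    (t.1 0 = 0 ∧ t.1 1 = 1 ∧ t.1 2 = 3) ∨ (t.1 0 = 1 ∧ t.1 1 = 2 ∧ t.1 2 = 3) := by
  have key : ∀ a b c : Fin 4, a < b → b < c → (b, c) ≠ (0, 2) → (a, c) ≠ (0, 2) →
    (a, b) ≠ (0, 2) → (a = 0 ∧ b = 1 ∧ c = 3) ∨ (a = 1 ∧ b = 2 ∧ c = 3) := by decide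
  exact key _ _ _ (t.1.strictMono (by decide)) (t.1.strictMono (by decide)) (t.2 0) (t.2 1) (t.2 2)

theorem pentagonFan_triangle (t : TriangulationTriangle pentagonFan) :
    (t.1 0 = 0 ∧ t.1 1 = 1 ∧ t.1 2 = 2) ∨ (t.1 0 = 0 ∧ t.1 1 = 2 ∧ t.1 2 = 3) ∨
      (t.1 0 = 0 ∧ t.1 1 = 3 ∧ t.1 2 = 4) := by
  have key : ∀ a b c : Fin 5, a < b → b < c →
    ((b, c) ≠ (1, 3) ∧ (b, c) ≠ (1, 4) ∧ (b, c) ≠ (2, 4)) →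
    ((a, c) ≠ (1, 3) ∧ (a, c) ≠ (1, 4) ∧ (a, c) ≠ (2, 4)) →
    ((a, b) ≠ (1, 3) ∧ (a, b) ≠ (1, 4) ∧ (a, b) ≠ (2, 4)) →
    (a = 0 ∧ b = 1 ∧ c = 2) ∨ (a = 0 ∧ b = 2 ∧ c = 3) ∨ (a = 0 ∧ b = 3 ∧ c = 4) := by decide
  exact key _ _ _ (t.1.strictMono (by decide)) (t.1.strictMono (by decide)) (t.2 0) (t.2 1) (t.2 2)

variable {X : SSet.{u}}

theorem triangleSide_val {n : ℕ} {t t' : Fin 3 ↪o Fin (n + 1)} {a a' : Fin 3}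
    (h : triangleSide t a = triangleSide t' a') :
    t (a.succAbove 0) = t' (a'.succAbove 0) ∧ t (a.succAbove 1) = t' (a'.succAbove 1) :=
  Prod.mk.inj (congrArg Subtype.val h)

theorem SSet.IsTwoSegal.extA (hX : X.IsTwoSegal) {ψ ψ' : X _⦋3⦌} (h₃ : X.δ 3 ψ = X.δ 3 ψ') (h₁ : X.δ 1 ψ = X.δ 1 ψ') :
    ψ = ψ' := by
  apply (hX 3 (by omega) squareA squareA_isTriangulation).1
  apply Subtype.ext
  funext t
  change X.triangleFace t.1 ψ = X.triangleFace t.1 ψ'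
  rcases squareA_triangle t with h | h
  · rw [X.triangleFace_δ t.1 3 h, X.triangleFace_δ t.1 3 h, h₃]
  · rw [X.triangleFace_δ t.1 1 h, X.triangleFace_δ t.1 1 h, h₁]

theorem SSet.IsTwoSegal.extB (hX : X.IsTwoSegal) {ψ ψ' : X _⦋3⦌} (h₂ : X.δ 2 ψ = X.δ 2 ψ')
    (h₀ : X.δ 0 ψ = X.δ 0 ψ') : ψ = ψ' := by
  apply (hX 3 (by omega) squareB squareB_isTriangulation).1
  apply Subtype.ext
  funext t
  change X.triangleFace t.1 ψ = X.triangleFace t.1 ψ'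
  rcases squareB_triangle t with h | h
  · rw [X.triangleFace_δ t.1 2 h, X.triangleFace_δ t.1 2 h, h₂]
  · rw [X.triangleFace_δ t.1 0 h, X.triangleFace_δ t.1 0 h, h₀]

theorem SSet.IsTwoSegal.existsA (hX : X.IsTwoSegal) {ξ ξ' : X _⦋2⦌} (h : X.δ 1 ξ = X.δ 2 ξ') :
    ∃ ψ : X _⦋3⦌, X.δ 3 ψ = ξ ∧ X.δ 1 ψ = ξ' := by
  obtain ⟨ψ, hψ⟩ := (hX 3 (by omega) squareA squareA_isTriangulation).2
    ⟨fun t => if t.1 1 = 1 then ξ else ξ', by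
      intro t t' a a' e
      have e := triangleSide_val e
      rcases squareA_triangle t with ⟨h0, h1, h2⟩ | ⟨h0, h1, h2⟩ <;>
      rcases squareA_triangle t' with ⟨h0', h1', h2'⟩ | ⟨h0', h1', h2'⟩ <;>
      revert e <;> fin_cases a <;> fin_cases a' <;>
      simp [Fin.succAbove, h0, h1, h2, h0', h1', h2', h]⟩
  have key (t) := congrFun (congrArg Subtype.val hψ) t
  refine ⟨ψ, ?_, ?_⟩
  · exact key ⟨Fin.succAboveOrderEmb 3, fun a Ha => absurd Ha (by revert a; decide)⟩
  · exact key ⟨Fin.succAboveOrderEmb 1, fun a Ha => absurd Ha (by revert a; decide)⟩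

theorem SSet.IsTwoSegal.existsB (hX : X.IsTwoSegal) {ξ ξ' : X _⦋2⦌} (h : X.δ 0 ξ = X.δ 1 ξ') :
    ∃ ψ : X _⦋3⦌, X.δ 2 ψ = ξ ∧ X.δ 0 ψ = ξ' := by
  obtain ⟨ψ, hψ⟩ := (hX 3 (by omega) squareB squareB_isTriangulation).2
    ⟨fun t => if t.1 1 = 1 then ξ else ξ', by
      intro t t' a a' e
      have e := triangleSide_val e
      rcases squareB_triangle t with ⟨h0, h1, h2⟩ | ⟨h0, h1, h2⟩ <;>
      rcases squareB_triangle t' with ⟨h0', h1', h2'⟩ | ⟨h0', h1', h2'⟩ <;>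
      revert e <;> fin_cases a <;> fin_cases a' <;>
      simp [Fin.succAbove, h0, h1, h2, h0', h1', h2', h]⟩
  have key (t) := congrFun (congrArg Subtype.val hψ) t
  refine ⟨ψ, ?_, ?_⟩
  · exact key ⟨Fin.succAboveOrderEmb 2, fun a Ha => absurd Ha (by revert a; decide)⟩
  · exact key ⟨Fin.succAboveOrderEmb 0, fun a Ha => absurd Ha (by revert a; decide)⟩

theorem SSet.IsTwoSegal.exists₄ (hX : X.IsTwoSegal) {ξ ξ' ξ'' : X _⦋2⦌} (h : X.δ 1 ξ = X.δ 2 ξ')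
    (h' : X.δ 1 ξ' = X.δ 2 ξ'') :
    ∃ ω : X _⦋4⦌, X.δ 3 (X.δ 4 ω) = ξ ∧ X.δ 1 (X.δ 4 ω) = ξ' ∧ X.δ 1 (X.δ 2 ω) = ξ'' := by
  obtain ⟨ω, hω⟩ := (hX 4 (by omega) pentagonFan pentagonFan_isTriangulation).2
    ⟨fun t => if t.1 1 = 1 then ξ else if t.1 1 = 2 then ξ' else ξ'', by
      intro t t' a a' e
      have e := triangleSide_val e
      rcases pentagonFan_triangle t with ⟨h0, h1, h2⟩ | ⟨h0, h1, h2⟩ | ⟨h0, h1, h2⟩ <;>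
      rcases pentagonFan_triangle t' with ⟨h0', h1', h2'⟩ | ⟨h0', h1', h2'⟩ | ⟨h0', h1', h2'⟩ <;>
      revert e <;> fin_cases a <;> fin_cases a' <;>
      simp [Fin.succAbove, h0, h1, h2, h0', h1', h2', h, h']⟩
  have key (t) := congrFun (congrArg Subtype.val hω) t
  have comp (i : Fin 4) (j : Fin 5) : X.δ i (X.δ j ω) =
      X.triangleFace ((Fin.succAboveOrderEmb i).trans (Fin.succAboveOrderEmb j)) ω := by
    unfold SSet.triangleFace SimplicialObject.δ
    rw [← Functor.map_comp_apply, ← op_comp]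
    rfl
  refine ⟨ω, (comp 3 4).trans ?_, (comp 1 4).trans ?_, (comp 1 2).trans ?_⟩
  · exact key ⟨(Fin.succAboveOrderEmb 3).trans (Fin.succAboveOrderEmb 4), by
      change ∀ a : Fin 3, _ ∧ _
      decide⟩
  · exact key ⟨(Fin.succAboveOrderEmb 1).trans (Fin.succAboveOrderEmb 4), by
      change ∀ a : Fin 3, _ ∧ _
      decide⟩
  · exact key ⟨(Fin.succAboveOrderEmb 1).trans (Fin.succAboveOrderEmb 2), by
      change ∀ a : Fin 3, _ ∧ _
      decide⟩

end TwoSegal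

section Associated

variable (X : SSet.{u})

/-- The object `X_1` of the bicategory of spans. -/
def SSet.spanObj : SpanSet.{u} := ⟨X _⦋1⦌⟩

/-- The unit `{∙} ← X_0 → X_1`, with right leg `s_0`. -/
def SSet.spanUnit : unit ⟶ X.spanObj :=
  ({ apex := X _⦋0⦌, left := fun _ => PUnit.unit, right := fun v => X.σ 0 v } :
    SetSpan unit X.spanObj)

/-- The multiplication `X_1 × X_1 ← X_2 → X_1`, with legs `(d_2, d_0)` and `d_1`. -/
def SSet.spanMul : X.spanObj ⊠ X.spanObj ⟶ X.spanObj :=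
  ({ apex := X _⦋2⦌, left := fun ξ => (X.δ 2 ξ, X.δ 0 ξ), right := fun ξ => X.δ 1 ξ } :
    SetSpan (X.spanObj ⊠ X.spanObj) X.spanObj)

/-- The span `(X_1 × X_1) × X_1 ← X_3 → X_1`, with legs given by the edges `01`, `12`, `23`
and `03`. -/
def SSet.spanTriple : (X.spanObj ⊠ X.spanObj) ⊠ X.spanObj ⟶ X.spanObj :=
  ({ apex := X _⦋3⦌
     left := fun ψ => ((X.δ 2 (X.δ 3 ψ), X.δ 0 (X.δ 3 ψ)), X.δ 0 (X.δ 1 ψ))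
     right := fun ψ => X.δ 1 (X.δ 1 ψ) } :
    SetSpan ((X.spanObj ⊠ X.spanObj) ⊠ X.spanObj) X.spanObj)

variable {X}

/-- The isomorphism of spans from `X_3` to `(μ ⊗ 1) ≫ μ` given by `ψ ↦ (d_3 ψ, d_1 ψ)`. -/
noncomputable def SSet.IsTwoSegal.isoA (hX : X.IsTwoSegal) :
    X.spanTriple ≅ (X.spanMul ⊠₁ 𝟙 X.spanObj) ≫ X.spanMul :=
  isoOfEquiv
    (Equiv.ofBijective
      (fun ψ : X _⦋3⦌ => (⟨((X.δ 3 ψ, X.δ 0 (X.δ 1 ψ)), X.δ 1 ψ),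
        Prod.ext (X.δ_δ_apply (i := 1) (j := 2) (by decide) ψ) rfl⟩ :
          SetSpan.apex ((X.spanMul ⊠₁ 𝟙 X.spanObj) ≫ X.spanMul)))
      ⟨fun ψ ψ' h => hX.extA
          (congrArg (fun p : SetSpan.apex ((X.spanMul ⊠₁ 𝟙 X.spanObj) ≫ X.spanMul) => p.1.1.1) h)
          (congrArg (fun p : SetSpan.apex ((X.spanMul ⊠₁ 𝟙 X.spanObj) ≫ X.spanMul) => p.1.2) h),
        by
          rintro ⟨⟨⟨ξ, x⟩, ξ'⟩, h⟩
          obtain ⟨h₁, h₂⟩ : X.δ 1 ξ = X.δ 2 ξ' ∧ x = X.δ 0 ξ' := Prod.mk.inj h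
          obtain ⟨ψ, rfl, rfl⟩ := hX.existsA h₁
          subst h₂
          exact ⟨ψ, rfl⟩⟩)
    (fun _ => rfl) (fun _ => rfl)

/-- The isomorphism of spans from `X_3` to `α ≫ (1 ⊗ μ) ≫ μ` given by `ψ ↦ (d_2 ψ, d_0 ψ)`. -/
noncomputable def SSet.IsTwoSegal.isoB (hX : X.IsTwoSegal) :
    X.spanTriple ≅ assoc₁ X.spanObj X.spanObj X.spanObj ≫
      (𝟙 X.spanObj ⊠₁ X.spanMul) ≫ X.spanMul :=
  isoOfEquiv
    (Equiv.ofBijective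
      (fun ψ : X _⦋3⦌ => (⟨(((X.δ 2 (X.δ 3 ψ), X.δ 0 (X.δ 3 ψ)), X.δ 0 (X.δ 1 ψ)),
          ⟨((X.δ 2 (X.δ 3 ψ), X.δ 0 ψ), X.δ 2 ψ),
            Prod.ext (X.δ_δ_apply (i := 2) (j := 2) (by decide) ψ)
              (X.δ_δ_apply (i := 0) (j := 1) (by decide) ψ).symm⟩),
        Prod.ext rfl (Prod.ext (X.δ_δ_apply (i := 0) (j := 2) (by decide) ψ)
          (X.δ_δ_apply (i := 0) (j := 0) (by decide) ψ))⟩ :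
          SetSpan.apex (assoc₁ X.spanObj X.spanObj X.spanObj ≫
            (𝟙 X.spanObj ⊠₁ X.spanMul) ≫ X.spanMul)))
      ⟨fun ψ ψ' h => hX.extB
          (congrArg (fun p : SetSpan.apex (assoc₁ X.spanObj X.spanObj X.spanObj ≫
            (𝟙 X.spanObj ⊠₁ X.spanMul) ≫ X.spanMul) => p.1.2.1.2) h)
          (congrArg (fun p : SetSpan.apex (assoc₁ X.spanObj X.spanObj X.spanObj ≫
            (𝟙 X.spanObj ⊠₁ X.spanMul) ≫ X.spanMul) => p.1.2.1.1.2) h),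
        by
          rintro ⟨⟨⟨⟨x₁, x₂⟩, x₃⟩, ⟨⟨⟨x, ξ⟩, ξ'⟩, h⟩⟩, h'⟩
          obtain ⟨h₁, h₂⟩ : x = X.δ 2 ξ' ∧ X.δ 1 ξ = X.δ 0 ξ' := Prod.mk.inj h
          obtain ⟨h₃, h₄⟩ : x₁ = x ∧ (x₂, x₃) = (X.δ 2 ξ, X.δ 0 ξ) := Prod.mk.inj h'
          obtain ⟨h₄, h₅⟩ := Prod.mk.inj h₄
          obtain ⟨ψ, rfl, rfl⟩ := hX.existsB h₂.symm
          subst h₃ h₁ h₄ h₅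
          refine ⟨ψ, Subtype.ext (Prod.ext (Prod.ext (Prod.ext ?_ ?_) ?_) (Subtype.ext
            (Prod.ext (Prod.ext ?_ rfl) rfl)))⟩
          · exact X.δ_δ_apply (i := 2) (j := 2) (by decide) ψ
          · exact X.δ_δ_apply (i := 0) (j := 2) (by decide) ψ
          · exact X.δ_δ_apply (i := 0) (j := 0) (by decide) ψ
          · exact X.δ_δ_apply (i := 2) (j := 2) (by decide) ψ⟩)
    (fun _ => rfl) (fun ψ => (X.δ_δ_apply (i := 1) (j := 1) (by decide) ψ))

/-- The associator: `X_3` is identified with both composites. -/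
noncomputable def SSet.IsTwoSegal.spanAssoc (hX : X.IsTwoSegal) :
    (X.spanMul ⊠₁ 𝟙 X.spanObj) ≫ X.spanMul ≅ assoc₁ X.spanObj X.spanObj X.spanObj ≫
      (𝟙 X.spanObj ⊠₁ X.spanMul) ≫ X.spanMul :=
  hX.isoA.symm ≪≫ hX.isoB

theorem SSet.δ_σ_self_apply (X : SSet.{u}) {n : ℕ} (i : Fin (n + 1)) (ψ : X _⦋n⦌) :
    X.δ i.castSucc (X.σ i ψ) = ψ :=
  ConcreteCategory.congr_hom (X.δ_comp_σ_self (i := i)) ψ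

theorem SSet.δ_σ_succ_apply (X : SSet.{u}) {n : ℕ} (i : Fin (n + 1)) (ψ : X _⦋n⦌) :
    X.δ i.succ (X.σ i ψ) = ψ :=
  ConcreteCategory.congr_hom (X.δ_comp_σ_succ (i := i)) ψ

theorem SSet.δ_σ_le_apply (X : SSet.{u}) {n : ℕ} {i : Fin (n + 2)} {j : Fin (n + 1)}
    (h : i ≤ j.castSucc) (ψ : X _⦋n + 1⦌) : X.δ i.castSucc (X.σ j.succ ψ) = X.σ j (X.δ i ψ) :=
  ConcreteCategory.congr_hom (X.δ_comp_σ_of_le h) ψ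

theorem SSet.δ_σ_gt_apply (X : SSet.{u}) {n : ℕ} {i : Fin (n + 2)} {j : Fin (n + 1)}
    (h : j.castSucc < i) (ψ : X _⦋n + 1⦌) : X.δ i.succ (X.σ j.castSucc ψ) = X.σ j (X.δ i ψ) :=
  ConcreteCategory.congr_hom (X.δ_comp_σ_of_gt h) ψ

theorem SSet.σ_σ_apply (X : SSet.{u}) (v : X _⦋0⦌) : X.σ 0 (X.σ 0 v) = X.σ 1 (X.σ 0 v) :=
  ConcreteCategory.congr_hom (X.σ_comp_σ (i := 0) (j := 0) le_rfl) v

theorem SSet.IsTwoSegal.unital_left (hX : X.IsTwoSegal) {v : X _⦋0⦌} {ξ : X _⦋2⦌}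
    (h : X.σ 0 v = X.δ 2 ξ) : X.σ 0 (X.δ 1 ξ) = ξ := by
  have key : X.σ 0 ξ = X.σ 1 ξ := by
    apply hX.extA
    · have h₁ : X.δ 3 (X.σ 0 ξ) = X.σ 0 (X.δ 2 ξ) :=
        X.δ_σ_gt_apply (i := 2) (j := 0) (by decide) ξ
      have h₂ : X.δ 3 (X.σ 1 ξ) = X.σ 1 (X.δ 2 ξ) :=
        X.δ_σ_gt_apply (i := 2) (j := 1) (by decide) ξ
      rw [h₁, h₂, ← h, X.σ_σ_apply]
    · exact (X.δ_σ_succ_apply 0 ξ).trans (X.δ_σ_self_apply 1 ξ).symm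
  have h₁ : X.δ 2 (X.σ 0 ξ) = X.σ 0 (X.δ 1 ξ) := X.δ_σ_gt_apply (i := 1) (j := 0) (by decide) ξ
  rw [← h₁, key]
  exact X.δ_σ_succ_apply 1 ξ

theorem SSet.IsTwoSegal.unital_right (hX : X.IsTwoSegal) {v : X _⦋0⦌} {ξ : X _⦋2⦌}
    (h : X.σ 0 v = X.δ 0 ξ) : X.σ 1 (X.δ 1 ξ) = ξ := by
  have key : X.σ 1 ξ = X.σ 2 ξ := by
    apply hX.extB
    · exact (X.δ_σ_succ_apply 1 ξ).trans (X.δ_σ_self_apply 2 ξ).symm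
    · have h₁ : X.δ 0 (X.σ 1 ξ) = X.σ 0 (X.δ 0 ξ) :=
        X.δ_σ_le_apply (i := 0) (j := 0) (by decide) ξ
      have h₂ : X.δ 0 (X.σ 2 ξ) = X.σ 1 (X.δ 0 ξ) :=
        X.δ_σ_le_apply (i := 0) (j := 1) (by decide) ξ
      rw [h₁, h₂, ← h, X.σ_σ_apply]
  have h₁ : X.δ 1 (X.σ 2 ξ) = X.σ 1 (X.δ 1 ξ) := X.δ_σ_le_apply (i := 1) (j := 1) (by decide) ξ
  rw [← h₁, ← key]
  exact X.δ_σ_self_apply 1 ξ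

/-- The left unitor, with inverse `x ↦ ((d_1 x, x), s_0 x)`. -/
def SSet.IsTwoSegal.spanLeftUnitor (hX : X.IsTwoSegal) :
    (X.spanUnit ⊠₁ 𝟙 X.spanObj) ≫ X.spanMul ≅ leftUnit X.spanObj :=
  isoOfEquiv (f := (X.spanUnit ⊠₁ 𝟙 X.spanObj) ≫ X.spanMul) (g := leftUnit X.spanObj)
    { toFun := fun p => (PUnit.unit, p.1.1.2)
      invFun := fun q => ⟨((X.δ 1 q.2, q.2), X.σ 0 q.2), Prod.ext
        (X.δ_σ_gt_apply (i := 1) (j := 0) (by decide) q.2).symm (X.δ_σ_self_apply 0 q.2).symm⟩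
      left_inv := by
        rintro ⟨⟨⟨v, x⟩, ξ⟩, h⟩
        obtain ⟨h₁, rfl⟩ : X.σ 0 v = X.δ 2 ξ ∧ x = X.δ 0 ξ := Prod.mk.inj h
        have h₂ := hX.unital_left h₁
        have h₃ : X.δ 0 ξ = X.δ 1 ξ :=
          (congrArg (X.δ 0) h₂).symm.trans (X.δ_σ_self_apply 0 (X.δ 1 ξ))
        have h₄ : X.δ 1 (X.δ 0 ξ) = v :=
          ((X.δ_δ_apply (i := 0) (j := 1) (by decide) ξ).symm.trans
            (congrArg (X.δ 0) h₁).symm).trans (X.δ_σ_self_apply 0 v)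
        exact Subtype.ext (Prod.ext (Prod.ext h₄ rfl) ((congrArg (X.σ 0) h₃).trans h₂))
      right_inv := fun _ => rfl } (fun _ => rfl)
    (by
      rintro ⟨⟨⟨v, x⟩, ξ⟩, h⟩
      obtain ⟨h₁, rfl⟩ : X.σ 0 v = X.δ 2 ξ ∧ x = X.δ 0 ξ := Prod.mk.inj h
      exact (congrArg (X.δ 0) (hX.unital_left h₁)).symm.trans (X.δ_σ_self_apply 0 (X.δ 1 ξ)))

/-- The right unitor, with inverse `x ↦ ((x, d_0 x), s_1 x)`. -/
def SSet.IsTwoSegal.spanRightUnitor (hX : X.IsTwoSegal) :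
    (𝟙 X.spanObj ⊠₁ X.spanUnit) ≫ X.spanMul ≅ rightUnit X.spanObj :=
  isoOfEquiv (f := (𝟙 X.spanObj ⊠₁ X.spanUnit) ≫ X.spanMul) (g := rightUnit X.spanObj)
    { toFun := fun p => (p.1.1.1, PUnit.unit)
      invFun := fun q => ⟨((q.1, X.δ 0 q.1), X.σ 1 q.1), Prod.ext
        (X.δ_σ_succ_apply 1 q.1).symm (X.δ_σ_le_apply (i := 0) (j := 0) (by decide) q.1).symm⟩
      left_inv := by
        rintro ⟨⟨⟨x, v⟩, ξ⟩, h⟩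
        obtain ⟨rfl, h₁⟩ : x = X.δ 2 ξ ∧ X.σ 0 v = X.δ 0 ξ := Prod.mk.inj h
        have h₂ := hX.unital_right h₁
        have h₃ : X.δ 2 ξ = X.δ 1 ξ :=
          (congrArg (X.δ 2) h₂).symm.trans (X.δ_σ_succ_apply 1 (X.δ 1 ξ))
        have h₄ : X.δ 0 (X.δ 2 ξ) = v :=
          ((X.δ_δ_apply (i := 0) (j := 1) (by decide) ξ).trans
            (congrArg (X.δ 1) h₁).symm).trans (X.δ_σ_succ_apply 0 v)
        exact Subtype.ext (Prod.ext (Prod.ext rfl h₄) ((congrArg (X.σ 1) h₃).trans h₂))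
      right_inv := fun _ => rfl } (fun _ => rfl)
    (by
      rintro ⟨⟨⟨x, v⟩, ξ⟩, h⟩
      obtain ⟨rfl, h₁⟩ : x = X.δ 2 ξ ∧ X.σ 0 v = X.δ 0 ξ := Prod.mk.inj h
      exact (congrArg (X.δ 2) (hX.unital_right h₁)).symm.trans (X.δ_σ_succ_apply 1 (X.δ 1 ξ)))

theorem SSet.IsTwoSegal.spanAssoc_app (hX : X.IsTwoSegal) (ψ : X _⦋3⦌)
    (p : SetSpan.apex ((X.spanMul ⊠₁ 𝟙 X.spanObj) ≫ X.spanMul))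
    (h₃ : p.1.1.1 = X.δ 3 ψ) (h₁ : p.1.2 = X.δ 1 ψ) :
    (app hX.spanAssoc.hom p).1.2.1.1.2 = X.δ 0 ψ ∧ (app hX.spanAssoc.hom p).1.2.1.2 = X.δ 2 ψ := by
  have hp : p = app hX.isoA.hom ψ := by
    obtain ⟨⟨⟨ξ, x⟩, ξ'⟩, h⟩ := p
    have h₂ : x = X.δ 0 ξ' := (Prod.mk.inj h).2
    refine Subtype.ext (Prod.ext (Prod.ext h₃ (h₂.trans (congrArg (X.δ 0) h₁))) h₁)
  have : app hX.isoA.inv p = ψ := by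
    rw [hp]
    exact congrFun (congrArg Hom.map hX.isoA.hom_inv_id) ψ
  change (app hX.isoB.hom (app hX.isoA.inv p)).1.2.1.1.2 = _ ∧
    (app hX.isoB.hom (app hX.isoA.inv p)).1.2.1.2 = _
  rw [this]
  exact ⟨rfl, rfl⟩

end Associated

section Coherence

/-- Elements of the common target of the two sides of the pentagon equation. -/
theorem pentagon_ext {Y : SpanSet.{u}} {μ : Y ⊠ Y ⟶ Y}
    (p q : SetSpan.apex (assoc₁ (Y ⊠ Y) Y Y ≫ assoc₁ Y Y (Y ⊠ Y) ≫
        (𝟙 Y ⊠₁ (𝟙 Y ⊠₁ μ)) ≫ (𝟙 Y ⊠₁ μ) ≫ μ))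
    (h₀ : SetSpan.left (assoc₁ (Y ⊠ Y) Y Y ≫ assoc₁ Y Y (Y ⊠ Y) ≫
        (𝟙 Y ⊠₁ (𝟙 Y ⊠₁ μ)) ≫ (𝟙 Y ⊠₁ μ) ≫ μ) p = SetSpan.left (assoc₁ (Y ⊠ Y) Y Y ≫
          assoc₁ Y Y (Y ⊠ Y) ≫ (𝟙 Y ⊠₁ (𝟙 Y ⊠₁ μ)) ≫ (𝟙 Y ⊠₁ μ) ≫ μ) q) (h₁ : p.1.2.1.2.1.1.2.2 = q.1.2.1.2.1.1.2.2)
    (h₂ : p.1.2.1.2.1.2.1.1.2 = q.1.2.1.2.1.2.1.1.2)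
    (h₃ : p.1.2.1.2.1.2.1.2 = q.1.2.1.2.1.2.1.2) : p = q := by
  obtain ⟨⟨p₁, ⟨⟨p₂, ⟨⟨⟨p₃, ⟨p₃', p₃''⟩⟩, ⟨⟨⟨p₄, p₄'⟩, p₅⟩, e₄⟩⟩, e₃⟩⟩, e₂⟩⟩, e₁⟩ := p
  obtain ⟨⟨q₁, ⟨⟨q₂, ⟨⟨⟨q₃, ⟨q₃', q₃''⟩⟩, ⟨⟨⟨q₄, q₄'⟩, q₅⟩, f₄⟩⟩, f₃⟩⟩, f₂⟩⟩, f₁⟩ := q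
  obtain rfl : p₁ = q₁ := h₀
  dsimp only at h₁ h₂ h₃
  subst h₁ h₂ h₃
  obtain rfl : p₂ = q₂ := Eq.trans (Eq.symm e₁) f₁
  have e := Eq.trans (Eq.symm e₂) f₂
  obtain ⟨g₁, g₂⟩ := Prod.mk.inj e
  obtain ⟨g₂, -⟩ := Prod.mk.inj g₂
  obtain rfl : p₃ = q₃ := g₁
  obtain rfl : p₃' = q₃' := g₂
  obtain rfl : p₄ = q₄ := (Prod.mk.inj (Eq.trans (Eq.symm e₃) f₃)).1
  rfl

theorem pentagon_aux {X : SSet.{u}} (hX : X.IsTwoSegal)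
    (a : (X.spanMul ⊠₁ 𝟙 X.spanObj) ≫ X.spanMul ≅ assoc₁ X.spanObj X.spanObj X.spanObj ≫
      (𝟙 X.spanObj ⊠₁ X.spanMul) ≫ X.spanMul)
    (ha : ∀ (ψ : X _⦋3⦌) (p : SetSpan.apex ((X.spanMul ⊠₁ 𝟙 X.spanObj) ≫ X.spanMul)),
      p.1.1.1 = X.δ 3 ψ → p.1.2 = X.δ 1 ψ →
      (app a.hom p).1.2.1.1.2 = X.δ 0 ψ ∧ (app a.hom p).1.2.1.2 = X.δ 2 ψ) :
    PentagonEquation X.spanMul a := by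
  refine SetSpan.hom_ext fun p => pentagon_ext _ _ ?_ ?_ ?_ ?_
  · exact (left_app _ p).trans (left_app _ p).symm
  all_goals
    obtain ⟨⟨⟨⟨ξ₁, x₃⟩, x₄⟩, ⟨⟨⟨ξ₂, x₄'⟩, ξ₃⟩, h₁⟩⟩, h₂⟩ := p
    obtain ⟨k₁, k₂⟩ : X.δ 1 ξ₂ = X.δ 2 ξ₃ ∧ x₄' = X.δ 0 ξ₃ := Prod.mk.inj h₁
    obtain ⟨k₃, k₄⟩ : (X.δ 1 ξ₁, x₃) = (X.δ 2 ξ₂, X.δ 0 ξ₂) ∧ x₄ = x₄' := Prod.mk.inj h₂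
    obtain ⟨k₃, k₅⟩ := Prod.mk.inj k₃
    obtain ⟨ω, rfl, rfl, rfl⟩ := hX.exists₄ k₃ k₁
    subst k₅ k₄ k₂
  · exact Eq.trans (b := X.δ 0 (X.δ 0 ω))
      (ha (X.δ 0 ω) _
        ((ha (X.δ 4 ω) _ rfl rfl).1.trans (X.δ_δ_apply (i := 0) (j := 3) (by decide) ω))
        ((ha (X.δ 2 ω) _
          ((ha (X.δ 4 ω) _ rfl rfl).2.trans (X.δ_δ_apply (i := 2) (j := 3) (by decide) ω))
          rfl).1.trans (X.δ_δ_apply (i := 0) (j := 1) (by decide) ω))).1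
      (Eq.symm ((ha (X.δ 1 ω) _ (X.δ_δ_apply (i := 1) (j := 3) (by decide) ω)
        (X.δ_δ_apply (i := 1) (j := 1) (by decide) ω)).1.trans
          (X.δ_δ_apply (i := 0) (j := 0) (by decide) ω)))
  · exact Eq.trans (b := X.δ 2 (X.δ 0 ω))
      (ha (X.δ 0 ω) _
        ((ha (X.δ 4 ω) _ rfl rfl).1.trans (X.δ_δ_apply (i := 0) (j := 3) (by decide) ω))
        ((ha (X.δ 2 ω) _
          ((ha (X.δ 4 ω) _ rfl rfl).2.trans (X.δ_δ_apply (i := 2) (j := 3) (by decide) ω))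
          rfl).1.trans (X.δ_δ_apply (i := 0) (j := 1) (by decide) ω))).2
      (Eq.symm ((ha (X.δ 3 ω) _ (X.δ_δ_apply (i := 3) (j := 3) (by decide) ω)
        ((ha (X.δ 1 ω) _ (X.δ_δ_apply (i := 1) (j := 3) (by decide) ω)
          (X.δ_δ_apply (i := 1) (j := 1) (by decide) ω)).2.trans
            (X.δ_δ_apply (i := 1) (j := 2) (by decide) ω).symm)).1.trans
              (X.δ_δ_apply (i := 0) (j := 2) (by decide) ω)))
  · exact Eq.trans (b := X.δ 2 (X.δ 2 ω))
      (ha (X.δ 2 ω) _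
        ((ha (X.δ 4 ω) _ rfl rfl).2.trans (X.δ_δ_apply (i := 2) (j := 3) (by decide) ω)) rfl).2
      (Eq.symm ((ha (X.δ 3 ω) _ (X.δ_δ_apply (i := 3) (j := 3) (by decide) ω)
        ((ha (X.δ 1 ω) _ (X.δ_δ_apply (i := 1) (j := 3) (by decide) ω)
          (X.δ_δ_apply (i := 1) (j := 1) (by decide) ω)).2.trans
            (X.δ_δ_apply (i := 1) (j := 2) (by decide) ω).symm)).2.trans
              (X.δ_δ_apply (i := 2) (j := 2) (by decide) ω)))

/-- Elements of the common target of the two sides of the triangle equation. -/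
theorem triangle_ext {Y : SpanSet.{u}} {μ : Y ⊠ Y ⟶ Y}
    (p q : SetSpan.apex ((rightUnit Y ⊠₁ 𝟙 Y) ≫ μ))
    (h₀ : SetSpan.left ((rightUnit Y ⊠₁ 𝟙 Y) ≫ μ) p =
      SetSpan.left ((rightUnit Y ⊠₁ 𝟙 Y) ≫ μ) q) (h₁ : p.1.2 = q.1.2) : p = q :=
  Subtype.ext (Prod.ext h₀ h₁)

theorem triangle_aux {X : SSet.{u}} (hX : X.IsTwoSegal)
    (a : (X.spanMul ⊠₁ 𝟙 X.spanObj) ≫ X.spanMul ≅ assoc₁ X.spanObj X.spanObj X.spanObj ≫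
      (𝟙 X.spanObj ⊠₁ X.spanMul) ≫ X.spanMul)
    (ha : ∀ (ψ : X _⦋3⦌) (p : SetSpan.apex ((X.spanMul ⊠₁ 𝟙 X.spanObj) ≫ X.spanMul)),
      p.1.1.1 = X.δ 3 ψ → p.1.2 = X.δ 1 ψ →
      (app a.hom p).1.2.1.1.2 = X.δ 0 ψ ∧ (app a.hom p).1.2.1.2 = X.δ 2 ψ) :
    TriangleEquation X.spanUnit X.spanMul a hX.spanLeftUnitor hX.spanRightUnitor := by
  refine SetSpan.hom_ext fun p => triangle_ext _ _ ?_ ?_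
  · exact (left_app _ p).trans (left_app _ p).symm
  · obtain ⟨⟨⟨⟨x₁, v⟩, x₃⟩, ⟨⟨⟨ξ₁, x₃'⟩, ξ₂⟩, h₁⟩⟩, h₂⟩ := p
    obtain ⟨k₁, -⟩ : X.δ 1 ξ₁ = X.δ 2 ξ₂ ∧ x₃' = X.δ 0 ξ₂ := Prod.mk.inj h₁
    obtain ⟨k₂, -⟩ : (x₁, X.σ 0 v) = (X.δ 2 ξ₁, X.δ 0 ξ₁) ∧ x₃ = x₃' := Prod.mk.inj h₂
    have k₃ : X.δ 3 (X.σ 1 ξ₂) = X.σ 1 (X.δ 2 ξ₂) :=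
      X.δ_σ_gt_apply (i := 2) (j := 1) (by decide) ξ₂
    have k₄ : ξ₁ = X.δ 3 (X.σ 1 ξ₂) :=
      (k₃.trans ((congrArg (X.σ 1) k₁).symm.trans (hX.unital_right (Prod.mk.inj k₂).2))).symm
    exact (ha (X.σ 1 ξ₂) _ k₄ (X.δ_σ_self_apply 1 ξ₂).symm).2.trans (X.δ_σ_succ_apply 1 ξ₂)

end Coherence

/-- The pseudomonoid in the bicategory of spans associated to a 2-Segal simplicial set. -/
noncomputable def SSet.IsTwoSegal.pseudomonoid {X : SSet.{u}} (hX : X.IsTwoSegal) :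
    SpanPseudomonoid.{u} where
  obj := X.spanObj
  η := X.spanUnit
  μ := X.spanMul
  a := hX.spanAssoc
  l := hX.spanLeftUnitor
  r := hX.spanRightUnitor
  triangle := triangle_aux hX hX.spanAssoc fun ψ p => hX.spanAssoc_app ψ p
  pentagon := pentagon_aux hX hX.spanAssoc fun ψ p => hX.spanAssoc_app ψ p

/-- A finite pointed cardinal `⟨n⟩ = {∗, 1, …, n}`. -/
structure FinPointedCard : Type where
  card : ℕ

namespace FinPointedCard

/-- The underlying set of `⟨n⟩`, realised as `{0, 1, …, n}` with `0` in the role of `∗`. -/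
abbrev Elem (A : FinPointedCard) : Type := Fin (A.card + 1)

/-- A pointed map. -/
@[ext]
structure Hom (A B : FinPointedCard) : Type where
  toFun : A.Elem → B.Elem
  map_zero : toFun 0 = 0

/-- The category of finite pointed cardinals and pointed maps. -/
instance : Category FinPointedCard where
  Hom := Hom
  id A := ⟨fun i => i, rfl⟩
  comp f g := ⟨fun i => g.toFun (f.toFun i), by rw [f.map_zero, g.map_zero]⟩

/-- The transposition of `1` and `2` on `⟨2⟩`. -/
def swap : (⟨2⟩ : FinPointedCard) ⟶ ⟨2⟩ :=
  (⟨Equiv.swap 1 2, by decide⟩ : Hom ⟨2⟩ ⟨2⟩)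

/-- The map `⟨m⟩ → ⟨n⟩` induced by a monotone map `f : {0, …, n} → {0, …, m}`: it sends `i` to `∗`
if `f 0 ≥ i` or `f n < i`, and to the least `k` with `f k ≥ i` otherwise. -/
def cutMap {n m : ℕ} (f : Fin (n + 1) →o Fin (m + 1)) (i : Fin (m + 1)) : Fin (n + 1) :=
  if h : i ≤ f 0 ∨ f (Fin.last n) < i then 0
  else Fin.find (fun k => i ≤ f k) ⟨Fin.last n, not_lt.mp (not_or.mp h).2⟩

theorem cutMap_eq_zero {n m : ℕ} (f : Fin (n + 1) →o Fin (m + 1)) (i : Fin (m + 1))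
    (h : f (Fin.last n) < i) : cutMap f i = 0 := by
  simp [cutMap, h]

theorem cutMap_le_iff {n m : ℕ} (f : Fin (n + 1) →o Fin (m + 1)) (i : Fin (m + 1))
    (h : i ≤ f (Fin.last n)) (k : Fin (n + 1)) : cutMap f i ≤ k ↔ i ≤ f k := by
  by_cases h₀ : i ≤ f 0
  · simp only [cutMap, h₀, true_or, dite_true, Fin.zero_le, true_iff]
    exact h₀.trans (f.monotone (Fin.zero_le k))
  · rw [cutMap, dif_neg (not_or.mpr ⟨h₀, not_lt.mpr h⟩)]
    constructor
    · intro hk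
      exact le_trans (Fin.find_spec (p := fun k => i ≤ f k) ⟨_, h⟩) (f.monotone hk)
    · intro hk
      exact Fin.find_le_of_pos _ hk

theorem eq_of_le_iff {n : ℕ} {a b : Fin (n + 1)} (h : ∀ k, a ≤ k ↔ b ≤ k) : a = b :=
  le_antisymm ((h b).2 le_rfl) ((h a).1 le_rfl)

theorem cutMap_id (n : ℕ) (i : Fin (n + 1)) : cutMap (OrderHom.id : Fin (n + 1) →o _) i = i :=
  eq_of_le_iff fun k => cutMap_le_iff OrderHom.id i (Fin.le_last i) k

theorem cutMap_comp {n m p : ℕ} (f : Fin (n + 1) →o Fin (m + 1)) (g : Fin (m + 1) →o Fin (p + 1))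
    (i : Fin (p + 1)) : cutMap (g.comp f) i = cutMap f (cutMap g i) := by
  rcases lt_or_ge (g (Fin.last m)) i with h | h
  · rw [cutMap_eq_zero g i h, cutMap_eq_zero (g.comp f) i
      (lt_of_le_of_lt (g.monotone (Fin.le_last _)) h)]
    simp [cutMap]
  · rcases lt_or_ge (g (f (Fin.last n))) i with h' | h'
    · rw [cutMap_eq_zero (g.comp f) i h', cutMap_eq_zero f]
      exact not_le.mp fun hh => not_le.mpr h' ((cutMap_le_iff g i h _).1 hh)
    · refine eq_of_le_iff fun k => ?_
      rw [cutMap_le_iff (g.comp f) i h', cutMap_le_iff f _ ((cutMap_le_iff g i h _).2 h'),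
        cutMap_le_iff g i h]
      rfl

/-- The functor `Cut`. -/
def cut : SimplexCategoryᵒᵖ ⥤ FinPointedCard where
  obj x := ⟨x.unop.len⟩
  map f := (⟨cutMap f.unop.toOrderHom, by simp [cutMap]⟩ : Hom _ _)
  map_id x := Hom.ext (funext fun i => cutMap_id _ i)
  map_comp f g := Hom.ext (funext fun i => cutMap_comp _ _ i)

end FinPointedCard

/-- A Γ-structure on a simplicial set `X`: a functor from finite pointed cardinals to sets whose
restriction along `Cut` is `X`. -/
structure GammaStructure (X : SSet.{u}) : Type (u + 1) where
  functor : FinPointedCard ⥤ Type u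
  cut_comp : FinPointedCard.cut ⋙ functor = X

/-- The action of the transposition of `⟨2⟩` on the set `X_2` underlying a Γ-structure. -/
def GammaStructure.theta {X : SSet.{u}} (G : GammaStructure X) : X _⦋2⦌ ⟶ X _⦋2⦌ :=
  eqToHom (congrArg (fun Y : SSet.{u} => Y _⦋2⦌) G.cut_comp.symm) ≫
    G.functor.map FinPointedCard.swap ≫
    eqToHom (congrArg (fun Y : SSet.{u} => Y _⦋2⦌) G.cut_comp)

/-- Two commutative structures on the same pseudomonoid are equivalent when the identity morphism of
the pseudomonoid (with identity 2-cells) is compatible with them. Since a commutative structure is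
a 2-morphism, and 2-morphisms of spans are compared by equality, no weaker relation is available
that keeps the pseudomonoid fixed. -/
def CommStructure.Equivalent {M : SpanPseudomonoid.{u}} (c c' : CommStructure M) : Prop :=
  c.γ.hom ≫ (braid M.obj M.obj ◁ 𝟙 M.μ) = 𝟙 M.μ ≫ c'.γ.hom

instance CommStructure.setoid (M : SpanPseudomonoid.{u}) : Setoid (CommStructure M) where
  r := CommStructure.Equivalent
  iseqv := by
    have h (c c' : CommStructure M) : c.Equivalent c' ↔ c.γ.hom = c'.γ.hom := by
      simp [CommStructure.Equivalent]
    exact ⟨fun c => (h c c).2 rfl, fun H => (h _ _).2 ((h _ _).1 H).symm,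
      fun H H' => (h _ _).2 (((h _ _).1 H).trans ((h _ _).1 H'))⟩

/-! Both sides of the correspondence amount to one map `θ` from 2-simplices to 2-simplices with the
properties in `SSet.IsBraiding`: it exchanges the faces `d_2` and `d_0`, keeps `d_1`, is an
involution and satisfies a condition on 3-simplices. For a commutative structure, `θ` is the only
free component of the map of spans, and the hexagon equation evaluated at `(d_3 ψ, d_1 ψ)` is the
condition on 3-simplices (`hexagonEquation_iff`). For a Γ-structure `F`, `θ` is `F(τ)` and the
properties are identities between pointed maps (`SSet.isBraiding_of_functorial`). The substance is
that `θ` extends to a functor `F` in exactly one way.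

Regard an `n`-simplex as a formal product of its `n` consecutive edges. In the fan triangulation at
the vertex `i + 2` the vertex `i + 1` is an ear, so the 2-Segal condition allows the triangle `i, i
+ 1, i + 2` to be replaced by its image under `θ` while everything that avoids `i + 1` stays fixed.
This is `transpose`. These operators satisfy the Coxeter relations of the symmetric group; the braid
relation (`transpose_braid`) is where the hexagon enters.

A pointed map is a permutation followed by some `Cut α` with `α 0 = 0`: sort the elements by value,
the base point last. Sorting by adjacent transpositions therefore defines the operator `gammaMap` of
a pointed map. The Coxeter relations, and the fact that `α` does not see transpositions inside a
fibre, make the result independent of the way of sorting (`sortEval_swapAt`).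

Functoriality is checked on generators in the second argument. A `Cut α` with `α 0 > 0` is reduced
to the case `α 0 = 0` by cyclic rotations (`face_rotate`), which rely on every edge being a loop. An
adjacent transposition is reduced to the transposition of `⟨2⟩`, and there `gammaMap_comp_swap`
proceeds by induction on the number of elements not sent to the base point: a fibre with two
elements is split by a map to `⟨3⟩`, and moving one factor past two is the hexagon. Uniqueness is
`eq_gammaMap`: on adjacent transpositions every such functor must be `transpose`, and these together
with the maps `Cut α` generate all pointed maps. -/

namespace SimplexCategory

/-! ### Monotone maps in natural number coordinates. -/

/-- The value of a monotone map at a natural number, which is truncated to the domain. -/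
def vtx {m n : ℕ} (α : ⦋m⦌ ⟶ ⦋n⦌) (j : ℕ) : ℕ :=
  (α ⟨min j m, Nat.lt_succ_of_le (min_le_right j m)⟩ : Fin (n + 1))

/-- The monotone map given by a monotone function on natural numbers, truncated to the codomain. -/
def ofNatMap (m n : ℕ) (g : ℕ → ℕ) (hg : ∀ a b, a ≤ b → g a ≤ g b) : ⦋m⦌ ⟶ ⦋n⦌ :=
  mkHom ⟨fun j => ⟨min (g j) n, by omega⟩, fun j k h => by
    have := hg j k (show (j : ℕ) ≤ k from h)
    simp only [Fin.mk_le_mk]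
    omega⟩

/-- The inclusion of an interval of vertices starting at `c`. -/
def seg (m n c : ℕ) : ⦋m⦌ ⟶ ⦋n⦌ := ofNatMap m n (fun j => c + j) fun _ _ h =>
  Nat.add_le_add_left h c

/-- The coface map which misses the vertex `v`. -/
def face (m v : ℕ) : ⦋m⦌ ⟶ ⦋m + 1⦌ :=
  ofNatMap m (m + 1) (fun j => if j < v then j else j + 1) fun a b h => by
    split_ifs <;> omega

variable {l m n : ℕ}

theorem vtx_of_le (α : ⦋m⦌ ⟶ ⦋n⦌) {j : ℕ} (h : j ≤ m) :
    vtx α j = (α ⟨j, Nat.lt_succ_of_le h⟩ : Fin (n + 1)) := by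
  simp [vtx, h]

theorem vtx_fin (α : ⦋m⦌ ⟶ ⦋n⦌) (j : Fin (m + 1)) : vtx α j = (α j : Fin (n + 1)) :=
  vtx_of_le α (Nat.le_of_lt_succ j.2)

theorem vtx_le (α : ⦋m⦌ ⟶ ⦋n⦌) (j : ℕ) : vtx α j ≤ n :=
  Nat.le_of_lt_succ (α ⟨min j m, Nat.lt_succ_of_le (min_le_right j m)⟩ : Fin (n + 1)).2

theorem vtx_mono (α : ⦋m⦌ ⟶ ⦋n⦌) {a b : ℕ} (h : a ≤ b) : vtx α a ≤ vtx α b :=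
  α.toOrderHom.monotone (show (⟨min a m, _⟩ : Fin (m + 1)) ≤ ⟨min b m, _⟩ from
    Fin.mk_le_mk.2 (by omega))

theorem vtx_min (α : ⦋m⦌ ⟶ ⦋n⦌) (j : ℕ) : vtx α (min j m) = vtx α j := by
  simp [vtx]

theorem vtx_comp (α : ⦋l⦌ ⟶ ⦋m⦌) (β : ⦋m⦌ ⟶ ⦋n⦌) (j : ℕ) :
    vtx (α ≫ β) j = vtx β (vtx α j) := by
  rw [vtx_of_le β (vtx_le α j)]
  rfl

theorem hom_ext_vtx {α β : ⦋m⦌ ⟶ ⦋n⦌} (h : ∀ j ≤ m, vtx α j = vtx β j) : α = β := by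
  apply SimplexCategory.Hom.ext
  apply OrderHom.ext
  funext j
  apply Fin.ext
  have := h j (Nat.le_of_lt_succ j.2)
  rwa [vtx_fin, vtx_fin] at this

theorem vtx_mkHom (f : Fin (m + 1) →o Fin (n + 1)) {j : ℕ} (h : j ≤ m) :
    vtx (mkHom f) j = f ⟨j, Nat.lt_succ_of_le h⟩ :=
  vtx_of_le _ h

theorem vtx_ofNatMap (g : ℕ → ℕ) (hg : ∀ a b, a ≤ b → g a ≤ g b) (j : ℕ) :
    vtx (ofNatMap m n g hg) j = min (g (min j m)) n := rfl

theorem vtx_seg (c : ℕ) (h : c + m ≤ n) {j : ℕ} (hj : j ≤ m) : vtx (seg m n c) j = c + j := by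
  rw [seg, vtx_ofNatMap]
  omega

theorem vtx_face (v : ℕ) {j : ℕ} (hj : j ≤ m) :
    vtx (face m v) j = if j < v then j else j + 1 := by
  rw [face, vtx_ofNatMap, min_eq_left hj]
  split_ifs <;> omega

theorem vtx_id {j : ℕ} (hj : j ≤ m) : vtx (𝟙 ⦋m⦌) j = j := vtx_of_le _ hj

theorem face_eq_δ (k : Fin (m + 2)) : face m k = δ k := by
  apply hom_ext_vtx
  intro j hj
  rw [vtx_face _ hj, vtx_of_le _ hj]
  change _ = ((k.succAbove ⟨j, _⟩ : Fin (m + 2)) : ℕ)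
  simp only [Fin.succAbove, Fin.lt_def, Fin.val_castSucc]
  split_ifs <;> rfl

theorem exists_comp_face (α : ⦋l⦌ ⟶ ⦋m + 1⦌) {v : ℕ} (hv : v ≤ m + 1)
    (h : ∀ j, vtx α j ≠ v) : ∃ β : ⦋l⦌ ⟶ ⦋m⦌, α = β ≫ face m v := by
  refine ⟨ofNatMap l m (fun j => if vtx α j < v then vtx α j else vtx α j - 1) ?_, ?_⟩
  · intro a b hab
    have := vtx_mono α hab
    split_ifs <;> omega
  · apply hom_ext_vtx
    intro j hj
    have h₁ := h j
    have h₂ := vtx_le α j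
    rw [vtx_comp, vtx_face _ (vtx_le _ _), vtx_ofNatMap, min_eq_left hj]
    split_ifs <;> omega

end SimplexCategory

open SimplexCategory

namespace SSet

variable (X : SSet.{u}) {l m n : ℕ}

/-- Restriction of simplices along a monotone map. -/
def res (α : ⦋m⦌ ⟶ ⦋n⦌) (x : X _⦋n⦌) : X _⦋m⦌ := X.map α.op x

theorem res_res (α : ⦋l⦌ ⟶ ⦋m⦌) (β : ⦋m⦌ ⟶ ⦋n⦌) (x : X _⦋n⦌) :
    X.res α (X.res β x) = X.res (α ≫ β) x := by
  rw [res, res, res, op_comp, Functor.map_comp_apply]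

theorem res_id (x : X _⦋n⦌) : X.res (𝟙 ⦋n⦌) x = x := by
  rw [res, op_id, X.map_id]
  rfl

theorem δ_eq_res (k : Fin (m + 2)) (x : X _⦋m + 1⦌) : X.δ k x = X.res (face m k) x := by
  rw [face_eq_δ]
  rfl

theorem res_congr {α β : ⦋m⦌ ⟶ ⦋n⦌} (x : X _⦋n⦌)
    (h : ∀ j ≤ m, vtx α j = vtx β j) : X.res α x = X.res β x := by
  rw [hom_ext_vtx h]

theorem triangleFace_eq_res (t : Fin 3 ↪o Fin (n + 1)) (x : X _⦋n⦌) :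
    X.triangleFace t x = X.res (mkHom t.toOrderHom) x := rfl

end SSet

/-! ### Fan triangulations and the replacement of one triangle of a simplex. -/

/-- The fan triangulation of a polygon: its sides and the diagonals at the vertex `c`. -/
def polygonFan (n c : ℕ) : Set (PolygonChord n) :=
  {d | (d.1.2 : ℕ) = d.1.1 + 1 ∨ ((d.1.1 : ℕ) = 0 ∧ (d.1.2 : ℕ) = n) ∨
    (d.1.1 : ℕ) = c ∨ (d.1.2 : ℕ) = c}

theorem mem_polygonFan {n c : ℕ} {i j : Fin (n + 1)} (h : i < j) :
    (⟨(i, j), h⟩ : PolygonChord n) ∈ polygonFan n c ↔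
      (j : ℕ) = i + 1 ∨ ((i : ℕ) = 0 ∧ (j : ℕ) = n) ∨ (i : ℕ) = c ∨ (j : ℕ) = c := Iff.rfl

theorem polygonFan_isTriangulation {n c : ℕ} (hc : c ≤ n) :
    IsPolygonTriangulation (polygonFan n c) := by
  apply isPolygonTriangulation_of
  · rintro ⟨⟨⟨i, hi⟩, ⟨j, hj⟩⟩, h⟩ hc ⟨⟨⟨k, hk⟩, ⟨l, hl⟩⟩, h'⟩ hd
    replace hc := (mem_polygonFan h).1 hc
    replace hd := (mem_polygonFan h').1 hd
    replace h : i < j := h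
    replace h' : k < l := h'
    dsimp only at hc hd
    change ¬((i < k ∧ k < j ∧ j < l) ∨ (k < i ∧ i < l ∧ l < j))
    omega
  · rintro ⟨⟨⟨i, hi⟩, ⟨j, hj⟩⟩, h⟩ hd
    have hd' : ¬(j = i + 1 ∨ (i = 0 ∧ j = n) ∨ i = c ∨ j = c) :=
      fun e => hd ((mem_polygonFan h).2 e)
    replace h : i < j := h
    -- The missing chord `(i, j)` separates `c` from some vertex: from `i + 1` if `c` lies outside
    -- `[i, j]`, otherwise from `0` or from `n`. The diagonal from `c` to that vertex crosses it.
    have key : ∃ k l : ℕ, k < l ∧ l ≤ n ∧ (k = c ∨ l = c) ∧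
        ((i < k ∧ k < j ∧ j < l) ∨ (k < i ∧ i < l ∧ l < j)) := by
      by_cases h₁ : c < i
      · exact ⟨c, i + 1, by omega⟩
      by_cases h₂ : j < c
      · exact ⟨i + 1, c, by omega⟩
      by_cases h₃ : 0 < i
      · exact ⟨0, c, by omega⟩
      · exact ⟨c, n, by omega⟩
    obtain ⟨k, l, hkl, hl, hT, hx⟩ := key
    refine ⟨⟨(⟨k, by omega⟩, ⟨l, by omega⟩), hkl⟩, Or.inr (Or.inr hT), ?_⟩
    simpa only [PolygonChord.Crosses, Fin.mk_lt_mk] using hx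

/-- In the fan at `i + 2` the vertex `i + 1` is an ear: the only chords that end there are the sides
to `i` and `i + 2`. -/
theorem polygonFan_triangle {n i : ℕ} (hi : i + 2 ≤ n)
    (t : TriangulationTriangle (polygonFan n (i + 2))) (h : ∃ a, (t.1 a : ℕ) = i + 1) :
    (t.1 0 : ℕ) = i ∧ (t.1 1 : ℕ) = i + 1 ∧ (t.1 2 : ℕ) = i + 2 := by
  have h₀ := t.2 0
  have h₁ := t.2 1
  have h₂ := t.2 2
  have s₀ : (t.1 0 : ℕ) < t.1 1 := t.1.strictMono (by decide)
  have s₁ : (t.1 1 : ℕ) < t.1 2 := t.1.strictMono (by decide)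
  have := (t.1 2).2
  replace h₀ : (t.1 2 : ℕ) = t.1 1 + 1 ∨ ((t.1 1 : ℕ) = 0 ∧ (t.1 2 : ℕ) = n) ∨
    (t.1 1 : ℕ) = i + 2 ∨ (t.1 2 : ℕ) = i + 2 := h₀
  replace h₁ : (t.1 2 : ℕ) = t.1 0 + 1 ∨ ((t.1 0 : ℕ) = 0 ∧ (t.1 2 : ℕ) = n) ∨
    (t.1 0 : ℕ) = i + 2 ∨ (t.1 2 : ℕ) = i + 2 := h₁
  replace h₂ : (t.1 1 : ℕ) = t.1 0 + 1 ∨ ((t.1 0 : ℕ) = 0 ∧ (t.1 1 : ℕ) = n) ∨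
    (t.1 0 : ℕ) = i + 2 ∨ (t.1 1 : ℕ) = i + 2 := h₂
  obtain ⟨a, ha⟩ := h
  fin_cases a <;> simp only [Fin.zero_eta, Fin.mk_one, Fin.reduceFinMk] at ha <;> omega

namespace SSet.IsTwoSegal

variable {X : SSet.{u}} (hX : X.IsTwoSegal) {l m n : ℕ}

include hX

/-- A simplex is determined by the triangles which miss an interior vertex and the triangle at this
vertex. -/
theorem ext_of_triangle {i : ℕ} (hi : i + 2 ≤ n) {x y : X _⦋n⦌}
    (h₁ : ∀ α : ⦋2⦌ ⟶ ⦋n⦌, (∀ j, vtx α j ≠ i + 1) → X.res α x = X.res α y)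
    (h₂ : X.res (seg 2 n i) x = X.res (seg 2 n i) y) : x = y := by
  apply (hX n (by omega) _ (polygonFan_isTriangulation hi)).1
  apply Subtype.ext
  funext t
  change X.res _ x = X.res _ y
  by_cases h : ∃ a, (t.1 a : ℕ) = i + 1
  · obtain ⟨e₀, e₁, e₂⟩ := polygonFan_triangle hi t h
    have : mkHom t.1.toOrderHom = seg 2 n i := by
      apply hom_ext_vtx
      intro j hj
      rw [vtx_seg _ hi hj, vtx_mkHom _ hj]
      interval_cases j
      · exact e₀
      · exact e₁
      · exact e₂
    rw [this, h₂]
  · exact h₁ _ fun j hj => h ⟨_, hj⟩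

/-- The triangle at an interior vertex can be replaced by one with the same long edge. -/
theorem exists_replace {i : ℕ} (hi : i + 2 ≤ n) (x : X _⦋n⦌) (ξ : X _⦋2⦌)
    (h : X.δ 1 ξ = X.δ 1 (X.res (seg 2 n i) x)) :
    ∃ y : X _⦋n⦌, X.res (seg 2 n i) y = ξ ∧
      ∀ (m : ℕ) (α : ⦋m⦌ ⟶ ⦋n⦌), (∀ j, vtx α j ≠ i + 1) → X.res α y = X.res α x := by
  classical
  have heq (t : TriangulationTriangle (polygonFan n (i + 2))) (ht : ∃ a, (t.1 a : ℕ) = i + 1) :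
      X.δ 1 ξ = X.δ 1 (X.triangleFace t.1 x) := by
    obtain ⟨e₀, e₁, e₂⟩ := polygonFan_triangle hi t ht
    rw [h, triangleFace_eq_res]
    congr 1
    refine X.res_congr x fun j hj => ?_
    rw [vtx_seg _ hi hj, vtx_mkHom _ hj]
    interval_cases j
    · exact e₀.symm
    · exact e₁.symm
    · exact e₂.symm
  -- The two other sides of the ear contain `i + 1`, so only its long side can be shared with a
  -- different triangle.
  have hside (t t' : TriangulationTriangle (polygonFan n (i + 2))) (a a' : Fin 3)
      (e : triangleSide t.1 a = triangleSide t'.1 a') (ht : ∃ a, (t.1 a : ℕ) = i + 1)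
      (ht' : ¬ ∃ a, (t'.1 a : ℕ) = i + 1) : a = 1 := by
    obtain ⟨e₀, e₁, e₂⟩ := polygonFan_triangle hi t ht
    have e := triangleSide_val e
    fin_cases a
    · exact absurd ⟨_, (congrArg Fin.val e.1).symm.trans e₁⟩ ht'
    · rfl
    · exact absurd ⟨_, (congrArg Fin.val e.2).symm.trans e₁⟩ ht'
  -- Glue `ξ` on the ear to the triangles of `x` elsewhere; the hypothesis on long edges is the only
  -- compatibility at stake.
  obtain ⟨y, hy⟩ := (hX n (by omega) _ (polygonFan_isTriangulation hi)).2
    ⟨fun t => if ∃ a, (t.1 a : ℕ) = i + 1 then ξ else X.triangleFace t.1 x, by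
      intro t t' a a' e
      dsimp only
      split_ifs with ht ht' ht'
      · obtain ⟨e₀, e₁, e₂⟩ := polygonFan_triangle hi t ht
        obtain ⟨f₀, f₁, f₂⟩ := polygonFan_triangle hi t' ht'
        have e := triangleSide_val e
        have e' := congrArg Fin.val e.1
        have e'' := congrArg Fin.val e.2
        fin_cases a <;> fin_cases a' <;> first
          | rfl
          | (exfalso; simp [Fin.succAbove, e₀, e₁, e₂, f₀, f₁, f₂] at e' e'')
      · obtain rfl := hside t t' a a' e ht ht'
        rw [heq t ht, X.δ_triangleFace t.1 t'.1 1 a' e]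
      · obtain rfl := hside t' t a' a e.symm ht' ht
        rw [heq t' ht', X.δ_triangleFace t'.1 t.1 1 a e.symm]
      · exact X.δ_triangleFace t.1 t'.1 a a' e x⟩
  have key (t : TriangulationTriangle (polygonFan n (i + 2))) : X.triangleFace t.1 y =
      if ∃ a, (t.1 a : ℕ) = i + 1 then ξ else X.triangleFace t.1 x :=
    congrFun (congrArg Subtype.val hy) t
  have hseg : X.res (seg 2 n i) y = ξ := by
    let t : Fin 3 ↪o Fin (n + 1) := OrderEmbedding.ofStrictMono
      (fun a => ⟨i + a, by omega⟩) fun a b hab => by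
        rw [Fin.mk_lt_mk]
        have : (a : ℕ) < b := hab
        omega
    have ht (a) : (t a : ℕ) = i + a := rfl
    have hT (a : Fin 3) : triangleSide t a ∈ polygonFan n (i + 2) := by
      refine (mem_polygonFan _).2 ?_
      simp only [ht]
      fin_cases a <;> simp [Fin.succAbove]
    refine Eq.trans ?_ ((key ⟨t, hT⟩).trans (if_pos ⟨1, rfl⟩))
    rw [triangleFace_eq_res]
    refine X.res_congr y fun j hj => ?_
    rw [vtx_seg _ hi hj, vtx_mkHom _ hj]
    rfl
  refine ⟨y, hseg, fun l α hα => ?_⟩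
  obtain ⟨m, rfl⟩ : ∃ m, n = m + 1 := ⟨n - 1, by omega⟩
  obtain ⟨β, rfl⟩ := exists_comp_face α (by omega) hα
  rw [← res_res, ← res_res]
  congr 1
  -- It remains to compare the faces opposite to `i + 1`. Cutting off the ear turns the fan at `i +
  -- 2` into the fan at `i + 1` of the smaller polygon, and all its triangles were taken from `x`.
  by_cases hm : 2 ≤ m
  · apply (hX m hm _ (polygonFan_isTriangulation (c := i + 1) (by omega))).1
    apply Subtype.ext
    funext t
    change X.res (mkHom t.1.toOrderHom) _ = X.res (mkHom t.1.toOrderHom) _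
    let t' : Fin 3 ↪o Fin (m + 2) :=
      t.1.trans (Fin.succAboveOrderEmb (⟨i + 1, by omega⟩ : Fin (m + 2)))
    have ht' (a) : (t' a : ℕ) = if (t.1 a : ℕ) < i + 1 then (t.1 a : ℕ) else t.1 a + 1 := by
      change ((Fin.succAbove (⟨i + 1, by omega⟩ : Fin (m + 2)) (t.1 a) : Fin (m + 2)) : ℕ) = _
      simp only [Fin.succAbove, Fin.lt_def, Fin.val_castSucc]
      split_ifs <;> rfl
    have hT (a : Fin 3) : triangleSide t' a ∈ polygonFan (m + 1) (i + 2) := by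
      refine (mem_polygonFan _).2 ?_
      have := (mem_polygonFan _).1 (t.2 a)
      rw [ht', ht']
      split_ifs <;> omega
    have hnot : ¬ ∃ a, (t' a : ℕ) = i + 1 := by
      rintro ⟨a, ha⟩
      rw [ht'] at ha
      split_ifs at ha <;> omega
    have := (key ⟨t', hT⟩).trans (if_neg hnot)
    rw [triangleFace_eq_res, triangleFace_eq_res] at this
    have hc : mkHom t.1.toOrderHom ≫ face m (i + 1) = mkHom t'.toOrderHom := by
      apply hom_ext_vtx
      intro j hj
      rw [vtx_comp, vtx_face _ (vtx_le _ _), vtx_mkHom _ hj, vtx_mkHom _ hj]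
      exact (ht' _).symm
    rw [res_res, res_res, hc, this]
  -- For `n = 2` the ear is the whole polygon, and the claim is the hypothesis on long edges.
  · obtain rfl : m = 1 := by omega
    obtain rfl : i = 0 := by omega
    have hid : seg 2 2 0 = 𝟙 ⦋2⦌ := hom_ext_vtx fun j hj => by
      rw [vtx_seg _ (by omega) hj, vtx_id hj, zero_add]
    rw [hid, res_id] at h hseg
    rw [hseg]
    have h' := h
    rw [δ_eq_res, δ_eq_res] at h'
    exact h'

end SSet.IsTwoSegal

/-! ### Braidings, and the adjacent transpositions that they induce on simplices. -/

namespace SSet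

variable (X : SSet.{u}) {l m n : ℕ}

/-- The elementary form of the data of a commutative structure on the pseudomonoid of `X`. -/
structure IsBraiding (θ : X _⦋2⦌ → X _⦋2⦌) : Prop where
  δ_two : ∀ ξ, X.δ 2 (θ ξ) = X.δ 0 ξ
  δ_zero : ∀ ξ, X.δ 0 (θ ξ) = X.δ 2 ξ
  δ_one : ∀ ξ, X.δ 1 (θ ξ) = X.δ 1 ξ
  invol : ∀ ξ, θ (θ ξ) = ξ
  -- If `ψ` has consecutive edges `x, y, z`, then `φ` has `y, x, z` and `χ` has `y, z, x`. The
  -- conclusion says that `χ` arises from `φ` by exchanging the last two factors.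
  hexagon : ∀ ψ φ χ : X _⦋3⦌, X.δ 3 φ = θ (X.δ 3 ψ) → X.δ 1 φ = X.δ 1 ψ →
    X.δ 3 χ = X.δ 0 ψ → X.δ 1 χ = θ (X.δ 2 ψ) → X.δ 0 χ = θ (X.δ 0 φ) ∧ X.δ 2 χ = X.δ 2 φ

variable {X}

/-- The relation between a simplex and its image under the transposition at the vertex `i + 1`. -/
def IsTransposed (θ : X _⦋2⦌ → X _⦋2⦌) (i : ℕ) (x y : X _⦋n⦌) : Prop :=
  X.res (seg 2 n i) y = θ (X.res (seg 2 n i) x) ∧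
    ∀ (m : ℕ) (α : ⦋m⦌ ⟶ ⦋n⦌), (∀ j, vtx α j ≠ i + 1) → X.res α y = X.res α x

open Classical in
/-- The transposition at the vertex `i + 1` of a simplex. -/
noncomputable def transpose (θ : X _⦋2⦌ → X _⦋2⦌) (i : ℕ) (x : X _⦋n⦌) : X _⦋n⦌ :=
  -- For a braiding on a 2-Segal set and `i + 2 ≤ n` the default is never used, by `isTransposed`.
  if h : ∃ y, IsTransposed θ i x y then h.choose else x

namespace IsBraiding

variable {θ : X _⦋2⦌ → X _⦋2⦌} (hθ : X.IsBraiding θ) (hX : X.IsTwoSegal)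

include hθ hX

/-- Since `θ` preserves the long edge, `exists_replace` applies to the triangle at `i + 1`. -/
theorem isTransposed {i : ℕ} (hi : i + 2 ≤ n) (x : X _⦋n⦌) :
    IsTransposed θ i x (transpose θ i x) := by
  have h : ∃ y, IsTransposed θ i x y := hX.exists_replace hi x _ (hθ.δ_one _)
  rw [transpose, dif_pos h]
  exact h.choose_spec

theorem res_seg_transpose {i : ℕ} (hi : i + 2 ≤ n) (x : X _⦋n⦌) :
    X.res (seg 2 n i) (transpose θ i x) = θ (X.res (seg 2 n i) x) :=
  (hθ.isTransposed hX hi x).1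

theorem res_transpose {i : ℕ} (hi : i + 2 ≤ n) (x : X _⦋n⦌) {α : ⦋m⦌ ⟶ ⦋n⦌}
    (hα : ∀ j, vtx α j ≠ i + 1) : X.res α (transpose θ i x) = X.res α x :=
  (hθ.isTransposed hX hi x).2 m α hα

omit hθ in
-- Every triangle that misses `i + 1` lies in the opposite face. This lets identities of operators
-- be proved by cutting off one ear at a time.
theorem _root_.SSet.IsTwoSegal.ext_of_face {i : ℕ} (hi : i + 1 ≤ n) {x y : X _⦋n + 1⦌}
    (h₁ : X.res (face n (i + 1)) x = X.res (face n (i + 1)) y)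
    (h₂ : X.res (seg 2 (n + 1) i) x = X.res (seg 2 (n + 1) i) y) : x = y := by
  refine hX.ext_of_triangle (i := i) (by omega) (fun α hα => ?_) h₂
  obtain ⟨β, rfl⟩ := exists_comp_face α (by omega) hα
  rw [← res_res, h₁, res_res]

omit hθ hX in
theorem vtx_face_ne {v j : ℕ} : vtx (face n v) j ≠ v := by
  rw [← vtx_min, vtx_face v (min_le_right _ _)]
  split_ifs <;> omega

theorem eq_transpose {i : ℕ} (hi : i + 2 ≤ n) {x y : X _⦋n⦌}
    (h₁ : ∀ α : ⦋2⦌ ⟶ ⦋n⦌, (∀ j, vtx α j ≠ i + 1) → X.res α y = X.res α x)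
    (h₂ : X.res (seg 2 n i) y = θ (X.res (seg 2 n i) x)) : y = transpose θ i x :=
  hX.ext_of_triangle hi (fun α hα => by rw [h₁ α hα, hθ.res_transpose hX hi x hα])
    (by rw [h₂, hθ.res_seg_transpose hX hi])

/-- By monotonicity `i' + 1` is the only vertex over `i + 1`, so triangles that avoid the former map
to triangles that avoid the latter, and the ear maps to the ear. -/
theorem res_transpose_eq {i i' : ℕ} (hi' : i' + 2 ≤ m) (hi : i + 2 ≤ n) {α : ⦋m⦌ ⟶ ⦋n⦌}
    (h₀ : ∀ j ≤ 2, vtx α (i' + j) = i + j) (x : X _⦋n⦌) :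
    X.res α (transpose θ i x) = transpose θ i' (X.res α x) := by
  refine hθ.eq_transpose hX hi' (fun β hβ => ?_) ?_
  · rw [res_res, res_res]
    refine hθ.res_transpose hX hi x fun j => ?_
    rw [vtx_comp]
    have h₁ := h₀ 0 (by omega)
    have h₂ := h₀ 2 (by omega)
    have h₃ := hβ j
    rcases lt_or_gt_of_ne h₃ with h | h
    · have := vtx_mono α (show vtx β j ≤ i' + 0 by omega)
      omega
    · have := vtx_mono α (show i' + 2 ≤ vtx β j by omega)
      omega
  · have : seg 2 m i' ≫ α = seg 2 n i := hom_ext_vtx fun j hj => by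
      rw [vtx_comp, vtx_seg _ hi' hj, h₀ j hj, vtx_seg _ hi hj]
    rw [res_res, res_res, this, hθ.res_seg_transpose hX hi]

theorem transpose_transpose {i : ℕ} (hi : i + 2 ≤ n) (x : X _⦋n⦌) :
    transpose θ i (transpose θ i x) = x := by
  symm
  refine hθ.eq_transpose hX hi (fun α hα => ?_) ?_
  · rw [hθ.res_transpose hX hi x hα]
  · rw [hθ.res_seg_transpose hX hi, hθ.invol]

/-- The face opposite to `i + 1` sees only the transposition at `j`, with its index shifted down by
one, and the ear at `i + 1` sees only the transposition at `i`. -/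
theorem transpose_comm {i j : ℕ} (hij : i + 2 ≤ j) (hj : j + 2 ≤ n) (x : X _⦋n⦌) :
    transpose θ i (transpose θ j x) = transpose θ j (transpose θ i x) := by
  obtain ⟨m, rfl⟩ : ∃ m, n = m + 1 := ⟨n - 1, by omega⟩
  symm
  obtain ⟨j, rfl⟩ : ∃ k, j = k + 1 := ⟨j - 1, by omega⟩
  have hf : ∀ k ≤ 2, vtx (face m (i + 1)) (j + k) = j + 1 + k := fun k hk => by
    rw [vtx_face _ (by omega), if_neg (by omega)]
    omega
  refine hX.ext_of_face (i := i) (by omega) ?_ ?_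
  · rw [hθ.res_transpose hX (by omega) _ fun k => vtx_face_ne,
      hθ.res_transpose_eq hX (i' := j) (by omega) (by omega) hf,
      hθ.res_transpose_eq hX (i' := j) (by omega) (by omega) hf,
      hθ.res_transpose hX (by omega) _ fun k => vtx_face_ne]
  · have hs : ∀ k, vtx (seg 2 (m + 1) i) k ≠ j + 1 + 1 := fun k => by
      rw [← vtx_min, vtx_seg _ (by omega) (by omega)]
      omega
    rw [hθ.res_seg_transpose hX (by omega), hθ.res_transpose hX (by omega) _ hs,
      hθ.res_transpose hX (by omega) _ hs, hθ.res_seg_transpose hX (by omega)]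

omit hX in
theorem res_face_two (ξ : X _⦋2⦌) : X.res (face 1 2) (θ ξ) = X.res (face 1 0) ξ := by
  have := hθ.δ_two ξ
  rwa [δ_eq_res, δ_eq_res] at this

omit hθ hX in
theorem seg_eq_face_three : seg 2 3 0 = face 2 3 := hom_ext_vtx fun j hj => by
  rw [vtx_seg _ (by omega) hj, vtx_face _ hj, if_pos (by omega), zero_add]

omit hθ hX in
theorem seg_eq_face_zero : seg 2 3 1 = face 2 0 := hom_ext_vtx fun j hj => by
  rw [vtx_seg _ (by omega) hj, vtx_face _ hj, if_neg (by omega), add_comm]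

omit hθ hX in
theorem seg_self : seg n n 0 = 𝟙 ⦋n⦌ := hom_ext_vtx fun j hj => by
  rw [vtx_seg _ (by omega) hj, vtx_id hj, zero_add]

theorem transpose_two (ξ : X _⦋2⦌) : transpose θ 0 ξ = θ ξ := by
  have := hθ.res_seg_transpose hX (n := 2) (i := 0) le_rfl ξ
  rwa [seg_self, res_id, res_id] at this

theorem face_three_transpose (ψ : X _⦋3⦌) :
    X.res (face 2 3) (transpose θ 0 ψ) = θ (X.res (face 2 3) ψ) := by
  have := hθ.res_seg_transpose hX (n := 3) (i := 0) (by omega) ψ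
  rwa [seg_eq_face_three] at this

theorem face_zero_transpose (ψ : X _⦋3⦌) :
    X.res (face 2 0) (transpose θ 1 ψ) = θ (X.res (face 2 0) ψ) := by
  have := hθ.res_seg_transpose hX (n := 3) (i := 1) (by omega) ψ
  rwa [seg_eq_face_zero] at this

theorem face_one_transpose (ψ : X _⦋3⦌) :
    X.res (face 2 1) (transpose θ 0 ψ) = X.res (face 2 1) ψ :=
  hθ.res_transpose hX (by omega) _ fun _ => vtx_face_ne

theorem face_two_transpose (ψ : X _⦋3⦌) :
    X.res (face 2 2) (transpose θ 1 ψ) = X.res (face 2 2) ψ :=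
  hθ.res_transpose hX (by omega) _ fun _ => vtx_face_ne

/-- Moving the first of three factors past the other two. -/
theorem face_transpose_transpose (ψ : X _⦋3⦌) :
    X.res (face 2 3) (transpose θ 1 (transpose θ 0 ψ)) = X.res (face 2 0) ψ ∧
      X.res (face 2 1) (transpose θ 1 (transpose θ 0 ψ)) = θ (X.res (face 2 2) ψ) := by
  have h : X.δ 1 (X.δ 0 ψ) = X.δ 2 (θ (X.δ 2 ψ)) := by
    rw [hθ.δ_two]
    exact (X.δ_δ_apply (i := 0) (j := 1) (by decide) ψ).symm
  -- Build the simplex with the two desired faces `d_3` and `d_1`. The hexagon computes its faces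
  -- `d_2` and `d_0`, and these identify it with the doubly transposed simplex.
  obtain ⟨χ, h₁, h₂⟩ := hX.existsA h
  have := hθ.hexagon ψ (transpose θ 0 ψ) χ
    (by simp only [δ_eq_res]; exact hθ.face_three_transpose hX ψ)
    (by simp only [δ_eq_res]; exact hθ.face_one_transpose hX ψ) h₁ h₂
  have hχ : χ = transpose θ 1 (transpose θ 0 ψ) := by
    refine hX.extB ?_ ?_
    · rw [this.2]
      simp only [δ_eq_res]
      exact (hθ.face_two_transpose hX _).symm
    · rw [this.1]
      simp only [δ_eq_res]
      exact (hθ.face_zero_transpose hX _).symm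
  subst hχ
  simp only [δ_eq_res] at h₁ h₂
  exact ⟨h₁, h₂⟩

/-- Moving the last of three factors past the other two. -/
theorem face_transpose_transpose' (ψ : X _⦋3⦌) :
    X.res (face 2 0) (transpose θ 0 (transpose θ 1 ψ)) = X.res (face 2 3) ψ ∧
      X.res (face 2 2) (transpose θ 0 (transpose θ 1 ψ)) = θ (X.res (face 2 1) ψ) := by
  -- The two transpositions are involutions, so this case is the inverse of the preceding one.
  have h := hθ.face_transpose_transpose hX (transpose θ 0 (transpose θ 1 ψ))
  rw [hθ.transpose_transpose hX (by omega), hθ.transpose_transpose hX (by omega)] at h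
  exact ⟨h.1.symm, by rw [h.2, hθ.invol]⟩

/-- By `face_transpose_transpose` both sides have `d_3` equal to `θ (d_0 ψ)` and `d_1` equal to `θ
(d_2 ψ)`, and these two faces determine a 3-simplex. -/
theorem braid_three (ψ : X _⦋3⦌) :
    transpose θ 0 (transpose θ 1 (transpose θ 0 ψ)) =
      transpose θ 1 (transpose θ 0 (transpose θ 1 ψ)) := by
  refine hX.extA ?_ ?_
  · simp only [δ_eq_res]
    exact (hθ.face_three_transpose hX _).trans (((congrArg θ
      (hθ.face_transpose_transpose hX ψ).1).trans (hθ.face_zero_transpose hX ψ).symm).trans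
        (hθ.face_transpose_transpose hX _).1.symm)
  · simp only [δ_eq_res]
    exact (hθ.face_one_transpose hX _).trans (((hθ.face_transpose_transpose hX ψ).2.trans
      (congrArg θ (hθ.face_two_transpose hX ψ).symm)).trans
        (hθ.face_transpose_transpose hX _).2.symm)

/-- Cutting off the ears at `i + 1` and `i + 2` leaves a face that none of the operators changes.
Both ears lie in the 3-simplex on `i, …, i + 3`, where `braid_three` applies. -/
theorem transpose_braid {i : ℕ} (hi : i + 3 ≤ n) (x : X _⦋n⦌) :
    transpose θ i (transpose θ (i + 1) (transpose θ i x)) =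
      transpose θ (i + 1) (transpose θ i (transpose θ (i + 1) x)) := by
  have s₀ (y : X _⦋n⦌) : X.res (seg 3 n i) (transpose θ i y) =
      transpose θ 0 (X.res (seg 3 n i) y) :=
    hθ.res_transpose_eq hX (by omega) (by omega)
      (fun j hj => by rw [vtx_seg _ hi (by omega)]; omega) y
  have s₁ (y : X _⦋n⦌) : X.res (seg 3 n i) (transpose θ (i + 1) y) =
      transpose θ 1 (X.res (seg 3 n i) y) :=
    hθ.res_transpose_eq hX (by omega) (by omega)
      (fun j hj => by rw [vtx_seg _ hi (by omega)]; omega) y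
  have h : X.res (seg 3 n i) (transpose θ i (transpose θ (i + 1) (transpose θ i x))) =
      X.res (seg 3 n i) (transpose θ (i + 1) (transpose θ i (transpose θ (i + 1) x))) := by
    rw [s₀, s₁, s₀, s₁, s₀, s₁, hθ.braid_three hX]
  obtain ⟨m, rfl⟩ : ∃ m, n = m + 2 := ⟨n - 2, by omega⟩
  refine hX.ext_of_face (n := m + 1) (i := i) (by omega) ?_ ?_
  · refine hX.ext_of_face (n := m) (i := i) (by omega) ?_ ?_
    · rw [res_res, res_res]
      have hne : ∀ j, vtx (face m (i + 1) ≫ face (m + 1) (i + 1)) j ≠ i + 1 ∧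
          vtx (face m (i + 1) ≫ face (m + 1) (i + 1)) j ≠ i + 1 + 1 := fun j => by
        rw [vtx_comp, ← vtx_min (face m (i + 1)), vtx_face _ (min_le_right _ _)]
        rw [vtx_face _ (by split_ifs <;> omega)]
        split_ifs <;> omega
      rw [hθ.res_transpose hX (by omega) _ fun j => (hne j).1,
        hθ.res_transpose hX (by omega) _ fun j => (hne j).2,
        hθ.res_transpose hX (by omega) _ fun j => (hne j).1,
        hθ.res_transpose hX (by omega) _ fun j => (hne j).2,
        hθ.res_transpose hX (by omega) _ fun j => (hne j).1,
        hθ.res_transpose hX (by omega) _ fun j => (hne j).2]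
    · have e : seg 2 (m + 1) i ≫ face (m + 1) (i + 1) = face 2 1 ≫ seg 3 (m + 2) i :=
        hom_ext_vtx fun j hj => by
          rw [vtx_comp, vtx_comp, vtx_seg _ (by omega) hj, vtx_face _ (by omega),
            vtx_face _ hj, vtx_seg _ hi (by split_ifs <;> omega)]
          split_ifs <;> omega
      rw [res_res, res_res, e, ← res_res, h, res_res]
  · have e : seg 2 (m + 2) i = face 2 3 ≫ seg 3 (m + 2) i := hom_ext_vtx fun j hj => by
      rw [vtx_comp, vtx_seg _ (by omega) hj, vtx_face _ hj,
        vtx_seg _ hi (by split_ifs <;> omega)]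
      split_ifs <;> omega
    rw [e, ← res_res, h, res_res]

/-- Moving the first factor past two others and then multiplying these is the same as moving it past
their product; on the first triangle this is the hexagon in the form `face_transpose_transpose`. -/
theorem face_one_transpose_transpose (hn : 2 ≤ n) (x : X _⦋n + 1⦌) :
    X.res (face n 1) (transpose θ 1 (transpose θ 0 x)) =
      transpose θ 0 (X.res (face n 2) x) := by
  refine hθ.eq_transpose hX hn (fun β hβ => ?_) ?_
  · rw [res_res, res_res]
    have hne : ∀ j, vtx (β ≫ face n 1) j ≠ 0 + 1 ∧ vtx (β ≫ face n 1) j ≠ 1 + 1 := fun j => by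
      have := hβ j
      rw [vtx_comp, vtx_face _ (vtx_le _ _)]
      split_ifs <;> omega
    rw [hθ.res_transpose hX (by omega) _ fun j => (hne j).2,
      hθ.res_transpose hX (by omega) _ fun j => (hne j).1]
    refine X.res_congr x fun j _ => ?_
    have := hβ j
    rw [vtx_comp, vtx_comp, vtx_face _ (vtx_le _ _), vtx_face _ (vtx_le _ _)]
    split_ifs <;> omega
  · have e (v : ℕ) (hv : 1 ≤ v) (hv' : v ≤ 2) :
        seg 2 n 0 ≫ face n v = face 2 v ≫ seg 3 (n + 1) 0 := hom_ext_vtx fun j hj => by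
      rw [vtx_comp, vtx_comp, vtx_seg _ (by omega) hj, vtx_face _ (by omega),
        vtx_face _ hj, vtx_seg _ (by omega) (by split_ifs <;> omega)]
      split_ifs <;> omega
    rw [res_res, res_res, e 1 (by omega) (by omega), e 2 (by omega) (by omega), ← res_res,
      ← res_res, hθ.res_transpose_eq hX (i' := 1) (α := seg 3 (n + 1) 0) (by omega)
        (by omega) fun j hj => by
        rw [vtx_seg _ (by omega) (by omega)]; omega,
      hθ.res_transpose_eq hX (i' := 0) (α := seg 3 (n + 1) 0) (by omega)
        (by omega) fun j hj => by
        rw [vtx_seg _ (by omega) (by omega)]; omega]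
    exact (hθ.face_transpose_transpose hX _).2

end IsBraiding

/-! ### Rotation of the first factor to the end. -/

/-- The operator which moves the first factor past the next `k` factors. -/
noncomputable def rotate (θ : X _⦋2⦌ → X _⦋2⦌) (k : ℕ) (x : X _⦋n⦌) : X _⦋n⦌ :=
  match k with
  | 0 => x
  | k + 1 => transpose θ k (rotate θ k x)

namespace IsBraiding

variable {θ : X _⦋2⦌ → X _⦋2⦌} (hθ : X.IsBraiding θ) (hX : X.IsTwoSegal)

include hθ hX

theorem face_one_rotate (k : ℕ) (hk : k + 2 ≤ n) (x : X _⦋n + 1⦌) :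
    X.res (face n 1) (rotate θ (k + 2) x) = rotate θ (k + 1) (X.res (face n 2) x) := by
  induction k with
  | zero => exact hθ.face_one_transpose_transpose hX hk x
  | succ k ih =>
    rw [rotate, hθ.res_transpose_eq hX (i' := k + 1) (by omega) (by omega) fun j hj => by
      rw [vtx_face _ (by omega), if_neg (by omega)]; omega, ih (by omega), ← rotate]

/-- The first two transpositions bring the second and third factors to the front; the later ones act
at vertices beyond the first triangle. -/
theorem seg_rotate (k : ℕ) (hk : k + 2 ≤ n) (x : X _⦋n + 1⦌) :
    X.res (seg 2 (n + 1) 0) (rotate θ (k + 2) x) = X.res (seg 2 (n + 1) 1) x := by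
  induction k with
  | zero =>
    have e : seg 2 (n + 1) 0 = face 2 3 ≫ seg 3 (n + 1) 0 := hom_ext_vtx fun j hj => by
      rw [vtx_comp, vtx_seg _ (by omega) hj, vtx_face _ hj,
        vtx_seg _ (by omega) (by split_ifs <;> omega)]
      split_ifs <;> omega
    have e' : seg 2 (n + 1) 1 = face 2 0 ≫ seg 3 (n + 1) 0 := hom_ext_vtx fun j hj => by
      rw [vtx_comp, vtx_seg _ (by omega) hj, vtx_face _ hj,
        vtx_seg _ (by omega) (by split_ifs <;> omega)]
      split_ifs <;> omega
    rw [e, e', ← res_res, ← res_res, rotate, rotate, rotate,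
      hθ.res_transpose_eq hX (i' := 1) (α := seg 3 (n + 1) 0) (by omega)
        (by omega) fun j hj => by
        rw [vtx_seg _ (by omega) (by omega)]; omega,
      hθ.res_transpose_eq hX (i' := 0) (α := seg 3 (n + 1) 0) (by omega)
        (by omega) fun j hj => by
        rw [vtx_seg _ (by omega) (by omega)]; omega]
    exact (hθ.face_transpose_transpose hX _).1
  | succ k ih =>
    rw [rotate, hθ.res_transpose hX (by omega) _ fun j => by
      rw [← vtx_min, vtx_seg _ (by omega) (min_le_right _ _)]; omega, ih (by omega)]

/-- Commutativity forces every edge to be a loop: the face `d_0` of `θ (s_0 x)` is `s_0 (d_1 x)`, so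
unitality gives `θ (s_0 x) = s_1 x`, whose face `d_0` is `s_0 (d_0 x)`. -/
theorem face_zero_eq_face_one (x : X _⦋1⦌) : X.res (face 0 0) x = X.res (face 0 1) x := by
  have h₁ : X.δ 2 (X.σ 0 x) = X.σ 0 (X.δ 1 x) := X.δ_σ_gt_apply (i := 1) (j := 0) (by decide) x
  have h₂ : X.σ 0 (X.δ 1 x) = X.δ 0 (θ (X.σ 0 x)) := by rw [hθ.δ_zero, h₁]
  have h₃ := hX.unital_right h₂
  rw [hθ.δ_one, show X.δ 1 (X.σ 0 x) = x from X.δ_σ_succ_apply 0 x] at h₃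
  have h₄ : X.δ 0 (X.σ 1 x) = X.σ 0 (X.δ 0 x) :=
    X.δ_σ_le_apply (i := 0) (j := 0) (by decide) x
  rw [h₃, ← h₂] at h₄
  have h₅ := congrArg (X.δ 0) h₄
  have h (v : X _⦋0⦌) : X.δ 0 (X.σ 0 v) = v := X.δ_σ_self_apply 0 v
  rw [h, h] at h₅
  rw [δ_eq_res, δ_eq_res] at h₅
  exact h₅.symm

theorem braiding_degenerate (x : X _⦋1⦌) : θ (X.σ 0 x) = X.σ 1 x := by
  have h₁ : X.δ 2 (X.σ 0 x) = X.σ 0 (X.δ 1 x) := X.δ_σ_gt_apply (i := 1) (j := 0) (by decide) x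
  have h₂ : X.σ 0 (X.δ 1 x) = X.δ 0 (θ (X.σ 0 x)) := by rw [hθ.δ_zero, h₁]
  have h₃ := hX.unital_right h₂
  rw [hθ.δ_one, show X.δ 1 (X.σ 0 x) = x from X.δ_σ_succ_apply 0 x] at h₃
  exact h₃.symm

/-- Dropping the last factor after the rotation is dropping the first factor before it. The
induction compares the faces opposite to the vertex 1 (`face_one_rotate`) and the first triangles
(`seg_rotate`); it starts from loops for `m = 0` and from `d_2 θ = d_0` for `m = 1`. -/
theorem face_rotate (m : ℕ) (x : X _⦋m + 1⦌) :
    X.res (face m (m + 1)) (rotate θ m x) = X.res (face m 0) x := by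
  induction m with
  | zero => exact (hθ.face_zero_eq_face_one hX x).symm
  | succ m ih =>
    rcases m with - | m
    · change X.res _ (transpose θ 0 x) = _
      rw [hθ.transpose_two hX]
      exact hθ.res_face_two x
    · refine hX.ext_of_face (i := 0) (by omega) ?_ ?_
      · have e : face (m + 1) (0 + 1) ≫ face (m + 2) (m + 2 + 1) =
            face (m + 1) (m + 2) ≫ face (m + 2) 1 := hom_ext_vtx fun j hj => by
          rw [vtx_comp, vtx_comp, vtx_face _ hj, vtx_face _ hj,
            vtx_face _ (by split_ifs <;> omega), vtx_face _ (by split_ifs <;> omega)]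
          split_ifs <;> omega
        have e' : face (m + 1) (0 + 1) ≫ face (m + 2) 0 =
            face (m + 1) 0 ≫ face (m + 2) 2 := hom_ext_vtx fun j hj => by
          rw [vtx_comp, vtx_comp, vtx_face _ hj, vtx_face _ hj,
            vtx_face _ (by split_ifs <;> omega), vtx_face _ (by split_ifs <;> omega)]
          split_ifs <;> omega
        rw [res_res, res_res, e, e', ← res_res, ← res_res,
          hθ.face_one_rotate hX m (by omega), ih]
      · have e : seg 2 (m + 1 + 1) 0 ≫ face (m + 2) (m + 2 + 1) = seg 2 (m + 3) 0 :=
          hom_ext_vtx fun j hj => by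
            rw [vtx_comp, vtx_seg _ (by omega) hj, vtx_seg _ (by omega) hj,
              vtx_face _ (by omega), if_pos (by omega)]
        have e' : seg 2 (m + 1 + 1) 0 ≫ face (m + 2) 0 = seg 2 (m + 3) 1 :=
          hom_ext_vtx fun j hj => by
            rw [vtx_comp, vtx_seg _ (by omega) hj, vtx_seg _ (by omega) hj,
              vtx_face _ (by omega), if_neg (by omega)]
            omega
        rw [res_res, res_res, e, e', hθ.seg_rotate hX m (by omega)]

end IsBraiding

end SSet

/-! ### Sorting by adjacent transpositions, and its independence of choices. -/

/-- The sequence `g` with the entries at `i + 1` and `i + 2` exchanged. -/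
def swapAt {K : Type*} (i : ℕ) (g : ℕ → K) (p : ℕ) : K :=
  if p = i + 1 then g (i + 2) else if p = i + 2 then g (i + 1) else g p

section swapAt

variable {K : Type*} (g : ℕ → K) (i j p : ℕ)

@[simp] theorem swapAt_left : swapAt i g (i + 1) = g (i + 2) := by simp [swapAt]

@[simp] theorem swapAt_right : swapAt i g (i + 2) = g (i + 1) := by simp [swapAt]

variable {i j p}

theorem swapAt_of_ne (h₁ : p ≠ i + 1) (h₂ : p ≠ i + 2) : swapAt i g p = g p := by
  simp [swapAt, h₁, h₂]

theorem swapAt_swapAt : swapAt i (swapAt i g) = g := by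
  funext p
  simp only [swapAt]
  split_ifs <;> first | rfl | (congr 1; omega)

theorem swapAt_comm (h : i + 2 ≤ j) : swapAt i (swapAt j g) = swapAt j (swapAt i g) := by
  funext p
  simp only [swapAt]
  split_ifs <;> first | rfl | (congr 1; omega)

theorem swapAt_braid : swapAt i (swapAt (i + 1) (swapAt i g)) =
    swapAt (i + 1) (swapAt i (swapAt (i + 1) g)) := by
  funext p
  simp only [swapAt]
  split_ifs <;> first | rfl | (congr 1; omega) | omega

theorem swapAt_of_eq (h : g (i + 1) = g (i + 2)) : swapAt i g = g := by
  funext p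
  simp only [swapAt]
  split_ifs with h₁ h₂
  · rw [h₁, h]
  · rw [h₂, h]
  · rfl

end swapAt

/-- A quantity which decreases when a sequence of `n` numbers is sorted. -/
def sortWeight (n : ℕ) (g : ℕ → ℕ) : ℕ := ∑ p ∈ Finset.range (n + 1), (n - p) * g p

/-- The weights of the two positions differ by one, so the exchange lowers the sum by `g (i + 1) - g
(i + 2)`. -/
theorem sortWeight_swapAt_lt {n i : ℕ} {g : ℕ → ℕ} (hi : i + 2 ≤ n) (h : g (i + 2) < g (i + 1)) :
    sortWeight n (swapAt i g) < sortWeight n g := by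
  have key : ∑ p ∈ Finset.range (n + 1), (((n - p : ℕ) : ℤ) * g p -
      ((n - p : ℕ) : ℤ) * swapAt i g p) = (((n - (i + 1) : ℕ) : ℤ) * g (i + 1) -
      ((n - (i + 1) : ℕ) : ℤ) * g (i + 2)) + (((n - (i + 2) : ℕ) : ℤ) * g (i + 2) -
      ((n - (i + 2) : ℕ) : ℤ) * g (i + 1)) := by
    rw [Finset.sum_eq_add (i + 1) (i + 2) (by omega)]
    · simp
    · rintro p - ⟨h₁, h₂⟩
      rw [swapAt_of_ne g h₁ h₂, sub_self]
    · intro hp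
      simp at hp
      omega
    · intro hp
      simp at hp
      omega
  rw [Finset.sum_sub_distrib] at key
  have e : ((n - (i + 1) : ℕ) : ℤ) = ((n - (i + 2) : ℕ) : ℤ) + 1 := by omega
  rw [e] at key
  have h' : (g (i + 2) : ℤ) < g (i + 1) := by exact_mod_cast h
  have : ((sortWeight n (swapAt i g) : ℕ) : ℤ) < (sortWeight n g : ℕ) := by
    simp only [sortWeight, Nat.cast_sum, Nat.cast_mul]
    linarith
  exact_mod_cast this

/-- Weak monotonicity of the entries `1, …, n` of a sequence. -/
def IsSorted (n : ℕ) (g : ℕ → ℕ) : Prop := ∀ i, i + 2 ≤ n → g (i + 1) ≤ g (i + 2)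

theorem IsSorted.le {n : ℕ} {g : ℕ → ℕ} (h : IsSorted n g) {p q : ℕ} (hp : 1 ≤ p) (hpq : p ≤ q)
    (hq : q ≤ n) : g p ≤ g q := by
  induction q, hpq using Nat.le_induction with
  | base => rfl
  | succ q hpq ih =>
    obtain ⟨r, rfl⟩ : ∃ r, q = r + 1 := ⟨q - 1, by omega⟩
    exact (ih (by omega)).trans (h r (by omega))

section sortEval

variable {A B : Type*} (n : ℕ) (t : ℕ → A → A) (G : (ℕ → ℕ) → A → B)

open Classical in
/-- The extension of `G` from sorted sequences to all sequences by sorting them with adjacent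
transpositions, which act by `t` on the second argument. -/
noncomputable def sortEval (g : ℕ → ℕ) (a : A) : B :=
  if h : ∃ i, i + 2 ≤ n ∧ g (i + 2) < g (i + 1) then
    sortEval (swapAt h.choose g) (t h.choose a)
  else G g a
termination_by sortWeight n g
decreasing_by exact sortWeight_swapAt_lt h.choose_spec.1 h.choose_spec.2

theorem sortEval_of_sorted {g : ℕ → ℕ} (hg : IsSorted n g) (a : A) :
    sortEval n t G g a = G g a := by
  rw [sortEval, dif_neg]
  rintro ⟨i, hi, h⟩
  exact absurd (hg i hi) (by omega)

theorem exists_sortEval_eq {g : ℕ → ℕ} (hg : ¬ IsSorted n g) :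
    ∃ i, i + 2 ≤ n ∧ g (i + 2) < g (i + 1) ∧
      ∀ a, sortEval n t G g a = sortEval n t G (swapAt i g) (t i a) := by
  have h : ∃ i, i + 2 ≤ n ∧ g (i + 2) < g (i + 1) := by
    unfold IsSorted at hg
    push Not at hg
    exact hg
  refine ⟨h.choose, h.choose_spec.1, h.choose_spec.2, fun a => ?_⟩
  rw [sortEval, dif_pos h]

variable {n t G}

/-- A confluence argument by induction on `sortWeight`. The recursion resolves some descent `j`,
which has to be compared with the given `i`: distant positions are reconciled by `comm`,
neighbouring ones by `braid`, and every intermediate sequence has smaller weight. -/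
theorem sortEval_swapAt_aux
    (comm : ∀ i j a, i + 2 ≤ j → j + 2 ≤ n → t i (t j a) = t j (t i a))
    (braid : ∀ i a, i + 3 ≤ n → t i (t (i + 1) (t i a)) = t (i + 1) (t i (t (i + 1) a)))
    (hG : ∀ g i a, IsSorted n g → i + 2 ≤ n → g (i + 1) = g (i + 2) → G g (t i a) = G g a)
    (N : ℕ) (g : ℕ → ℕ) (hN : sortWeight n g < N) (i : ℕ) (hi : i + 2 ≤ n)
    (h : g (i + 2) ≤ g (i + 1)) (a : A) :
    sortEval n t G (swapAt i g) (t i a) = sortEval n t G g a := by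
  induction N generalizing g i a with
  | zero => omega
  | succ N ih =>
    have ih' (j k : ℕ) (hj : j + 2 ≤ n) (hd : g (j + 2) < g (j + 1)) (hk : k + 2 ≤ n)
        (hd' : swapAt j g (k + 2) ≤ swapAt j g (k + 1)) (b : A) :=
      ih (swapAt j g) (by have := sortWeight_swapAt_lt hj hd; omega) k hk hd' b
    have ih'' (j k l : ℕ) (hj : j + 2 ≤ n) (hd : g (j + 2) < g (j + 1)) (hk : k + 2 ≤ n)
        (hd' : swapAt j g (k + 2) < swapAt j g (k + 1)) (hl : l + 2 ≤ n)
        (hd'' : swapAt k (swapAt j g) (l + 2) ≤ swapAt k (swapAt j g) (l + 1)) (b : A) :=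
      ih (swapAt k (swapAt j g)) (by
        have := sortWeight_swapAt_lt hj hd
        have := sortWeight_swapAt_lt hk hd'
        omega) l hl hd'' b
    by_cases hs : IsSorted n g
    -- If `g` is sorted, the two entries agree and the claim is the invariance `hG` of the
    -- evaluation.
    · have e := le_antisymm (hs i hi) h
      rw [swapAt_of_eq g e, sortEval_of_sorted n t G hs, sortEval_of_sorted n t G hs,
        hG g i a hs hi e]
    obtain ⟨j, hj, hd, hF⟩ := exists_sortEval_eq n t G hs
    rw [hF]
    rcases h.eq_or_lt with e | hlt
    -- For equal entries the sequence does not change, so the claim is that `t i` may be dropped.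
    · rw [swapAt_of_eq g e.symm, hF]
      rcases lt_trichotomy j i with hij | rfl | hij
      · by_cases hij' : j + 2 ≤ i
        · rw [comm j i a hij' hi, ← ih' j i hj hd hi (by
            rw [swapAt_of_ne g (by omega) (by omega), swapAt_of_ne g (by omega) (by omega), e])
            (t j a), swapAt_of_eq (swapAt j g) (by
            rw [swapAt_of_ne g (by omega) (by omega), swapAt_of_ne g (by omega) (by omega), e])]
        -- The exchanges at `j` and `j + 1` carry the equal pair to the positions `j + 1` and `j +
        -- 2`. The braid relation turns the `t (j + 1)` to be dropped into an outermost `t j`, which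
        -- the induction absorbs at the new positions.
        · obtain rfl : i = j + 1 := by omega
          have v₁ : swapAt j g (j + 1 + 1) = g (j + 1) := swapAt_right g j
          have v₂ : swapAt j g (j + 1 + 2) = g (j + 3) :=
            swapAt_of_ne g (by omega) (by omega)
          have v₃ : swapAt j g (j + 1) = g (j + 2) := swapAt_left g j
          have e : g (j + 3) = g (j + 2) := e
          have w₁ : swapAt (j + 1) (swapAt j g) (j + 1) = g (j + 2) := by
            rw [swapAt_of_ne _ (by omega) (by omega), v₃]
          have w₂ : swapAt (j + 1) (swapAt j g) (j + 2) = g (j + 3) := by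
            rw [show j + 2 = j + 1 + 1 from rfl, swapAt_left, v₂]
          rw [← ih' j (j + 1) hj hd hi (by rw [v₁, v₂]; omega) (t j (t (j + 1) a)),
            ← braid j a (by omega),
            ← ih' j (j + 1) hj hd hi (by rw [v₁, v₂]; omega) (t j a)]
          conv_lhs => rw [← swapAt_of_eq (swapAt (j + 1) (swapAt j g)) (i := j) (by rw [w₁, w₂, e])]
          rw [ih'' j (j + 1) j hj hd hi (by rw [v₁, v₂]; omega) hj (by rw [w₁, w₂]; omega)]
      · omega
      · by_cases hij' : i + 2 ≤ j
        · rw [← comm i j a hij' hj, ← ih' j i hj hd hi (by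
            rw [swapAt_of_ne g (by omega) (by omega), swapAt_of_ne g (by omega) (by omega), e])
            (t j a), swapAt_of_eq (swapAt j g) (by
            rw [swapAt_of_ne g (by omega) (by omega), swapAt_of_ne g (by omega) (by omega), e])]
        · obtain rfl : j = i + 1 := by omega
          have v₁ : swapAt (i + 1) g (i + 1) = g (i + 1) := swapAt_of_ne g (by omega) (by omega)
          have v₂ : swapAt (i + 1) g (i + 2) = g (i + 3) := swapAt_left g (i + 1)
          have v₃ : swapAt (i + 1) g (i + 1 + 2) = g (i + 2) := swapAt_right g (i + 1)
          have hd : g (i + 3) < g (i + 2) := hd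
          have w₁ : swapAt i (swapAt (i + 1) g) (i + 1 + 1) = g (i + 1) := by
            rw [show i + 1 + 1 = i + 2 from rfl, swapAt_right, v₁]
          have w₂ : swapAt i (swapAt (i + 1) g) (i + 1 + 2) = g (i + 2) := by
            rw [swapAt_of_ne _ (by omega) (by omega), v₃]
          rw [← ih' (i + 1) i hj hd hi (by rw [v₁, v₂]; omega) (t (i + 1) (t i a)),
            braid i a (by omega),
            ← ih' (i + 1) i hj hd hi (by rw [v₁, v₂]; omega) (t (i + 1) a)]
          conv_lhs => rw [← swapAt_of_eq (swapAt i (swapAt (i + 1) g)) (i := i + 1)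
            (by rw [w₁, w₂, e])]
          rw [ih'' (i + 1) i (i + 1) hj hd hi (by rw [v₁, v₂]; omega) hj (by rw [w₁, w₂]; omega)]
    -- Now `i` and `j` are both strict descents. After either one is resolved, induction allows
    -- further exchanges, until the two routes meet in the same sequence.
    · rcases lt_trichotomy j i with hij | rfl | hij
      · by_cases hij' : j + 2 ≤ i
        · rw [← ih' i j hi hlt hj (by
            rw [swapAt_of_ne g (by omega) (by omega), swapAt_of_ne g (by omega) (by omega)]; omega),
            ← ih' j i hj hd hi (by
            rw [swapAt_of_ne g (by omega) (by omega), swapAt_of_ne g (by omega) (by omega)]; omega),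
            comm j i a hij' hi, swapAt_comm g hij']
        · obtain rfl : i = j + 1 := by omega
          have hlt : g (j + 3) < g (j + 2) := hlt
          have v₁ : swapAt (j + 1) g (j + 1) = g (j + 1) := swapAt_of_ne g (by omega) (by omega)
          have v₂ : swapAt (j + 1) g (j + 2) = g (j + 3) := swapAt_left g (j + 1)
          have v₃ : swapAt (j + 1) g (j + 1 + 2) = g (j + 2) := swapAt_right g (j + 1)
          have w₁ : swapAt j (swapAt (j + 1) g) (j + 1 + 1) = g (j + 1) := by
            rw [show j + 1 + 1 = j + 2 from rfl, swapAt_right, v₁]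
          have w₂ : swapAt j (swapAt (j + 1) g) (j + 1 + 2) = g (j + 2) := by
            rw [swapAt_of_ne _ (by omega) (by omega), v₃]
          have x₁ : swapAt j g (j + 1 + 1) = g (j + 1) := swapAt_right g j
          have x₂ : swapAt j g (j + 1 + 2) = g (j + 3) :=
            swapAt_of_ne g (by omega) (by omega)
          have x₃ : swapAt j g (j + 1) = g (j + 2) := swapAt_left g j
          have y₁ : swapAt (j + 1) (swapAt j g) (j + 1) = g (j + 2) := by
            rw [swapAt_of_ne _ (by omega) (by omega), x₃]
          have y₂ : swapAt (j + 1) (swapAt j g) (j + 2) = g (j + 3) := by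
            rw [show j + 2 = j + 1 + 1 from rfl, swapAt_left, x₂]
          rw [← ih' (j + 1) j hi hlt hj (by rw [v₁, v₂]; omega),
            ← ih'' (j + 1) j (j + 1) hi hlt hj (by rw [v₁, v₂]; omega) hi (by rw [w₁, w₂]; omega),
            ← ih' j (j + 1) hj hd hi (by rw [x₁, x₂]; omega),
            ← ih'' j (j + 1) j hj hd hi (by rw [x₁, x₂]; omega) hj (by rw [y₁, y₂]; omega),
            braid j a (by omega), swapAt_braid]
      · rfl
      · by_cases hij' : i + 2 ≤ j
        · rw [← ih' i j hi hlt hj (by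
            rw [swapAt_of_ne g (by omega) (by omega), swapAt_of_ne g (by omega) (by omega)]; omega),
            ← ih' j i hj hd hi (by
            rw [swapAt_of_ne g (by omega) (by omega), swapAt_of_ne g (by omega) (by omega)]; omega),
            comm i j a hij' hj, swapAt_comm g hij']
        · obtain rfl : j = i + 1 := by omega
          have hd : g (i + 3) < g (i + 2) := hd
          have v₁ : swapAt (i + 1) g (i + 1) = g (i + 1) := swapAt_of_ne g (by omega) (by omega)
          have v₂ : swapAt (i + 1) g (i + 2) = g (i + 3) := swapAt_left g (i + 1)
          have v₃ : swapAt (i + 1) g (i + 1 + 2) = g (i + 2) := swapAt_right g (i + 1)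
          have w₁ : swapAt i (swapAt (i + 1) g) (i + 1 + 1) = g (i + 1) := by
            rw [show i + 1 + 1 = i + 2 from rfl, swapAt_right, v₁]
          have w₂ : swapAt i (swapAt (i + 1) g) (i + 1 + 2) = g (i + 2) := by
            rw [swapAt_of_ne _ (by omega) (by omega), v₃]
          have x₁ : swapAt i g (i + 1 + 1) = g (i + 1) := swapAt_right g i
          have x₂ : swapAt i g (i + 1 + 2) = g (i + 3) :=
            swapAt_of_ne g (by omega) (by omega)
          have x₃ : swapAt i g (i + 1) = g (i + 2) := swapAt_left g i
          have y₁ : swapAt (i + 1) (swapAt i g) (i + 1) = g (i + 2) := by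
            rw [swapAt_of_ne _ (by omega) (by omega), x₃]
          have y₂ : swapAt (i + 1) (swapAt i g) (i + 2) = g (i + 3) := by
            rw [show i + 2 = i + 1 + 1 from rfl, swapAt_left, x₂]
          rw [← ih' (i + 1) i hj hd hi (by rw [v₁, v₂]; omega),
            ← ih'' (i + 1) i (i + 1) hj hd hi (by rw [v₁, v₂]; omega) hj (by rw [w₁, w₂]; omega),
            ← ih' i (i + 1) hi hlt hj (by rw [x₁, x₂]; omega),
            ← ih'' i (i + 1) i hi hlt hj (by rw [x₁, x₂]; omega) hi (by rw [y₁, y₂]; omega),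
            braid i a (by omega), swapAt_braid]

/-- Sorting is compatible with all adjacent transpositions. -/
theorem sortEval_swapAt
    (inv : ∀ i a, i + 2 ≤ n → t i (t i a) = a)
    (comm : ∀ i j a, i + 2 ≤ j → j + 2 ≤ n → t i (t j a) = t j (t i a))
    (braid : ∀ i a, i + 3 ≤ n → t i (t (i + 1) (t i a)) = t (i + 1) (t i (t (i + 1) a)))
    (hG : ∀ g i a, IsSorted n g → i + 2 ≤ n → g (i + 1) = g (i + 2) → G g (t i a) = G g a)
    (g : ℕ → ℕ) (i : ℕ) (hi : i + 2 ≤ n) (a : A) :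
    sortEval n t G (swapAt i g) (t i a) = sortEval n t G g a := by
  rcases le_total (g (i + 2)) (g (i + 1)) with h | h
  · exact sortEval_swapAt_aux comm braid hG _ g (Nat.lt_succ_self _) i hi h a
  -- At an ascent, exchange first to obtain a descent and undo `t i` by `inv`.
  · have := sortEval_swapAt_aux comm braid hG _ (swapAt i g) (Nat.lt_succ_self _) i hi
      (by simpa using h) (t i a)
    rw [swapAt_swapAt, inv i a hi] at this
    exact this.symm

end sortEval

/-! ### Pointed maps: coordinates, sorting keys and the image of `Cut`. -/

namespace FinPointedCard

variable {n k l : ℕ}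

/-- The value of a pointed map at a natural number, extended by zero. -/
def val (f : (⟨n⟩ : FinPointedCard) ⟶ ⟨k⟩) (p : ℕ) : ℕ :=
  if h : p < n + 1 then (Hom.toFun f ⟨p, h⟩ : Fin (k + 1)) else 0

/-- The pointed map given by a function on natural numbers, truncated to the codomain. -/
def ofVal (n k : ℕ) (g : ℕ → ℕ) (h : g 0 = 0) : (⟨n⟩ : FinPointedCard) ⟶ ⟨k⟩ :=
  (⟨fun p => ⟨min (g p) k, Nat.lt_succ_of_le (min_le_right _ _)⟩, Fin.ext (by simp [h])⟩ :
    Hom ⟨n⟩ ⟨k⟩)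

theorem val_of_lt (f : (⟨n⟩ : FinPointedCard) ⟶ ⟨k⟩) {p : ℕ} (h : p < n + 1) :
    val f p = (Hom.toFun f ⟨p, h⟩ : Fin (k + 1)) := dif_pos h

theorem val_of_gt (f : (⟨n⟩ : FinPointedCard) ⟶ ⟨k⟩) {p : ℕ} (h : n < p) : val f p = 0 :=
  dif_neg (by omega)

theorem val_zero (f : (⟨n⟩ : FinPointedCard) ⟶ ⟨k⟩) : val f 0 = 0 := by
  rw [val_of_lt f (Nat.succ_pos n)]
  exact congrArg Fin.val (Hom.map_zero f)

theorem val_le (f : (⟨n⟩ : FinPointedCard) ⟶ ⟨k⟩) (p : ℕ) : val f p ≤ k := by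
  rcases lt_or_ge p (n + 1) with h | h
  · rw [val_of_lt f h]
    exact Nat.le_of_lt_succ (Fin.is_lt _)
  · rw [val_of_gt f h]
    exact Nat.zero_le k

theorem val_comp (f : (⟨n⟩ : FinPointedCard) ⟶ ⟨k⟩) (g : (⟨k⟩ : FinPointedCard) ⟶ ⟨l⟩) (p : ℕ) :
    val (f ≫ g) p = val g (val f p) := by
  rcases lt_or_ge p (n + 1) with h | h
  · rw [val_of_lt g (Nat.lt_succ_of_le (val_le f p)), val_of_lt _ h]
    simp only [val_of_lt f h]
    rfl
  · rw [val_of_gt f h, val_of_gt _ h, val_zero]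

theorem val_id {p : ℕ} (h : p ≤ n) : val (𝟙 (⟨n⟩ : FinPointedCard)) p = p :=
  val_of_lt _ (Nat.lt_succ_of_le h)

theorem val_ofVal (g : ℕ → ℕ) (h : g 0 = 0) {p : ℕ} (hp : p ≤ n) (hg : g p ≤ k) :
    val (ofVal n k g h) p = g p := by
  rw [val_of_lt _ (Nat.lt_succ_of_le hp)]
  exact min_eq_left hg

theorem hom_ext_val {f g : (⟨n⟩ : FinPointedCard) ⟶ ⟨k⟩}
    (h : ∀ p, 1 ≤ p → p ≤ n → val f p = val g p) : f = g := by
  apply Hom.ext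
  funext p
  apply Fin.ext
  rcases Nat.eq_zero_or_pos p with h₀ | h₀
  · obtain rfl : p = 0 := Fin.ext h₀
    exact congrArg Fin.val ((Hom.map_zero f).trans (Hom.map_zero g).symm)
  · have := h p h₀ (Nat.le_of_lt_succ p.2)
    rwa [val_of_lt f p.2, val_of_lt g p.2] at this

/-- The pointed map which corresponds to a monotone map under the functor `Cut`. -/
def cutHom (α : ⦋k⦌ ⟶ ⦋n⦌) : (⟨n⟩ : FinPointedCard) ⟶ ⟨k⟩ := cut.map α.op

theorem cutHom_comp (α : ⦋l⦌ ⟶ ⦋k⦌) (β : ⦋k⦌ ⟶ ⦋n⦌) :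
    cutHom (α ≫ β) = cutHom β ≫ cutHom α := cut.map_comp β.op α.op

theorem cutHom_id : cutHom (𝟙 ⦋n⦌) = 𝟙 _ := cut.map_id (op ⦋n⦌)

section

variable (α : ⦋k⦌ ⟶ ⦋n⦌) {p : ℕ}

theorem val_cutHom (h : p < n + 1) :
    val (cutHom α) p = (cutMap α.toOrderHom ⟨p, h⟩ : Fin (k + 1)) := val_of_lt _ h

theorem val_cutHom_of_le (h : p ≤ vtx α 0) : val (cutHom α) p = 0 := by
  have hp : p < n + 1 := Nat.lt_succ_of_le (h.trans (vtx_le α 0))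
  rw [val_cutHom α hp, cutMap, dif_pos]
  · rfl
  · left
    rw [vtx_of_le α (Nat.zero_le k)] at h
    exact h

theorem val_cutHom_of_gt (h : vtx α k < p) : val (cutHom α) p = 0 := by
  rcases lt_or_ge p (n + 1) with hp | hp
  · rw [val_cutHom α hp, cutMap, dif_pos]
    · rfl
    · right
      rw [vtx_of_le α le_rfl] at h
      exact h
  · exact val_of_gt _ hp

theorem val_cutHom_le_iff (h : p ≤ vtx α k) {j : ℕ} (hj : j ≤ k) :
    val (cutHom α) p ≤ j ↔ p ≤ vtx α j := by
  have hp : p < n + 1 := Nat.lt_succ_of_le (h.trans (vtx_le α k))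
  rw [val_cutHom α hp, vtx_of_le α hj]
  rw [vtx_of_le α le_rfl] at h
  exact cutMap_le_iff α.toOrderHom ⟨p, hp⟩ h ⟨j, Nat.lt_succ_of_le hj⟩

theorem val_cutHom_eq {j : ℕ} (hj : j + 1 ≤ k) (h₁ : vtx α j < p) (h₂ : p ≤ vtx α (j + 1)) :
    val (cutHom α) p = j + 1 := by
  have h : p ≤ vtx α k := h₂.trans (vtx_mono α hj)
  have e₁ := val_cutHom_le_iff α h hj
  have e₂ := val_cutHom_le_iff α h (show j ≤ k by omega)
  omega

end

/-- The transposition of `i + 1` and `i + 2`. -/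
def adjSwap (n i : ℕ) : (⟨n⟩ : FinPointedCard) ⟶ ⟨n⟩ := ofVal n n (swapAt i fun p => p) rfl

theorem val_adjSwap {i : ℕ} (hi : i + 2 ≤ n) {p : ℕ} (hp : p ≤ n) :
    val (adjSwap n i) p = swapAt i (fun p => p) p :=
  val_ofVal _ _ hp (by simp only [swapAt]; split_ifs <;> omega)

theorem adjSwap_adjSwap {i : ℕ} (hi : i + 2 ≤ n) : adjSwap n i ≫ adjSwap n i = 𝟙 _ := by
  refine hom_ext_val fun p _ hp => ?_
  rw [val_comp, val_adjSwap hi (val_le _ _), val_adjSwap hi hp, val_id hp]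
  simp only [swapAt]
  split_ifs <;> omega

theorem adjSwap_adjSwap_assoc {i : ℕ} (hi : i + 2 ≤ n) (f : (⟨n⟩ : FinPointedCard) ⟶ ⟨k⟩) :
    adjSwap n i ≫ adjSwap n i ≫ f = f := by
  rw [← Category.assoc, adjSwap_adjSwap hi, Category.id_comp]

theorem val_adjSwap_comp {i : ℕ} (hi : i + 2 ≤ n) (f : (⟨n⟩ : FinPointedCard) ⟶ ⟨k⟩) :
    val (adjSwap n i ≫ f) = swapAt i (val f) := by
  funext p
  rw [val_comp]
  rcases lt_or_ge n p with hp | hp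
  · rw [val_of_gt _ hp, val_zero, swapAt_of_ne _ (by omega) (by omega), val_of_gt _ hp]
  · rw [val_adjSwap hi hp]
    simp only [swapAt]
    split_ifs <;> rfl

theorem swap_eq_adjSwap : swap = adjSwap 2 0 := by
  refine hom_ext_val fun p h₁ h₂ => ?_
  interval_cases p <;> rfl

/-- The sorting key of a pointed map, which puts the base point last. -/
def key (f : (⟨n⟩ : FinPointedCard) ⟶ ⟨k⟩) (p : ℕ) : ℕ := if val f p = 0 then k + 1 else val f p

theorem key_adjSwap_comp {i : ℕ} (hi : i + 2 ≤ n) (f : (⟨n⟩ : FinPointedCard) ⟶ ⟨k⟩) :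
    key (adjSwap n i ≫ f) = swapAt i (key f) := by
  funext p
  simp only [key, val_adjSwap_comp hi f]
  simp only [swapAt, key]
  split_ifs <;> rfl

/-- When `α 0 = 0`, only elements beyond the last vertex of `α` go to the base point, and their key
`k + 1` is the largest. So the sublevel sets of the key are initial segments that end at the
vertices of `α`. -/
theorem key_cutHom_le_iff {α : ⦋k⦌ ⟶ ⦋n⦌} (hα : vtx α 0 = 0) {p j : ℕ} (hp : 1 ≤ p) (hj : j ≤ k) :
    key (cutHom α) p ≤ j ↔ p ≤ vtx α j := by
  rcases le_or_gt p (vtx α k) with h | h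
  · have h₀ := val_cutHom_le_iff α h (Nat.zero_le k)
    have h₁ := val_cutHom_le_iff α h hj
    rw [key, if_neg (by omega), h₁]
  · have := vtx_mono α hj
    rw [key, if_pos (val_cutHom_of_gt α h)]
    omega

theorem isSorted_key_cutHom {α : ⦋k⦌ ⟶ ⦋n⦌} (hα : vtx α 0 = 0) : IsSorted n (key (cutHom α)) := by
  intro i _
  by_contra! h
  have hk : key (cutHom α) (i + 2) ≤ k := by
    have : key (cutHom α) (i + 1) ≤ k + 1 := by
      have := val_le (cutHom α) (i + 1)
      rw [key]
      split_ifs <;> omega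
    omega
  have h₁ := (key_cutHom_le_iff hα (by omega) hk).1 le_rfl
  have h₂ := (key_cutHom_le_iff hα (p := i + 1) (by omega) hk).2 (by omega)
  omega

theorem eq_of_key_cutHom_eq {α β : ⦋k⦌ ⟶ ⦋n⦌} (hα : vtx α 0 = 0) (hβ : vtx β 0 = 0)
    (h : key (cutHom α) = key (cutHom β)) : α = β := by
  refine hom_ext_vtx fun j hj => ?_
  have key (p : ℕ) (hp : 1 ≤ p) : p ≤ vtx α j ↔ p ≤ vtx β j := by
    rw [← key_cutHom_le_iff hα hp hj, ← key_cutHom_le_iff hβ hp hj, h]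
  apply le_antisymm
  · rcases Nat.eq_zero_or_pos (vtx α j) with h | h
    · omega
    · exact (key _ h).1 le_rfl
  · rcases Nat.eq_zero_or_pos (vtx β j) with h | h
    · omega
    · exact (key _ h).2 le_rfl

theorem key_injective {f g : (⟨n⟩ : FinPointedCard) ⟶ ⟨k⟩} (h : key f = key g) : f = g := by
  refine hom_ext_val fun p _ _ => ?_
  have := congrFun h p
  have h₁ := val_le f p
  have h₂ := val_le g p
  simp only [key] at this
  split_ifs at this <;> omega

theorem exists_cutHom_eq {f : (⟨n⟩ : FinPointedCard) ⟶ ⟨k⟩} (hf : IsSorted n (key f)) :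
    ∃ α : ⦋k⦌ ⟶ ⦋n⦌, vtx α 0 = 0 ∧ cutHom α = f := by
  classical
  -- The sublevel sets of a sorted key are initial segments; their ends are the vertices of the
  -- required monotone map.
  let g (j : ℕ) : ℕ := Nat.findGreatest (fun p => key f p ≤ min j k) n
  have hg (j p : ℕ) (hp : 1 ≤ p) (hp' : p ≤ n) : p ≤ g j ↔ key f p ≤ min j k := by
    constructor
    · intro h
      have hne : g j ≠ 0 := by omega
      have h₁ : key f (g j) ≤ min j k := 
        Nat.findGreatest_of_ne_zero (P := fun p => key f p ≤ min j k) (m := g j) rfl hne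
      exact (hf.le hp h (Nat.findGreatest_le n)).trans h₁
    · intro h
      exact Nat.le_findGreatest hp' h
  have hmono (a b : ℕ) (h : a ≤ b) : g a ≤ g b :=
    Nat.findGreatest_mono_left (fun p hp => hp.trans (by omega)) n
  have hle (j : ℕ) : g j ≤ n := Nat.findGreatest_le n
  have hg₀ : g 0 = 0 := by
    by_contra h
    have h₁ := (hg 0 (g 0) (by omega) (hle 0)).1 le_rfl
    rw [key] at h₁
    split_ifs at h₁ <;> omega
  have hvtx (j : ℕ) (hj : j ≤ k) : vtx (ofNatMap k n g hmono) j = g j := by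
    rw [vtx_ofNatMap, min_eq_left hj, min_eq_left (hle j)]
  refine ⟨ofNatMap k n g hmono, by rw [hvtx 0 (Nat.zero_le k), hg₀], key_injective ?_⟩
  have hz : vtx (ofNatMap k n g hmono) 0 = 0 := by rw [hvtx 0 (Nat.zero_le k), hg₀]
  have hk (f : (⟨n⟩ : FinPointedCard) ⟶ ⟨k⟩) (p : ℕ) : key f p ≤ k + 1 := by
    have := val_le f p
    rw [key]
    split_ifs <;> omega
  funext p
  by_cases hp : 1 ≤ p ∧ p ≤ n
  · have e (j : ℕ) (hj : j ≤ k) : key (cutHom (ofNatMap k n g hmono)) p ≤ j ↔ key f p ≤ j := by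
      rw [key_cutHom_le_iff hz hp.1 hj, hvtx j hj, hg j p hp.1 hp.2, min_eq_left hj]
    have h₁ := hk f p
    have h₂ := hk (cutHom (ofNatMap k n g hmono)) p
    rcases h₁.eq_or_lt with h | h
    · rcases h₂.eq_or_lt with h' | h'
      · omega
      · have := (e _ (Nat.le_of_lt_succ h')).1 le_rfl
        omega
    · have h₃ := (e _ (Nat.le_of_lt_succ h)).2 le_rfl
      have h₄ := (e _ (by omega)).1 le_rfl
      omega
  · have (f : (⟨n⟩ : FinPointedCard) ⟶ ⟨k⟩) : val f p = 0 := by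
      rcases Nat.eq_zero_or_pos p with rfl | h
      · exact val_zero f
      · exact val_of_gt f (by omega)
    simp only [key, this]

/-- Every pointed map is obtained from maps `Cut α` by composition with adjacent transpositions. -/
theorem sort_induction {P : ((⟨n⟩ : FinPointedCard) ⟶ ⟨k⟩) → Prop}
    (cut : ∀ α : ⦋k⦌ ⟶ ⦋n⦌, vtx α 0 = 0 → P (cutHom α))
    (swap : ∀ i f, i + 2 ≤ n → P (adjSwap n i ≫ f) → P f) (f) : P f := by
  induction hN : sortWeight n (key f) using Nat.strong_induction_on generalizing f with
  | _ N ih =>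
    by_cases hs : IsSorted n (key f)
    · obtain ⟨α, hα, rfl⟩ := exists_cutHom_eq hs
      exact cut α hα
    · unfold IsSorted at hs
      push Not at hs
      obtain ⟨i, hi, h⟩ := hs
      refine swap i f hi (ih _ ?_ _ rfl)
      rw [← hN, key_adjSwap_comp hi]
      exact sortWeight_swapAt_lt hi h

/-- If `i + 1` is not a vertex of `α`, then `i + 1` and `i + 2` lie in the same fibre of `Cut α`. -/
theorem adjSwap_comp_cutHom {i : ℕ} (hi : i + 2 ≤ n) {α : ⦋k⦌ ⟶ ⦋n⦌}
    (hα : ∀ j, vtx α j ≠ i + 1) : adjSwap n i ≫ cutHom α = cutHom α := by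
  have hle {p q j : ℕ} (hp : p = i + 1 ∨ p = i + 2) (hq : q = i + 1 ∨ q = i + 2) :
      p ≤ vtx α j ↔ q ≤ vtx α j := by
    have := hα j
    omega
  have hv {p q : ℕ} (hp : p = i + 1 ∨ p = i + 2) (hq : q = i + 1 ∨ q = i + 2) :
      val (cutHom α) p = val (cutHom α) q := by
    rcases le_or_gt p (vtx α k) with h | h
    · have h' := (hle hp hq).1 h
      have e (j : ℕ) (hj : j ≤ k) : val (cutHom α) p ≤ j ↔ val (cutHom α) q ≤ j := by
        rw [val_cutHom_le_iff α h hj, val_cutHom_le_iff α h' hj, hle hp hq]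
      exact le_antisymm ((e _ (val_le _ _)).2 le_rfl) ((e _ (val_le _ _)).1 le_rfl)
    · have h' : vtx α k < q := not_le.1 fun h' => absurd ((hle hp hq).2 h') (not_le.2 h)
      rw [val_cutHom_of_gt α h, val_cutHom_of_gt α h']
  refine hom_ext_val fun p _ _ => ?_
  rw [val_adjSwap_comp hi]
  simp only [swapAt]
  split_ifs with h₁ h₂
  · exact hv (by omega) (by omega)
  · exact hv (by omega) (by omega)
  · rfl

theorem val_cutHom_seg {i : ℕ} (hi : i + k ≤ n) {p : ℕ} (h₁ : i ≤ p) (h₂ : p ≤ i + k) :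
    val (cutHom (seg k n i)) p = p - i := by
  rcases h₁.eq_or_lt with rfl | h₁
  · rw [val_cutHom_of_le _ (by rw [vtx_seg _ hi (by omega)]; omega)]
    omega
  · obtain ⟨j, rfl⟩ : ∃ j, p = i + (j + 1) := ⟨p - i - 1, by omega⟩
    rw [val_cutHom_eq (j := j) _ (by omega) (by rw [vtx_seg _ hi (by omega)]; omega)
      (by rw [vtx_seg _ hi (by omega)])]
    omega

theorem val_cutHom_seg_of_lt {i : ℕ} (hi : i + k ≤ n) {p : ℕ} (h : p < i) :
    val (cutHom (seg k n i)) p = 0 :=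
  val_cutHom_of_le _ (by rw [vtx_seg _ hi (by omega)]; omega)

theorem val_cutHom_seg_of_gt {i : ℕ} (hi : i + k ≤ n) {p : ℕ} (h : i + k < p) :
    val (cutHom (seg k n i)) p = 0 :=
  val_cutHom_of_gt _ (by rw [vtx_seg _ hi (by omega)]; omega)

theorem adjSwap_comp_cutHom_seg {i : ℕ} (hi : i + 2 ≤ n) :
    adjSwap n i ≫ cutHom (seg 2 n i) = cutHom (seg 2 n i) ≫ adjSwap 2 0 := by
  refine hom_ext_val fun p _ hp => ?_
  rw [val_adjSwap_comp hi, val_comp, val_adjSwap le_rfl (val_le _ _)]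
  rcases lt_or_ge p i with h | h
  · rw [swapAt_of_ne _ (by omega) (by omega), val_cutHom_seg_of_lt hi h]
    rfl
  rcases lt_or_ge (i + 2) p with h' | h'
  · rw [swapAt_of_ne _ (by omega) (by omega), val_cutHom_seg_of_gt hi h']
    rfl
  obtain ⟨j, rfl⟩ : ∃ j, p = i + j := ⟨p - i, by omega⟩
  have hj : j ≤ 2 := by omega
  rw [val_cutHom_seg hi h h']
  interval_cases j
  · rw [swapAt_of_ne _ (by omega) (by omega), val_cutHom_seg hi h h']
    simp [swapAt]
  · rw [swapAt_left, val_cutHom_seg hi (by omega) (by omega)]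
    simp [swapAt]
  · rw [swapAt_right, val_cutHom_seg hi (by omega) (by omega)]
    simp [swapAt]

theorem val_cutHom_face {v : ℕ} (h₀ : 1 ≤ v) (hv : v ≤ n) {p : ℕ} (hp : p ≤ n + 1) :
    val (cutHom (face n v)) p = if p ≤ v then p else p - 1 := by
  rcases Nat.eq_zero_or_pos p with rfl | h
  · rw [val_zero]
    simp
  split_ifs with h'
  · obtain ⟨j, rfl⟩ : ∃ j, p = j + 1 := ⟨p - 1, by omega⟩
    exact val_cutHom_eq _ (by omega) (by rw [vtx_face _ (by omega)]; split_ifs <;> omega)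
      (by rw [vtx_face _ (by omega)]; split_ifs <;> omega)
  · obtain ⟨j, rfl⟩ : ∃ j, p = j + 2 := ⟨p - 2, by omega⟩
    exact val_cutHom_eq _ (by omega) (by rw [vtx_face _ (by omega)]; split_ifs <;> omega)
      (by rw [vtx_face _ (by omega)]; split_ifs <;> omega)

theorem val_cutHom_face_zero {p : ℕ} (hp : p ≤ n + 1) : val (cutHom (face n 0)) p = p - 1 := by
  rcases lt_or_ge p 2 with h | h
  · rw [val_cutHom_of_le _ (by rw [vtx_face _ (by omega), if_neg (by omega)]; omega)]
    omega
  · obtain ⟨j, rfl⟩ : ∃ j, p = j + 2 := ⟨p - 2, by omega⟩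
    exact val_cutHom_eq _ (by omega) (by rw [vtx_face _ (by omega)]; split_ifs <;> omega)
      (by rw [vtx_face _ (by omega)]; split_ifs <;> omega)

theorem val_cutHom_face_last {p : ℕ} (hp : p ≤ n + 1) :
    val (cutHom (face n (n + 1))) p = if p ≤ n then p else 0 := by
  rcases Nat.eq_zero_or_pos p with rfl | h
  · rw [val_zero]
    simp
  split_ifs with h'
  · obtain ⟨j, rfl⟩ : ∃ j, p = j + 1 := ⟨p - 1, by omega⟩
    exact val_cutHom_eq _ (by omega) (by rw [vtx_face _ (by omega)]; split_ifs <;> omega)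
      (by rw [vtx_face _ (by omega)]; split_ifs <;> omega)
  · exact val_cutHom_of_gt _ (by rw [vtx_face _ (by omega)]; split_ifs <;> omega)

/-- The cyclic permutation which moves the element `k + 1` to the first place. -/
def cycle (n k : ℕ) : (⟨n⟩ : FinPointedCard) ⟶ ⟨n⟩ :=
  match k with
  | 0 => 𝟙 _
  | k + 1 => adjSwap n k ≫ cycle n k

theorem val_cycle {k : ℕ} (hk : k + 1 ≤ n) {p : ℕ} (hp : 1 ≤ p) (hp' : p ≤ n) :
    val (cycle n k) p = if p ≤ k then p + 1 else if p = k + 1 then 1 else p := by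
  induction k generalizing p with
  | zero =>
    rw [cycle, val_id hp']
    split_ifs <;> omega
  | succ k ih =>
    rw [cycle, val_adjSwap_comp (by omega)]
    simp only [swapAt]
    split_ifs <;> (rw [ih (by omega) (by omega) (by omega)]; split_ifs <;> omega)

/-- The counterpart of `face_rotate` for pointed maps. -/
theorem cycle_comp_face (m : ℕ) :
    cycle (m + 1) m ≫ cutHom (face m 0) = cutHom (face m (m + 1)) := by
  refine hom_ext_val fun p h₁ h₂ => ?_
  rw [val_comp, val_cycle le_rfl h₁ h₂, val_cutHom_face_last h₂, val_cutHom_face_zero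
    (by split_ifs <;> omega)]
  split_ifs <;> omega

end FinPointedCard

open FinPointedCard

/-! ### The operator of a pointed map, its functoriality and its uniqueness. -/

namespace SSet

variable {X : SSet.{u}} {l k n : ℕ}

open Classical in
/-- The operator on simplices given by the monotone map with the sorting key `g`, if there is
one. -/
noncomputable def resOfKey (k : ℕ) (g : ℕ → ℕ) (x : X _⦋n⦌) : X _⦋k⦌ :=
  if h : ∃ α : ⦋k⦌ ⟶ ⦋n⦌, vtx α 0 = 0 ∧ key (cutHom α) = g then X.res h.choose x
  -- The constant map at `0` avoids every `i + 1`, so the default value too is invariant under the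
  -- transpositions, as `sortEval_swapAt` demands for all sorted sequences.
  else X.res (ofNatMap k n (fun _ => 0) fun _ _ _ => le_rfl) x

theorem resOfKey_key {α : ⦋k⦌ ⟶ ⦋n⦌} (hα : vtx α 0 = 0) (x : X _⦋n⦌) :
    resOfKey k (key (cutHom α)) x = X.res α x := by
  have h : ∃ β : ⦋k⦌ ⟶ ⦋n⦌, vtx β 0 = 0 ∧ key (cutHom β) = key (cutHom α) := ⟨α, hα, rfl⟩
  rw [resOfKey, dif_pos h, eq_of_key_cutHom_eq h.choose_spec.1 hα h.choose_spec.2]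

/-- The operator on simplices given by a pointed map. -/
noncomputable def gammaMap (θ : X _⦋2⦌ → X _⦋2⦌) (f : (⟨n⟩ : FinPointedCard) ⟶ ⟨k⟩) (x : X _⦋n⦌) :
    X _⦋k⦌ :=
  sortEval n (transpose θ) (resOfKey k) (key f) x

theorem gammaMap_cutHom_of_zero (θ : X _⦋2⦌ → X _⦋2⦌) {α : ⦋k⦌ ⟶ ⦋n⦌} (hα : vtx α 0 = 0)
    (x : X _⦋n⦌) : gammaMap θ (cutHom α) x = X.res α x := by
  rw [gammaMap, sortEval_of_sorted _ _ _ (isSorted_key_cutHom hα), resOfKey_key hα]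

/-- The number of elements which are not sent to the base point. -/
def supportCard (f : (⟨n⟩ : FinPointedCard) ⟶ ⟨k⟩) : ℕ :=
  ((Finset.range (n + 1)).filter fun p => val f p ≠ 0).card

theorem supportCard_lt {f : (⟨n⟩ : FinPointedCard) ⟶ ⟨k⟩} {g : (⟨n⟩ : FinPointedCard) ⟶ ⟨l⟩}
    (h : ∀ p, val f p = 0 → val g p = 0) (p : ℕ) (hf : val f p ≠ 0) (hg : val g p = 0) :
    supportCard g < supportCard f := by
  have hp : p < n + 1 := by
    by_contra hp
    exact hf (val_of_gt f (by omega))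
  refine Finset.card_lt_card (Finset.ssubset_iff_of_subset ?_ |>.2 ⟨p, ?_, ?_⟩)
  · intro q hq
    rw [Finset.mem_filter] at hq ⊢
    exact ⟨hq.1, fun h' => hq.2 (h q h')⟩
  · exact Finset.mem_filter.2 ⟨Finset.mem_range.2 hp, hf⟩
  · intro hq
    exact (Finset.mem_filter.1 hq).2 hg

namespace IsBraiding

variable {θ : X _⦋2⦌ → X _⦋2⦌} (hθ : X.IsBraiding θ) (hX : X.IsTwoSegal)

include hθ hX

/-- The Coxeter relations feed `sortEval_swapAt`. Its invariance hypothesis holds because equal keys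
at `i + 1` and `i + 2` mean that `α` misses the vertex `i + 1`, and restriction along `α` then
ignores the transposition. -/
theorem gammaMap_adjSwap_comp {i : ℕ} (hi : i + 2 ≤ n) (f : (⟨n⟩ : FinPointedCard) ⟶ ⟨k⟩)
    (x : X _⦋n⦌) : gammaMap θ (adjSwap n i ≫ f) (transpose θ i x) = gammaMap θ f x := by
  rw [gammaMap, gammaMap, key_adjSwap_comp hi]
  refine sortEval_swapAt (fun i a h => hθ.transpose_transpose hX h a)
    (fun i j a h h' => hθ.transpose_comm hX h h' a) (fun i a h => hθ.transpose_braid hX h a)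
    (fun g i a hg hi h => ?_) _ i hi x
  by_cases hα : ∃ α : ⦋k⦌ ⟶ ⦋n⦌, vtx α 0 = 0 ∧ key (cutHom α) = g
  · obtain ⟨α, hα, rfl⟩ := hα
    rw [resOfKey_key hα, resOfKey_key hα]
    refine hθ.res_transpose hX hi a fun j hj => ?_
    have hj' : vtx α (min j k) = i + 1 := (vtx_min α j).trans hj
    have h₁ := key_cutHom_le_iff hα (p := i + 1) (by omega) (min_le_right j k)
    have h₂ := key_cutHom_le_iff hα (p := i + 2) (by omega) (min_le_right j k)
    rw [h] at h₁
    omega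
  · rw [resOfKey, resOfKey, dif_neg hα, dif_neg hα, hθ.res_transpose hX hi a fun j => ?_]
    rw [vtx_ofNatMap]
    omega

theorem gammaMap_cycle_comp {m : ℕ} (hm : m + 1 ≤ n) (f : (⟨n⟩ : FinPointedCard) ⟶ ⟨k⟩)
    (x : X _⦋n⦌) : gammaMap θ (cycle n m ≫ f) (rotate θ m x) = gammaMap θ f x := by
  induction m with
  | zero => rw [cycle, Category.id_comp, rotate]
  | succ m ih =>
    rw [cycle, Category.assoc, rotate, hθ.gammaMap_adjSwap_comp hX (by omega), ih (by omega)]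

/-- Induction on `α 0`. If it is positive, `α` factors through the face opposite to `0`; a rotation
exchanges this face for the one opposite to the last vertex, which lowers `α 0` by one. -/
theorem gammaMap_cutHom (α : ⦋k⦌ ⟶ ⦋n⦌) (x : X _⦋n⦌) :
    gammaMap θ (cutHom α) x = X.res α x := by
  induction hc : vtx α 0 generalizing α x with
  | zero => exact gammaMap_cutHom_of_zero θ hc x
  | succ c ih =>
    have hn := vtx_le α 0
    obtain ⟨m, rfl⟩ : ∃ m, n = m + 1 := ⟨n - 1, by omega⟩
    obtain ⟨β, rfl⟩ := exists_comp_face α (Nat.zero_le _) fun j => by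
      have := vtx_mono α (Nat.zero_le j)
      omega
    have hβ : vtx β 0 = c := by
      rw [vtx_comp, vtx_face _ (vtx_le _ _), if_neg (by omega)] at hc
      omega
    have hle := vtx_le β 0
    rw [← hθ.gammaMap_cycle_comp hX le_rfl, cutHom_comp, ← Category.assoc, cycle_comp_face,
      ← cutHom_comp, ih, ← res_res, hθ.face_rotate hX, res_res]
    rw [vtx_comp, vtx_face _ hle, if_pos (by omega), hβ]

theorem gammaMap_comp_cutHom (α : ⦋l⦌ ⟶ ⦋k⦌)
    (f : (⟨n⟩ : FinPointedCard) ⟶ ⟨k⟩) (x : X _⦋n⦌) :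
    gammaMap θ (f ≫ cutHom α) x = X.res α (gammaMap θ f x) := by
  induction f using sort_induction generalizing x with
  | cut β hβ =>
    rw [← cutHom_comp, hθ.gammaMap_cutHom hX, hθ.gammaMap_cutHom hX, res_res]
  | swap i f hi ih =>
    rw [← hθ.gammaMap_adjSwap_comp hX hi f, ← ih, Category.assoc,
      hθ.gammaMap_adjSwap_comp hX hi]

/-- Compatibility with a transposition follows from compatibility at the two factors involved. -/
theorem gammaMap_comp_adjSwap_of {i : ℕ} (hi : i + 2 ≤ k) (f : (⟨n⟩ : FinPointedCard) ⟶ ⟨k⟩)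
    (x : X _⦋n⦌)
    (h : gammaMap θ ((f ≫ cutHom (seg 2 k i)) ≫ adjSwap 2 0) x =
      θ (gammaMap θ (f ≫ cutHom (seg 2 k i)) x)) :
    gammaMap θ (f ≫ adjSwap k i) x = transpose θ i (gammaMap θ f x) := by
  refine hθ.eq_transpose hX hi (fun α hα => ?_) ?_
  · rw [← hθ.gammaMap_comp_cutHom hX, ← hθ.gammaMap_comp_cutHom hX, Category.assoc,
      adjSwap_comp_cutHom hi hα]
  · rw [← hθ.gammaMap_comp_cutHom hX, ← hθ.gammaMap_comp_cutHom hX, ← h, Category.assoc,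
      Category.assoc, adjSwap_comp_cutHom_seg hi]

/-- Compatibility with the transposition when the first fibre is empty. -/
theorem gammaMap_comp_swap_of_forall_ne (f : (⟨n⟩ : FinPointedCard) ⟶ ⟨2⟩) (x : X _⦋n⦌)
    (h : ∀ p, val f p ≠ 1) : gammaMap θ (f ≫ adjSwap 2 0) x = θ (gammaMap θ f x) := by
  let σ (i : Fin 2) : ⦋2⦌ ⟶ ⦋1⦌ := SimplexCategory.σ i
  have hσ (i : Fin 2) (y : X _⦋1⦌) : X.res (σ i) y = X.σ i y := rfl
  -- With the first fibre empty, `f` factors through the degeneracy `s_0` and its composite with the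
  -- transposition through `s_1`, so `θ (s_0 x) = s_1 x` suffices.
  have e₀ : (f ≫ cutHom (face 1 0)) ≫ cutHom (σ 0) = f := by
    refine hom_ext_val fun p _ _ => ?_
    have h₁ := h p
    have h₂ := val_le f p
    rw [val_comp, val_comp, val_cutHom_face_zero h₂]
    obtain h₃ | h₃ : val f p = 0 ∨ val f p = 2 := by omega
    · rw [h₃, val_zero]
    · rw [h₃]
      exact val_cutHom_eq _ (j := 1) le_rfl (by decide) (by decide)
  have e₁ : (f ≫ cutHom (face 1 0)) ≫ cutHom (σ 1) = f ≫ adjSwap 2 0 := by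
    refine hom_ext_val fun p _ _ => ?_
    have h₁ := h p
    have h₂ := val_le f p
    rw [val_comp, val_comp, val_cutHom_face_zero h₂, val_comp, val_adjSwap le_rfl h₂]
    obtain h₃ | h₃ : val f p = 0 ∨ val f p = 2 := by omega
    · rw [h₃, val_zero]
      rfl
    · rw [h₃]
      exact val_cutHom_eq _ (j := 0) (by omega) (by decide) (by decide)
  rw [← e₁]
  conv_rhs => rw [← e₀]
  rw [hθ.gammaMap_comp_cutHom hX, hθ.gammaMap_comp_cutHom hX (σ 0), hσ, hσ,
    hθ.braiding_degenerate hX]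

/-- Compatibility with the transposition when both fibres have exactly one element. -/
theorem gammaMap_comp_swap_of_unique (f : (⟨n⟩ : FinPointedCard) ⟶ ⟨2⟩) (x : X _⦋n⦌)
    (h₁ : ∃ p, val f p = 1) (h₂ : ∃ p, val f p = 2)
    (u₁ : ∀ p q, val f p = 1 → val f q = 1 → p = q)
    (u₂ : ∀ p q, val f p = 2 → val f q = 2 → p = q) :
    gammaMap θ (f ≫ adjSwap 2 0) x = θ (gammaMap θ f x) := by
  induction f using sort_induction generalizing x with
  | cut α hα =>
    obtain ⟨p, hp⟩ := h₁
    obtain ⟨q, hq⟩ := h₂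
    have hp₁ : p ≤ vtx α 2 := by
      by_contra h
      rw [val_cutHom_of_gt α (by omega)] at hp
      omega
    have hq₁ : q ≤ vtx α 2 := by
      by_contra h
      rw [val_cutHom_of_gt α (by omega)] at hq
      omega
    have hp₂ := val_cutHom_le_iff α hp₁ (show 0 ≤ 2 by omega)
    have hp₃ := val_cutHom_le_iff α hp₁ (show 1 ≤ 2 by omega)
    have hq₂ := val_cutHom_le_iff α hq₁ (show 1 ≤ 2 by omega)
    -- Fibres with one element force the vertices of `α` to be `0, 1, 2`, so that the claim is the
    -- defining property of `transpose` on the first triangle.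
    have v₁ : vtx α 1 = 1 := by
      by_contra h
      exact absurd (u₁ 1 2 (val_cutHom_eq α (j := 0) (by omega) (by omega)
        (by rw [zero_add]; omega)) (val_cutHom_eq α (j := 0) (by omega) (by omega)
        (by rw [zero_add]; omega))) (by omega)
    have v₂ : vtx α 2 = 2 := by
      by_contra h
      exact absurd (u₂ 2 3 (val_cutHom_eq α (j := 1) (by omega) (by omega)
        (by rw [one_add_one_eq_two]; omega)) (val_cutHom_eq α (j := 1) (by omega) (by omega)
        (by rw [one_add_one_eq_two]; omega))) (by omega)
    have hn : 0 + 2 ≤ n := by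
      have := vtx_le α 2
      omega
    have e : α = seg 2 n 0 := hom_ext_vtx fun j hj => by
      rw [vtx_seg _ hn hj]
      interval_cases j <;> omega
    rw [e, ← adjSwap_comp_cutHom_seg hn, ← hθ.transpose_transpose hX hn x,
      hθ.gammaMap_adjSwap_comp hX hn, hθ.gammaMap_cutHom hX, hθ.gammaMap_cutHom hX,
      hθ.transpose_transpose hX hn, hθ.res_seg_transpose hX hn]
  | swap i f hi ih =>
    have hv (p : ℕ) : val (adjSwap n i ≫ f) (swapAt i (fun p => p) p) = val f p := by
      rw [val_adjSwap_comp hi]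
      simp only [swapAt]
      split_ifs <;> first | rfl | (congr 1; omega)
    have hv' (p : ℕ) : val (adjSwap n i ≫ f) p = val f (swapAt i (fun p => p) p) := by
      rw [val_adjSwap_comp hi]
      simp only [swapAt]
      split_ifs <;> rfl
    have hinj (p q : ℕ) (h : swapAt i (fun p => p) p = swapAt i (fun p => p) q) : p = q := by
      simp only [swapAt] at h
      split_ifs at h <;> omega
    have := ih (transpose θ i x) (h₁.imp' _ fun p hp => (hv p).trans hp)
      (h₂.imp' _ fun p hp => (hv p).trans hp)
      (fun p q hp hq => hinj p q (u₁ _ _ ((hv' p).symm.trans hp) ((hv' q).symm.trans hq)))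
      (fun p q hp hq => hinj p q (u₂ _ _ ((hv' p).symm.trans hp) ((hv' q).symm.trans hq)))
    rwa [Category.assoc, hθ.gammaMap_adjSwap_comp hX hi, hθ.gammaMap_adjSwap_comp hX hi] at this

/-- Reduction to smaller maps when the first fibre has at least two elements. -/
theorem gammaMap_comp_swap_of_two (f : (⟨n⟩ : FinPointedCard) ⟶ ⟨2⟩) (x : X _⦋n⦌)
    (ih : ∀ g : (⟨n⟩ : FinPointedCard) ⟶ ⟨2⟩, supportCard g < supportCard f →
      gammaMap θ (g ≫ adjSwap 2 0) x = θ (gammaMap θ g x))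
    {p q : ℕ} (hpq : p ≠ q) (hp : val f p = 1) (hq : val f q = 1) :
    gammaMap θ (f ≫ adjSwap 2 0) x = θ (gammaMap θ f x) := by
  have hp₀ : p ≠ 0 := by
    rintro rfl
    rw [val_zero] at hp
    omega
  -- Split the first fibre: `p` goes to 1, its other elements to 2, and the second fibre to 3. The
  -- face `d_1` merges the two pieces again.
  let g : (⟨n⟩ : FinPointedCard) ⟶ ⟨3⟩ := ofVal n 3 (fun r => if r = p then 1 else
    if val f r = 0 then 0 else val f r + 1) (by simp [hp₀.symm, val_zero])
  have hg (r : ℕ) : val g r = if r = p then 1 else if val f r = 0 then 0 else val f r + 1 := by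
    rcases lt_or_ge n r with hr | hr
    · rw [val_of_gt _ hr, val_of_gt f hr, if_neg, if_pos rfl]
      rintro rfl
      rw [val_of_gt f hr] at hp
      omega
    · have := val_le f r
      exact val_ofVal _ _ hr (by split_ifs <;> omega)
  have hv (r : ℕ) : (r = p ∧ val g r = 1 ∧ val f r = 1) ∨
      (r ≠ p ∧ ((val g r = 0 ∧ val f r = 0) ∨ (val g r = 2 ∧ val f r = 1) ∨
        (val g r = 3 ∧ val f r = 2))) := by
    have := val_le f r
    rw [hg]
    by_cases hr : r = p
    · left
      subst hr
      simp [hp]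
    · right
      rw [if_neg hr]
      refine ⟨hr, ?_⟩
      split_ifs <;> omega
  have a₁ (r : ℕ) (hr : r ≤ 3) : val (adjSwap 3 1) r = swapAt 1 (fun p => p) r :=
    val_adjSwap (by omega) hr
  have a₀ (r : ℕ) (hr : r ≤ 3) : val (adjSwap 3 0) r = swapAt 0 (fun p => p) r :=
    val_adjSwap (by omega) hr
  have a₂ (r : ℕ) (hr : r ≤ 2) : val (adjSwap 2 0) r = swapAt 0 (fun p => p) r :=
    val_adjSwap (by omega) hr
  have b₁ : g ≫ cutHom (face 2 1) = f := by
    refine hom_ext_val fun r _ _ => ?_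
    rw [val_comp, val_cutHom_face le_rfl (by omega) (val_le g r)]
    have := hv r
    split_ifs <;> omega
  have b₂ : ((g ≫ adjSwap 3 1) ≫ adjSwap 3 0) ≫ cutHom (face 2 2) = f ≫ adjSwap 2 0 := by
    refine hom_ext_val fun r _ _ => ?_
    rw [val_comp, val_comp, val_comp, val_comp,
      val_cutHom_face (by omega) le_rfl (val_le _ _), a₀ _ (val_le _ _), a₁ _ (val_le _ _),
      a₂ _ (val_le _ _)]
    rcases hv r with ⟨-, h₁, h₂⟩ | ⟨-, ⟨h₁, h₂⟩ | ⟨h₁, h₂⟩ | ⟨h₁, h₂⟩⟩ <;> rw [h₁, h₂] <;> rfl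
  -- The transposition of the last two values does not involve `p`, and the next one does not
  -- involve `q`, so both have smaller support and fall under the induction.
  have c₁ := hθ.gammaMap_comp_adjSwap_of hX (k := 3) (i := 1) (by omega) g x <| ih _ <| by
    have hs (r : ℕ) : val (g ≫ cutHom (seg 2 3 1)) r = val g r - 1 := by
      rw [val_comp]
      rcases Nat.eq_zero_or_pos (val g r) with h | h
      · rw [h, val_zero]
      · exact val_cutHom_seg (by omega) h (val_le g r)
    refine supportCard_lt (fun r hr => ?_) p (by omega) ?_
    · have := hv r
      rw [hs]
      omega
    · have := hv p
      rw [hs]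
      omega
  have c₂ := hθ.gammaMap_comp_adjSwap_of hX (k := 3) (i := 0) (by omega) (g ≫ adjSwap 3 1) x <|
    ih _ <| by
    have hs (r : ℕ) : val ((g ≫ adjSwap 3 1) ≫ cutHom (seg 2 3 0)) r =
        if val g r = 1 then 1 else if val g r = 3 then 2 else 0 := by
      rw [val_comp, val_comp, a₁ _ (val_le g r)]
      rcases hv r with ⟨-, h₁, h₂⟩ | ⟨-, ⟨h₁, h₂⟩ | ⟨h₁, h₂⟩ | ⟨h₁, h₂⟩⟩ <;> rw [h₁]
      · exact val_cutHom_seg (by omega) (by omega) (by decide)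
      · exact val_zero _
      · exact val_cutHom_seg_of_gt (by omega) (by decide)
      · exact val_cutHom_seg (by omega) (by omega) (by decide)
    refine supportCard_lt (fun r hr => ?_) q (by omega) ?_
    · have := hv r
      rw [hs]
      split_ifs <;> omega
    · have := hv q
      rw [hs]
      split_ifs <;> omega
  -- The hexagon: moving the last factor past two and multiplying these is `θ` applied after
  -- multiplying them.
  rw [← b₂, hθ.gammaMap_comp_cutHom hX, c₂, c₁, (hθ.face_transpose_transpose' hX _).2,
    ← hθ.gammaMap_comp_cutHom hX, b₁]

theorem gammaMap_comp_swap (f : (⟨n⟩ : FinPointedCard) ⟶ ⟨2⟩) (x : X _⦋n⦌) :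
    gammaMap θ (f ≫ adjSwap 2 0) x = θ (gammaMap θ f x) := by
  induction hN : supportCard f using Nat.strong_induction_on generalizing f with
  | _ N ih =>
    subst hN
    -- The claims for `f` and for its composite with the transposition are equivalent, so the two
    -- fibres play symmetric roles.
    have hflip (h : gammaMap θ ((f ≫ adjSwap 2 0) ≫ adjSwap 2 0) x =
        θ (gammaMap θ (f ≫ adjSwap 2 0) x)) :
        gammaMap θ (f ≫ adjSwap 2 0) x = θ (gammaMap θ f x) := by
      rw [Category.assoc, adjSwap_adjSwap le_rfl, Category.comp_id] at h
      rw [h, hθ.invol]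
    have hval (r : ℕ) : val (f ≫ adjSwap 2 0) r = swapAt 0 (fun p => p) (val f r) := by
      rw [val_comp, val_adjSwap le_rfl (val_le f r)]
    have hval₀ (r : ℕ) : val (f ≫ adjSwap 2 0) r = 0 ↔ val f r = 0 := by
      have := val_le f r
      rw [hval]
      interval_cases val f r <;> decide
    have hval₁ (r : ℕ) : val (f ≫ adjSwap 2 0) r = 1 ↔ val f r = 2 := by
      have := val_le f r
      rw [hval]
      interval_cases val f r <;> decide
    have hcard : supportCard (f ≫ adjSwap 2 0) = supportCard f := by
      simp only [supportCard, ne_eq, hval₀]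
    by_cases h₁ : ∃ p, val f p = 1
    swap
    · exact hθ.gammaMap_comp_swap_of_forall_ne hX f x (not_exists.1 h₁)
    by_cases h₂ : ∃ p, val f p = 2
    swap
    · exact hflip (hθ.gammaMap_comp_swap_of_forall_ne hX _ x fun r hr => h₂ ⟨r, (hval₁ r).1 hr⟩)
    by_cases u₁ : ∀ p q, val f p = 1 → val f q = 1 → p = q
    swap
    · push Not at u₁
      obtain ⟨p, q, hp, hq, hpq⟩ := u₁
      exact hθ.gammaMap_comp_swap_of_two hX f x (fun g hg => ih _ hg g rfl) hpq hp hq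
    by_cases u₂ : ∀ p q, val f p = 2 → val f q = 2 → p = q
    swap
    · push Not at u₂
      obtain ⟨p, q, hp, hq, hpq⟩ := u₂
      exact hflip (hθ.gammaMap_comp_swap_of_two hX _ x
        (fun g hg => ih _ (by rwa [hcard] at hg) g rfl) hpq ((hval₁ p).2 hp) ((hval₁ q).2 hq))
    exact hθ.gammaMap_comp_swap_of_unique hX f x h₁ h₂ u₁ u₂

/-- It is enough to let `g` run through generators; the adjacent transpositions reduce to
`gammaMap_comp_swap` on the segment that they move. -/
theorem gammaMap_comp (f : (⟨n⟩ : FinPointedCard) ⟶ ⟨k⟩) (g : (⟨k⟩ : FinPointedCard) ⟶ ⟨l⟩)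
    (x : X _⦋n⦌) : gammaMap θ (f ≫ g) x = gammaMap θ g (gammaMap θ f x) := by
  induction g using sort_induction generalizing f x with
  | cut α _ => rw [hθ.gammaMap_comp_cutHom hX, hθ.gammaMap_cutHom hX]
  | swap i g hi ih =>
    rw [← hθ.gammaMap_adjSwap_comp hX hi g,
      ← hθ.gammaMap_comp_adjSwap_of hX hi f x (hθ.gammaMap_comp_swap hX _ x), ← ih,
      Category.assoc, adjSwap_adjSwap_assoc hi]

theorem gammaMap_id (x : X _⦋n⦌) : gammaMap θ (𝟙 _) x = x := by
  rw [← cutHom_id, hθ.gammaMap_cutHom hX, res_id]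

theorem gammaMap_swap (ξ : X _⦋2⦌) : gammaMap θ swap ξ = θ ξ := by
  have := hθ.gammaMap_comp_swap hX (𝟙 _) ξ
  rwa [Category.id_comp, hθ.gammaMap_id hX, ← swap_eq_adjSwap] at this

/-- A functorial system of operators which extends the simplicial operators is determined by the
transposition of two factors. -/
theorem eq_gammaMap (M : ∀ n k : ℕ, ((⟨n⟩ : FinPointedCard) ⟶ ⟨k⟩) → X _⦋n⦌ → X _⦋k⦌)
    (hcomp : ∀ (n k l : ℕ) (f : (⟨n⟩ : FinPointedCard) ⟶ ⟨k⟩) (g : (⟨k⟩ : FinPointedCard) ⟶ ⟨l⟩)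
      (x : X _⦋n⦌), M n l (f ≫ g) x = M k l g (M n k f x))
    (hcut : ∀ (n k : ℕ) (α : ⦋k⦌ ⟶ ⦋n⦌) (x : X _⦋n⦌), M n k (cutHom α) x = X.res α x)
    (hswap : ∀ ξ : X _⦋2⦌, M 2 2 swap ξ = θ ξ) (f : (⟨n⟩ : FinPointedCard) ⟶ ⟨k⟩)
    (x : X _⦋n⦌) : M n k f x = gammaMap θ f x := by
  -- Functoriality alone gives the two properties that characterise `transpose`.
  have htr {i : ℕ} (hi : i + 2 ≤ n) (x : X _⦋n⦌) : M n n (adjSwap n i) x = transpose θ i x := by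
    refine hθ.eq_transpose hX hi (fun α hα => ?_) ?_
    · rw [← hcut, ← hcomp, adjSwap_comp_cutHom hi hα, hcut]
    · rw [← hcut, ← hcomp, adjSwap_comp_cutHom_seg hi, hcomp, hcut, ← swap_eq_adjSwap, hswap]
  induction f using sort_induction generalizing x with
  | cut α _ => rw [hcut, hθ.gammaMap_cutHom hX]
  | swap i f hi ih =>
    rw [← hθ.gammaMap_adjSwap_comp hX hi f, ← ih, ← htr hi, ← hcomp, adjSwap_adjSwap_assoc hi]

end IsBraiding

/-! ### Braidings from functorial systems of operators. -/

/-- The transposition of two factors, in a functorial system of operators which extends the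
simplicial operators. -/
theorem isBraiding_of_functorial (hX : X.IsTwoSegal)
    (M : ∀ n k : ℕ, ((⟨n⟩ : FinPointedCard) ⟶ ⟨k⟩) → X _⦋n⦌ → X _⦋k⦌)
    (hcomp : ∀ (n k l : ℕ) (f : (⟨n⟩ : FinPointedCard) ⟶ ⟨k⟩) (g : (⟨k⟩ : FinPointedCard) ⟶ ⟨l⟩)
      (x : X _⦋n⦌), M n l (f ≫ g) x = M k l g (M n k f x))
    (hcut : ∀ (n k : ℕ) (α : ⦋k⦌ ⟶ ⦋n⦌) (x : X _⦋n⦌), M n k (cutHom α) x = X.res α x) :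
    X.IsBraiding (M 2 2 swap) := by
  have hδ {m : ℕ} (j : Fin (m + 2)) (x : X _⦋m + 1⦌) :
      X.δ j x = M _ _ (cutHom (face m j)) x := by rw [hcut, δ_eq_res]
  have face₂ (i : ℕ) (p : ℕ) (hp : p ≤ 2) (hi : i ≤ 2) : val (cutHom (face 1 i)) p =
      if i = 0 then p - 1 else if i = 1 then (if p ≤ 1 then p else p - 1) else
        if p ≤ 1 then p else 0 := by
    interval_cases i
    · exact val_cutHom_face_zero hp
    · exact val_cutHom_face le_rfl le_rfl hp
    · exact val_cutHom_face_last hp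
  have face₃ (i : ℕ) (p : ℕ) (hp : p ≤ 3) (hi : i ≤ 3) : val (cutHom (face 2 i)) p =
      if i = 0 then p - 1 else if i = 1 then (if p ≤ 1 then p else p - 1) else
        if i = 2 then (if p ≤ 2 then p else p - 1) else if p ≤ 2 then p else 0 := by
    interval_cases i
    · exact val_cutHom_face_zero hp
    · exact val_cutHom_face le_rfl (by omega) hp
    · exact val_cutHom_face (by omega) le_rfl hp
    · exact val_cutHom_face_last hp
  have a₁ (r : ℕ) (hr : r ≤ 3) : val (adjSwap 3 1) r = swapAt 1 (fun p => p) r :=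
    val_adjSwap (by omega) hr
  have a₀ (r : ℕ) (hr : r ≤ 3) : val (adjSwap 3 0) r = swapAt 0 (fun p => p) r :=
    val_adjSwap (by omega) hr
  have a₂ (r : ℕ) (hr : r ≤ 2) : val swap r = swapAt 0 (fun p => p) r := by
    rw [swap_eq_adjSwap]
    exact val_adjSwap (by omega) hr
  refine ⟨fun ξ => ?_, fun ξ => ?_, fun ξ => ?_, fun ξ => ?_, fun ψ φ χ h₁ h₂ h₃ h₄ => ?_⟩
  · rw [hδ, hδ, ← hcomp]
    congr 1
    refine hom_ext_val fun p _ hp => ?_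
    rw [val_comp, face₂ _ _ (val_le _ _) (by decide), face₂ _ _ hp (by decide), a₂ _ hp]
    interval_cases p <;> rfl
  · rw [hδ, hδ, ← hcomp]
    congr 1
    refine hom_ext_val fun p _ hp => ?_
    rw [val_comp, face₂ _ _ (val_le _ _) (by decide), face₂ _ _ hp (by decide), a₂ _ hp]
    interval_cases p <;> rfl
  · rw [hδ, hδ, ← hcomp]
    congr 1
    refine hom_ext_val fun p _ hp => ?_
    rw [val_comp, face₂ _ _ (val_le _ _) (by decide), face₂ _ _ hp (by decide), a₂ _ hp]
    interval_cases p <;> rfl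
  · rw [← hcomp, swap_eq_adjSwap, adjSwap_adjSwap le_rfl, ← cutHom_id, hcut, res_id]
  -- The faces `d_3` and `d_1` identify `φ` and `χ` with the images of `ψ` under permutations of
  -- three factors. The hexagon is then an identity of pointed maps.
  · obtain rfl : φ = M 3 3 (adjSwap 3 0) ψ := by
      refine hX.extA ?_ ?_
      · rw [h₁, hδ, hδ, ← hcomp, ← hcomp]
        congr 1
        refine hom_ext_val fun p _ hp => ?_
        rw [val_comp, val_comp, face₃ _ _ (val_le _ _) (by decide), face₃ _ _ hp (by decide),
          a₂ _ (by split_ifs <;> omega), a₀ _ hp]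
        interval_cases p <;> rfl
      · rw [h₂, hδ, hδ, ← hcomp]
        congr 1
        refine hom_ext_val fun p _ hp => ?_
        rw [val_comp, face₃ _ _ (val_le _ _) (by decide), face₃ _ _ hp (by decide), a₀ _ hp]
        interval_cases p <;> rfl
    obtain rfl : χ = M 3 3 (adjSwap 3 1) (M 3 3 (adjSwap 3 0) ψ) := by
      refine hX.extA ?_ ?_
      · rw [h₃, hδ, hδ, ← hcomp, ← hcomp]
        congr 1
        refine hom_ext_val fun p _ hp => ?_
        rw [val_comp, val_comp, face₃ _ _ (val_le _ _) (by decide), face₃ _ _ hp (by decide),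
          a₁ _ (val_le _ _), a₀ _ hp]
        interval_cases p <;> rfl
      · rw [h₄, hδ, hδ, ← hcomp, ← hcomp, ← hcomp]
        congr 1
        refine hom_ext_val fun p _ hp => ?_
        rw [val_comp, val_comp, val_comp, face₃ _ _ (val_le _ _) (by decide),
          face₃ _ _ hp (by decide), a₂ _ (by simp; split_ifs <;> omega), a₁ _ (val_le _ _), a₀ _ hp]
        interval_cases p <;> rfl
    generalize M 3 3 (adjSwap 3 0) ψ = y
    constructor
    · rw [hδ, hδ, ← hcomp, ← hcomp]
      congr 1
      refine hom_ext_val fun p _ hp => ?_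
      rw [val_comp, val_comp, face₃ _ _ (val_le _ _) (by decide), face₃ _ _ hp (by decide),
        a₁ _ hp, a₂ _ (by simp; omega)]
      interval_cases p <;> rfl
    · rw [hδ, hδ, ← hcomp]
      congr 1
      refine hom_ext_val fun p _ hp => ?_
      rw [val_comp, face₃ _ _ (val_le _ _) (by decide), face₃ _ _ hp (by decide), a₁ _ hp]
      interval_cases p <;> rfl

end SSet

/-! ### Γ-structures and their braidings. -/

namespace GammaStructure

variable {X : SSet.{u}}

/-- The action of a pointed map on the simplices of `X` which underlies a Γ-structure. -/
def action (G : GammaStructure X) {n k : ℕ} (f : (⟨n⟩ : FinPointedCard) ⟶ ⟨k⟩) :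
    X _⦋n⦌ ⟶ X _⦋k⦌ :=
  eqToHom (congrArg (fun Y : SSet.{u} => Y _⦋n⦌) G.cut_comp.symm) ≫ G.functor.map f ≫
    eqToHom (congrArg (fun Y : SSet.{u} => Y _⦋k⦌) G.cut_comp)

theorem action_comp (G : GammaStructure X) {n k l : ℕ} (f : (⟨n⟩ : FinPointedCard) ⟶ ⟨k⟩)
    (g : (⟨k⟩ : FinPointedCard) ⟶ ⟨l⟩) : G.action (f ≫ g) = G.action f ≫ G.action g := by
  obtain ⟨F, rfl⟩ := G
  exact F.map_comp f g

theorem action_cutHom (G : GammaStructure X) {n k : ℕ} (α : ⦋k⦌ ⟶ ⦋n⦌) :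
    G.action (cutHom α) = X.map α.op := by
  obtain ⟨F, rfl⟩ := G
  rfl

theorem ext_of_action {G G' : GammaStructure X}
    (h : ∀ {n k : ℕ} (f : (⟨n⟩ : FinPointedCard) ⟶ ⟨k⟩), G.action f = G'.action f) : G = G' := by
  obtain ⟨F, rfl⟩ := G
  obtain ⟨F', e⟩ := G'
  have : F = F' := by
    refine CategoryTheory.Functor.ext
      (fun A => congrArg (fun Y : SSet.{u} => Y _⦋A.card⦌) e.symm) fun A B f => ?_
    exact h (n := A.card) (k := B.card) f
  subst this
  rfl

theorem isBraiding_theta (G : GammaStructure X) (hX : X.IsTwoSegal) :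
    X.IsBraiding G.theta :=
  SSet.isBraiding_of_functorial hX (fun _ _ f => G.action f)
    (fun _ _ _ f g x => ConcreteCategory.congr_hom (G.action_comp f g) x)
    (fun _ _ α x => ConcreteCategory.congr_hom (G.action_cutHom α) x)

theorem action_eq_gammaMap (G : GammaStructure X) (hX : X.IsTwoSegal) {n k : ℕ}
    (f : (⟨n⟩ : FinPointedCard) ⟶ ⟨k⟩) (x : X _⦋n⦌) :
    G.action f x = SSet.gammaMap G.theta f x :=
  (G.isBraiding_theta hX).eq_gammaMap hX (fun _ _ f => G.action f)
    (fun _ _ _ f g x => ConcreteCategory.congr_hom (G.action_comp f g) x)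
    (fun _ _ α x => ConcreteCategory.congr_hom (G.action_cutHom α) x) (fun _ => rfl) f x

/-- Every action map is `gammaMap` of the transposition, by `action_eq_gammaMap`. -/
theorem ext_of_theta (hX : X.IsTwoSegal) {G G' : GammaStructure X}
    (h : ∀ ξ, G.theta ξ = G'.theta ξ) : G = G' := by
  refine ext_of_action fun f => ?_
  apply ConcreteCategory.hom_ext
  intro x
  rw [G.action_eq_gammaMap hX, G'.action_eq_gammaMap hX]
  congr 1
  funext ξ
  exact h ξ

/-- The Γ-structure given by a braiding. -/
noncomputable def ofBraiding (hX : X.IsTwoSegal) {θ : X _⦋2⦌ → X _⦋2⦌} (hθ : X.IsBraiding θ) :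
    GammaStructure X where
  functor :=
    { obj A := X _⦋A.card⦌
      map {A B} f := ↾(SSet.gammaMap (n := A.card) (k := B.card) θ f)
      map_id A := by
        apply ConcreteCategory.hom_ext
        intro x
        exact hθ.gammaMap_id hX x
      map_comp {A B C} f g := by
        apply ConcreteCategory.hom_ext
        intro x
        exact hθ.gammaMap_comp hX (n := A.card) (k := B.card) (l := C.card) f g x }
  cut_comp := by
    refine CategoryTheory.Functor.ext (fun x => rfl) fun x y α => ?_
    apply ConcreteCategory.hom_ext
    intro a
    exact hθ.gammaMap_cutHom hX (k := y.unop.len) (n := x.unop.len) α.unop a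

theorem theta_ofBraiding (hX : X.IsTwoSegal) {θ : X _⦋2⦌ → X _⦋2⦌} (hθ : X.IsBraiding θ)
    (ξ : X _⦋2⦌) : (ofBraiding hX hθ).theta ξ = θ ξ :=
  hθ.gammaMap_swap hX ξ

end GammaStructure

/-! ### Commutative structures and their braidings. -/

/-- Elements of the common target of the two sides of the hexagon equation. -/
theorem hexagon_ext {Y : SpanSet.{u}} {μ : Y ⊠ Y ⟶ Y}
    (p q : SetSpan.apex (assoc₁ Y Y Y ≫ braid Y (Y ⊠ Y) ≫ assoc₁ Y Y Y ≫ (𝟙 Y ⊠₁ μ) ≫ μ))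
    (h₀ : SetSpan.left (assoc₁ Y Y Y ≫ braid Y (Y ⊠ Y) ≫ assoc₁ Y Y Y ≫ (𝟙 Y ⊠₁ μ) ≫ μ) p =
      SetSpan.left (assoc₁ Y Y Y ≫ braid Y (Y ⊠ Y) ≫ assoc₁ Y Y Y ≫ (𝟙 Y ⊠₁ μ) ≫ μ) q)
    (h₁ : p.1.2.1.2.1.2.1.1.2 = q.1.2.1.2.1.2.1.1.2)
    (h₂ : p.1.2.1.2.1.2.1.2 = q.1.2.1.2.1.2.1.2) : p = q := by
  obtain ⟨⟨p₁, ⟨⟨p₂, ⟨⟨p₃, ⟨⟨⟨p₄, p₅⟩, p₆⟩, e₄⟩⟩, e₃⟩⟩, e₂⟩⟩, e₁⟩ := p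
  obtain ⟨⟨q₁, ⟨⟨q₂, ⟨⟨q₃, ⟨⟨⟨q₄, q₅⟩, q₆⟩, f₄⟩⟩, f₃⟩⟩, f₂⟩⟩, f₁⟩ := q
  -- Apart from the two 2-simplices, every component is fixed successively by the left leg through
  -- the fibre product conditions.
  obtain rfl : p₁ = q₁ := h₀
  dsimp only at h₁ h₂
  subst h₁ h₂
  obtain rfl : p₂ = q₂ := Eq.trans (Eq.symm e₁) f₁
  obtain rfl : p₃ = q₃ := Eq.trans (Eq.symm e₂) f₂
  obtain rfl : p₄ = q₄ := (Prod.mk.inj (Eq.trans (Eq.symm e₃) f₃)).1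
  rfl

section Commutative

variable {X : SSet.{u}}

/-- The map of 2-simplices which underlies a 2-morphism from `μ` to `μ ∘ ρ`. -/
def SSet.braidingMap (γ : X.spanMul ≅ braid X.spanObj X.spanObj ≫ X.spanMul) (ξ : X _⦋2⦌) :
    X _⦋2⦌ :=
  (SetSpan.app γ.hom ξ).1.2

theorem SSet.δ_braidingMap (γ : X.spanMul ≅ braid X.spanObj X.spanObj ≫ X.spanMul) (ξ : X _⦋2⦌) :
    X.δ 2 (SSet.braidingMap γ ξ) = X.δ 0 ξ ∧ X.δ 0 (SSet.braidingMap γ ξ) = X.δ 2 ξ ∧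
      X.δ 1 (SSet.braidingMap γ ξ) = X.δ 1 ξ := by
  have h₁ : (SetSpan.app γ.hom ξ).1.1 = (X.δ 2 ξ, X.δ 0 ξ) := left_app γ.hom ξ
  have h₂ : ((SetSpan.app γ.hom ξ).1.1.2, (SetSpan.app γ.hom ξ).1.1.1) =
    (X.δ 2 (SSet.braidingMap γ ξ), X.δ 0 (SSet.braidingMap γ ξ)) := (SetSpan.app γ.hom ξ).2
  rw [h₁] at h₂
  exact ⟨(Prod.mk.inj h₂).1.symm, (Prod.mk.inj h₂).2.symm, right_app γ.hom ξ⟩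

theorem SSet.app_eq_braidingMap (γ : X.spanMul ≅ braid X.spanObj X.spanObj ≫ X.spanMul)
    (ξ : X _⦋2⦌) : (SetSpan.app γ.hom ξ).1 = ((X.δ 2 ξ, X.δ 0 ξ), SSet.braidingMap γ ξ) :=
  Prod.ext (left_app γ.hom ξ) rfl

theorem symmetryEquation_iff (γ : X.spanMul ≅ braid X.spanObj X.spanObj ≫ X.spanMul) :
    SymmetryEquation X.spanMul γ ↔
      ∀ ξ, SSet.braidingMap γ (SSet.braidingMap γ ξ) = ξ := by
  constructor
  · intro h ξ
    exact congrArg (fun φ : X.spanMul ⟶ braid X.spanObj X.spanObj ≫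
      braid X.spanObj X.spanObj ≫ X.spanMul => (SetSpan.app φ ξ).1.2.1.2) h
  · intro h
    refine SetSpan.hom_ext fun ξ => ?_
    refine Subtype.ext (Prod.ext (left_app γ.hom ξ) (Subtype.ext (Prod.ext ?_ (h ξ))))
    have h₁ := left_app γ.hom (SSet.braidingMap γ ξ)
    have h₂ := SSet.δ_braidingMap γ ξ
    exact Eq.trans h₁ (Prod.ext h₂.1 h₂.2.1)

/-- Evaluate both sides at `(d_3 ψ, d_1 ψ)`. The route `a`, `γ`, `a` passes through `(d_3 χ, d_1 χ)`
and ends with the faces `d_2` and `d_0` of `χ`; the other route passes through `(d_3 φ, d_1 φ)` and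
ends with `d_2 φ` and the image of `d_0 φ` under the braiding. -/
theorem hexagonEquation_iff (hX : X.IsTwoSegal)
    (γ : X.spanMul ≅ braid X.spanObj X.spanObj ≫ X.spanMul) :
    HexagonEquation X.spanMul hX.spanAssoc γ ↔
      ∀ ψ φ χ : X _⦋3⦌, X.δ 3 φ = SSet.braidingMap γ (X.δ 3 ψ) → X.δ 1 φ = X.δ 1 ψ →
        X.δ 3 χ = X.δ 0 ψ → X.δ 1 χ = SSet.braidingMap γ (X.δ 2 ψ) →
        X.δ 0 χ = SSet.braidingMap γ (X.δ 0 φ) ∧ X.δ 2 χ = X.δ 2 φ := by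
  have ha := fun ψ p => hX.spanAssoc_app ψ p
  -- Only the values of the associator on pairs `(d_3 ψ, d_1 ψ)` matter.
  generalize hX.spanAssoc = a at ha ⊢
  constructor
  · intro h ψ φ χ h₁ h₂ h₃ h₄
    let T := (X.spanMul ⊠₁ 𝟙 X.spanObj) ≫ X.spanMul ⟶
      assoc₁ X.spanObj X.spanObj X.spanObj ≫ braid X.spanObj (X.spanObj ⊠ X.spanObj) ≫
        assoc₁ X.spanObj X.spanObj X.spanObj ≫ (𝟙 X.spanObj ⊠₁ X.spanMul) ≫ X.spanMul
    have hp := ha ψ (SetSpan.app hX.isoA.hom ψ) rfl rfl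
    constructor
    · have e := congrArg (fun ω : T =>
        (SetSpan.app ω (SetSpan.app hX.isoA.hom ψ)).1.2.1.2.1.2.1.1.2) h
      exact ((ha χ _ (hp.1.trans h₃.symm)
        ((congrArg (SSet.braidingMap γ) hp.2).trans h₄.symm)).1.symm.trans e).trans
          (congrArg (SSet.braidingMap γ) (ha φ _ h₁.symm h₂.symm).1)
    · have e := congrArg (fun ω : T =>
        (SetSpan.app ω (SetSpan.app hX.isoA.hom ψ)).1.2.1.2.1.2.1.2) h
      exact ((ha χ _ (hp.1.trans h₃.symm)
        ((congrArg (SSet.braidingMap γ) hp.2).trans h₄.symm)).2.symm.trans e).trans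
          (ha φ _ h₁.symm h₂.symm).2
  · intro h
    refine SetSpan.hom_ext fun p => ?_
    -- By the 2-Segal condition every element of the source comes from some `ψ`, and the
    -- intermediate simplices `φ` and `χ` exist.
    have key : ∃ ψ φ χ : X _⦋3⦌, X.δ 3 φ = SSet.braidingMap γ (X.δ 3 ψ) ∧ X.δ 1 φ = X.δ 1 ψ ∧
        X.δ 3 χ = X.δ 0 ψ ∧ X.δ 1 χ = SSet.braidingMap γ (X.δ 2 ψ) ∧
        p.1.1.1 = X.δ 3 ψ ∧ p.1.2 = X.δ 1 ψ := by
      obtain ⟨⟨⟨ξ, x⟩, ξ'⟩, e⟩ := p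
      obtain ⟨ψ, rfl, rfl⟩ := hX.existsA (Prod.mk.inj e).1
      obtain ⟨φ, h₁, h₂⟩ := hX.existsA (ξ := SSet.braidingMap γ (X.δ 3 ψ)) (ξ' := X.δ 1 ψ)
        ((SSet.δ_braidingMap γ _).2.2.trans (Prod.mk.inj e).1)
      obtain ⟨χ, h₃, h₄⟩ := hX.existsA (ξ := X.δ 0 ψ) (ξ' := SSet.braidingMap γ (X.δ 2 ψ))
        ((X.δ_δ_apply (i := 0) (j := 1) (by decide) ψ).symm.trans
          (SSet.δ_braidingMap γ _).1.symm)
      exact ⟨ψ, φ, χ, h₁, h₂, h₃, h₄, rfl, rfl⟩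
    obtain ⟨ψ, φ, χ, h₁, h₂, h₃, h₄, h₅, h₆⟩ := key
    have hp := ha ψ p h₅ h₆
    have hh := h ψ φ χ h₁ h₂ h₃ h₄
    let q : SetSpan.apex ((X.spanMul ⊠₁ 𝟙 X.spanObj) ≫ X.spanMul) :=
      ⟨((SSet.braidingMap γ p.1.1.1, p.1.1.2), p.1.2),
        Prod.ext ((SSet.δ_braidingMap γ p.1.1.1).2.2.trans (Prod.mk.inj p.2).1)
          (Prod.mk.inj p.2).2⟩
    have hq := ha φ q ((congrArg (SSet.braidingMap γ) h₅).trans h₁.symm) (h₆.trans h₂.symm)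
    refine hexagon_ext _ _ ?_ ?_ ?_
    · exact (left_app _ p).trans (left_app _ p).symm
    · exact ((ha χ _ (hp.1.trans h₃.symm)
        ((congrArg (SSet.braidingMap γ) hp.2).trans h₄.symm)).1.trans hh.1).trans
          (congrArg (SSet.braidingMap γ) hq.1.symm)
    · exact ((ha χ _ (hp.1.trans h₃.symm)
        ((congrArg (SSet.braidingMap γ) hp.2).trans h₄.symm)).2.trans hh.2).trans hq.2.symm

/-- The invertible 2-morphism from `μ` to `μ ∘ ρ` given by a braiding. -/
def SSet.IsBraiding.spanIso {θ : X _⦋2⦌ → X _⦋2⦌} (hθ : X.IsBraiding θ) :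
    X.spanMul ≅ braid X.spanObj X.spanObj ≫ X.spanMul :=
  isoOfEquiv (f := X.spanMul) (g := braid X.spanObj X.spanObj ≫ X.spanMul)
    { toFun := fun ξ => ⟨((X.δ 2 ξ, X.δ 0 ξ), θ ξ),
        Prod.ext (hθ.δ_two ξ).symm (hθ.δ_zero ξ).symm⟩
      invFun := fun p => θ p.1.2
      left_inv := hθ.invol
      right_inv := by
        rintro ⟨⟨⟨x, y⟩, ξ⟩, h⟩
        obtain ⟨rfl, rfl⟩ : y = X.δ 2 ξ ∧ x = X.δ 0 ξ := Prod.mk.inj h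
        exact Subtype.ext (Prod.ext (Prod.ext (hθ.δ_two ξ) (hθ.δ_zero ξ)) (hθ.invol ξ)) }
    (fun _ => rfl) hθ.δ_one

/-- The commutative structure given by a braiding. -/
noncomputable def SSet.IsBraiding.commStructure {θ : X _⦋2⦌ → X _⦋2⦌} (hθ : X.IsBraiding θ)
    (hX : X.IsTwoSegal) : CommStructure hX.pseudomonoid where
  γ := hθ.spanIso
  symmetry := (symmetryEquation_iff hθ.spanIso).2 hθ.invol
  hexagon := (hexagonEquation_iff hX hθ.spanIso).2 hθ.hexagon

theorem CommStructure.isBraiding {hX : X.IsTwoSegal} (c : CommStructure hX.pseudomonoid) :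
    X.IsBraiding (SSet.braidingMap c.γ) where
  δ_two ξ := (SSet.δ_braidingMap c.γ ξ).1
  δ_zero ξ := (SSet.δ_braidingMap c.γ ξ).2.1
  δ_one ξ := (SSet.δ_braidingMap c.γ ξ).2.2
  invol := (symmetryEquation_iff c.γ).1 c.symmetry
  hexagon := (hexagonEquation_iff hX c.γ).1 c.hexagon

/-- Equivalence is equality of the 2-morphisms, and the left leg fixes their components outside the
2-simplices. -/
theorem CommStructure.equivalent_iff {hX : X.IsTwoSegal} (c c' : CommStructure hX.pseudomonoid) :
    c.Equivalent c' ↔ ∀ ξ, SSet.braidingMap c.γ ξ = SSet.braidingMap c'.γ ξ := by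
  have h : c.Equivalent c' ↔ c.γ.hom = c'.γ.hom := by simp [CommStructure.Equivalent]
  rw [h]
  constructor
  · intro h ξ
    exact congrArg (fun φ : X.spanMul ⟶ braid X.spanObj X.spanObj ≫ X.spanMul =>
      (SetSpan.app φ ξ).1.2) h
  · intro h
    refine SetSpan.hom_ext fun ξ => Subtype.ext ?_
    exact (SSet.app_eq_braidingMap c.γ ξ).trans
      ((congrArg (Prod.mk _) (h ξ)).trans (SSet.app_eq_braidingMap c'.γ ξ).symm)

end Commutative

/-! ### The correspondence. -/

theorem theorem5 (X : SSet.{u}) (hX : X.IsTwoSegal) :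
    ∃ e : GammaStructure X ≃ Quotient (CommStructure.setoid hX.pseudomonoid),
      ∀ G : GammaStructure X, ∃ c : CommStructure hX.pseudomonoid,
        e G = Quotient.mk (CommStructure.setoid hX.pseudomonoid) c ∧
          ∀ ξ : X _⦋2⦌, (SetSpan.app c.γ.hom ξ).1.2 = G.theta ξ := by
  let comm (G : GammaStructure X) : CommStructure hX.pseudomonoid :=
    (G.isBraiding_theta hX).commStructure hX
  refine ⟨Equiv.ofBijective (fun G => Quotient.mk (CommStructure.setoid hX.pseudomonoid) (comm G))
    ⟨fun G G' h => ?_, fun q => ?_⟩, fun G => ⟨comm G, rfl, fun _ => rfl⟩⟩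
  · exact GammaStructure.ext_of_theta hX
      ((CommStructure.equivalent_iff (comm G) (comm G')).1 (Quotient.exact h))
  · obtain ⟨c, rfl⟩ := Quotient.exists_rep q
    exact ⟨GammaStructure.ofBraiding hX c.isBraiding, Quotient.sound
      ((CommStructure.equivalent_iff _ c).2 (GammaStructure.theta_ofBraiding hX c.isBraiding))⟩
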